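/- All manifolds are smooth, finite-dimensional and without boundary, and "smooth" means $C^\infty$. Let $\Gamma\rightrightarrows M$ be a Lie groupoid with source $\alpha$, target $\beta$ (submersions), identity section $\epsilon$ and inversion $i$; let $\dim M=m$ and $\dim\Gamma=m+n$. Let $E_\Gamma\to M$, $(E_\Gamma)_x=\ker T_{\epsilon(x)}\alpha$, be its Lie algebroid, and write $l_g(k)=gk$, $r_g(k)=kg$. Let $V_g\alpha=\ker T_g\alpha$, $V_g\beta=\ker T_g\beta$, and let $\mathcal T^\Gamma\Gamma\to\Gamma$ be the Lie algebroid with fibers $\mathcal T^\Gamma_g\Gamma=V_g\beta\oplus V_g\alpha$, anchor $\rho(X,Y)=X+Y$ and bracket determined by $$[\![(\overrightarrow X,\overleftarrow Y),(\overrightarrow{X'},\overleftarrow{Y'})]\!]=(-\overrightarrow{[\![X,X']\!]},\overleftarrow{[\![Y,Y']\!]})=([\overrightarrow X,\overrightarrow{X'}],[\overleftarrow Y,\overleftarrow{Y'}])$$ for sections $X,Y,X',Y'$ of $E_\Gamma$, where $\overleftarrow X(g)=T_{\epsilon(\beta(g))}l_g(X(\beta(g)))$ and $\overrightarrow X(g)=-T_{\epsilon(\alpha(g))}(r_g\circ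 i)(X(\alpha(g)))$. For a smooth function $L_d:\Gamma\to\mathbb R$ put $\Theta^+_{L_d}(g)(X_g,Y_g)=Y_g(L_d)$ and $\Omega_{L_d}=-d\Theta^+_{L_d}$, where $d$ is the differential of the Lie algebroid $\mathcal T^\Gamma\Gamma$; for $a\in(E_\Gamma)_{\alpha(g)}$ and $b\in(E_\Gamma)_{\beta(g)}$ put $$G_g^{L_d}(a,b)=\Omega_{L_d}(g)\big((-T_{\epsilon(\alpha(g))}(r_g\circ i)(a),0),(0,T_{\epsilon(\beta(g))}l_g(b))\big).$$ Let $(L_d,\mathcal M_c,\mathcal D_c)$ be a discrete nonholonomic Lagrangian system on $\Gamma$: $L_d:\Gamma\to\mathbb R$ is smooth and regular (that is, $\Omega_{L_d}(g)$ is nondegenerate for every $g\in\Gamma$), $\mathcal D_c$ is a smooth vector subbundle of $E_\Gamma$ of rank $r$, and $\mathcal M_c$ is an embedded submanifold of $\Gamma$ of dimension $m+r$. Its Legendre transformations $\mathbb F^\pm:\mathcal M_c\to\mathcal D_c^*$ are given by $$\mathbb F^-(h)(v)=-v(L_d\circ r_h\circ i)\quad (v\in\mathcal D_c(\alpha(h))),\qquad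 \mathbb F^+(g)(v)=v(L_d\circ l_g)\quad (v\in\mathcal D_c(\beta(g))),$$ and the system is called regular if $\mathbb F^-$ and $\mathbb F^+$ are both local diffeomorphisms. With $^0$ denoting annihilators, let $$F_h=\{\gamma_h^{(1,0)}\mid\gamma\in\mathcal D_c(\alpha(h))^0\}^0,\qquad \bar F_g=\{\gamma_g^{(0,1)}\mid\gamma\in\mathcal D_c(\beta(g))^0\}^0,$$ where $\gamma_h^{(1,0)}(X,Y)=\gamma(T_h(i\circ r_{h^{-1}})(X))$ and $\gamma_g^{(0,1)}(X,Y)=\gamma(T_gl_{g^{-1}}(Y))$, and let $^\perp$ denote the orthogonal with respect to $\Omega_{L_d}$. For $h,g\in\mathcal M_c$ let $\mathcal H_h=\rho^{-1}(T_h\mathcal M_c)\cap F_h$ and $\bar{\mathcal H}_g=\rho^{-1}(T_g\mathcal M_c)\cap\bar F_g$; let $G_h^{L_dc}$ be the restriction of $G_h^{L_d}$ to $\mathcal D_c(\alpha(h))\times\{b\in(E_\Gamma)_{\beta(h)}\mid T_{\epsilon(\beta(h))}l_h(b)\in T_h\mathcal M_c\}$, and let $\bar G_g^{L_dc}$ be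 the restriction of $G_g^{L_d}$ to $\{a\in(E_\Gamma)_{\alpha(g)}\mid T_{\epsilon(\alpha(g))}(r_g\circ i)(a)\in T_g\mathcal M_c\}\times\mathcal D_c(\beta(g))$. Then the following conditions are equivalent: 1. The system $(L_d,\mathcal M_c,\mathcal D_c)$ is regular. 2. $\rho^{-1}(T_h\mathcal M_c)\cap F_h^\perp=\{0\}$ for all $h\in\mathcal M_c$, and $\rho^{-1}(T_g\mathcal M_c)\cap\bar F_g^\perp=\{0\}$ for all $g\in\mathcal M_c$. 3. $\mathcal H$ and $\bar{\mathcal H}$ are symplectic subbundles of rank $2r$ of $(\mathcal T^\Gamma_{\mathcal M_c}\Gamma,\Omega_{L_d})$, that is, they are smooth vector subbundles of rank $2r$ of the restriction of $\mathcal T^\Gamma\Gamma$ to $\mathcal M_c$ and $\Omega_{L_d}$ is nondegenerate on each of their fibers. 4. For all $g,h\in\mathcal M_c$, $G_h^{L_dc}$ is right nondegenerate and $\bar G_g^{L_dc}$ is left nondegenerate: if $G_h^{L_dc}(a,b)=0$ for all $a\in\mathcal D_c(\alpha(h))$ then $b=0$, and if $\bar G_g^{L_dc}(a,b)=0$ for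 all $b\in\mathcal D_c(\beta(g))$ then $a=0$. -/

import Mathlib

open scoped Manifold ContDiff Bundle Topology
open Set Manifold

noncomputable section

/-- Through every vector tangent to a fiber of a submersion there is a curve in that fiber. -/
theorem exists_curve_in_fiber {p q : ℕ} {A B : Type*}
    [TopologicalSpace A] [ChartedSpace (EuclideanSpace ℝ (Fin p)) A]
    [IsManifold (𝓡 p) ∞ A]
    [TopologicalSpace B] [ChartedSpace (EuclideanSpace ℝ (Fin q)) B]
    [IsManifold (𝓡 q) ∞ B]
    {f : A → B} {a : A} (hf : IsSubmersionAt (𝓡 p) (𝓡 q) ∞ f a)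
    (v : TangentSpace (𝓡 p) a) (hv : mfderiv (𝓡 p) (𝓡 q) f a v = 0) :
    ∃ c : ℝ → A, c 0 = a ∧ (∀ᶠ t in 𝓝 (0 : ℝ), f (c t) = f a) ∧
      MDifferentiableAt 𝓘(ℝ, ℝ) (𝓡 p) c 0 ∧
      (mfderiv 𝓘(ℝ, ℝ) (𝓡 p) c 0 (1 : ℝ) : EuclideanSpace ℝ (Fin p)) = v := by
  set e := hf.domChart
  set d := hf.codChart
  have hea : a ∈ e.source := hf.mem_domChart_source
  have hda : f a ∈ d.source := hf.mem_codChart_source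
  have he : e.MDifferentiable (𝓡 p) (𝓡 p) :=
    ⟨(contMDiffOn_of_mem_maximalAtlas hf.domChart_mem_maximalAtlas).mdifferentiableOn (by simp),
     (contMDiffOn_symm_of_mem_maximalAtlas hf.domChart_mem_maximalAtlas).mdifferentiableOn (by simp)⟩
  have hd : d.MDifferentiable (𝓡 q) (𝓡 q) :=
    ⟨(contMDiffOn_of_mem_maximalAtlas hf.codChart_mem_maximalAtlas).mdifferentiableOn (by simp),
     (contMDiffOn_symm_of_mem_maximalAtlas hf.codChart_mem_maximalAtlas).mdifferentiableOn (by simp)⟩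
  have key : ∀ y ∈ e.target, d (f (e.symm y)) = (hf.equiv y).1 := by
    intro y hy
    have hy' : y ∈ (hf.domChart.extend (𝓡 p)).target := by
      simpa [OpenPartialHomeomorph.extend_target] using hy
    simpa using hf.writtenInCharts hy'
  have hfa : MDifferentiableAt (𝓡 p) (𝓡 q) f a := hf.contMDiffAt.mdifferentiableAt (by simp)
  let w : EuclideanSpace ℝ (Fin p) := mfderiv (𝓡 p) (𝓡 p) e a v
  have hes : MDifferentiableAt (𝓡 p) (𝓡 p) e.symm (e a) := he.mdifferentiableAt_symm (e.map_source hea)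
  have hw : mfderiv (𝓡 p) (𝓡 p) e.symm (e a) w = v := by
    have := he.symm_comp_deriv hea
    exact congrArg (fun L => L v) this
  have hea' : e.symm (e a) = a := e.left_inv hea
  have hw0 : (hf.equiv w).1 = 0 := by
    have h1 : mfderiv (𝓡 p) (𝓡 q) (fun y => (hf.equiv y).1) (e a) w = (hf.equiv w).1 := by
      rw [mfderiv_eq_fderiv]
      let P : EuclideanSpace ℝ (Fin p) →L[ℝ] EuclideanSpace ℝ (Fin q) :=
        (ContinuousLinearMap.fst ℝ _ hf.complement).comp
          (hf.equiv : EuclideanSpace ℝ (Fin p) →L[ℝ] (EuclideanSpace ℝ (Fin q) × hf.complement))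
      have : HasFDerivAt (fun y => (hf.equiv y).1) P (e a) := P.hasFDerivAt
      rw [this.fderiv]; rfl
    rw [← h1]
    have h2 : (fun y => (hf.equiv y).1) =ᶠ[𝓝 (e a)] (d ∘ (f ∘ e.symm)) := by
      filter_upwards [e.open_target.mem_nhds (e.map_source hea)] with y hy
      exact (key y hy).symm
    have h3 : HasMFDerivAt (𝓡 p) (𝓡 q) (f ∘ e.symm) (e a) _ :=
      HasMFDerivAt.comp (e a)
        (show MDifferentiableAt (𝓡 p) (𝓡 q) f (e.symm (e a)) by rw [hea']; exact hfa).hasMFDerivAt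
        hes.hasMFDerivAt
    have h4 : MDifferentiableAt (𝓡 q) (𝓡 q) d ((f ∘ e.symm) (e a)) := by
      simp only [Function.comp, hea']; exact hd.mdifferentiableAt hda
    have h6 := (HasMFDerivAt.comp (e a) h4.hasMFDerivAt h3).congr_of_eventuallyEq h2
    have h5 : mfderiv (𝓡 p) (𝓡 q) f (e.symm (e a)) v = 0 := by
      rw [hea']; exact hv
    have h7 := congrArg (fun L => L w) h6.mfderiv
    refine h7.trans ?_
    change mfderiv (𝓡 q) (𝓡 q) d ((f ∘ e.symm) (e a))
      (mfderiv (𝓡 p) (𝓡 q) f (e.symm (e a)) (mfderiv (𝓡 p) (𝓡 p) e.symm (e a) w)) = 0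
    rw [hw]
    exact (congrArg _ h5).trans (map_zero _)
  let ℓ : ℝ → EuclideanSpace ℝ (Fin p) := fun t => e a + t • w
  have hℓ : HasFDerivAt ℓ ((1 : ℝ →L[ℝ] ℝ).smulRight w) 0 := by
    have := ((hasFDerivAt_id (𝕜 := ℝ) (0:ℝ)).smul_const w).const_add (e a)
    exact this
  have hℓ0 : ℓ 0 = e a := by simp [ℓ]
  refine ⟨fun t => e.symm (ℓ t), by simp [hℓ0, hea'], ?_, ?_, ?_⟩
  · have h1 : ∀ᶠ t in 𝓝 (0:ℝ), ℓ t ∈ e.target :=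
      hℓ.continuousAt.eventually_mem (by rw [hℓ0]; exact e.open_target.mem_nhds (e.map_source hea))
    filter_upwards [h1] with t ht
    have h2 : e.symm (ℓ t) ∈ e.source := e.map_target ht
    apply d.injOn (hf.source_subset_preimage_source h2) hda
    have h3 := key _ (e.map_source hea)
    rw [hea'] at h3
    change d (f (e.symm (ℓ t))) = d (f a)
    rw [key _ ht, h3]
    simp [ℓ, hw0]
  · exact MDifferentiableAt.comp (0:ℝ) (by rw [hℓ0]; exact hes) hℓ.differentiableAt.mdifferentiableAt
  · have h8 : HasMFDerivAt 𝓘(ℝ, ℝ) (𝓡 p) (e.symm ∘ ℓ) 0 _ :=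
      HasMFDerivAt.comp (0:ℝ)
        (show MDifferentiableAt (𝓡 p) (𝓡 p) e.symm (ℓ 0) by rw [hℓ0]; exact hes).hasMFDerivAt
        hℓ.hasMFDerivAt
    refine (congrArg (fun L => L (1:ℝ)) h8.mfderiv).trans ?_
    change mfderiv (𝓡 p) (𝓡 p) e.symm (ℓ 0) ((1:ℝ) • w) = v
    rw [one_smul, hℓ0]
    exact hw

/-- If `φ` maps the fiber of the submersion `f` through `a` into a level set of `ψ`, then the
derivative of `φ` along the fiber maps vectors tangent to the fiber into the kernel of the
derivative of `ψ`. (`mfderivWithin` along a fiber is some linear extension of the derivative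
of the restriction to the fiber, and only its values on vectors tangent to the fiber are used.) -/
theorem mfderiv_mfderivWithin_fiber {p q k s : ℕ} {A B C D : Type*}
    [TopologicalSpace A] [ChartedSpace (EuclideanSpace ℝ (Fin p)) A] [IsManifold (𝓡 p) ∞ A]
    [TopologicalSpace B] [ChartedSpace (EuclideanSpace ℝ (Fin q)) B] [IsManifold (𝓡 q) ∞ B]
    [TopologicalSpace C] [ChartedSpace (EuclideanSpace ℝ (Fin k)) C]
    [TopologicalSpace D] [ChartedSpace (EuclideanSpace ℝ (Fin s)) D]
    {f : A → B} {φ : A → C} {ψ : C → D} {a : A} {b : B} {y : C} {z : D}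
    (hf : IsSubmersionAt (𝓡 p) (𝓡 q) ∞ f a) (hb : f a = b) (hy : φ a = y)
    (hψ : MDifferentiableAt (𝓡 k) (𝓡 s) ψ y) (hz : ∀ a', f a' = b → ψ (φ a') = z)
    (v : TangentSpace (𝓡 p) a) (hv : mfderiv (𝓡 p) (𝓡 q) f a v = 0) :
    mfderiv (𝓡 k) (𝓡 s) ψ y (mfderivWithin (𝓡 p) (𝓡 k) φ (f ⁻¹' {b}) a v :
      EuclideanSpace ℝ (Fin k)) = 0 := by
  subst hb hy
  by_cases hφ : MDifferentiableWithinAt (𝓡 p) (𝓡 k) φ (f ⁻¹' {f a}) a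
  swap
  · rw [mfderivWithin_zero_of_not_mdifferentiableWithinAt hφ]; exact map_zero _
  obtain ⟨c, hc0, hcf, hcd, hcv⟩ := exists_curve_in_fiber hf v hv
  subst hc0
  have h1 : HasMFDerivWithinAt 𝓘(ℝ, ℝ) (𝓡 p) c (c ⁻¹' (f ⁻¹' {f (c 0)})) 0 _ := hcd.hasMFDerivAt.hasMFDerivWithinAt
  have h2 := hψ.hasMFDerivAt.comp_hasMFDerivWithinAt 0 (hφ.hasMFDerivWithinAt.comp 0 h1 subset_rfl)
  have h3 := h2.hasMFDerivAt hcf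
  have h4 : HasMFDerivAt 𝓘(ℝ, ℝ) (𝓡 s) (ψ ∘ φ ∘ c) 0 0 := by
    refine (hasMFDerivAt_const z (0:ℝ)).congr_of_eventuallyEq ?_
    filter_upwards [hcf] with t ht using hz _ ht
  have h5 := congrArg (fun L => L (1:ℝ)) (hasMFDerivAt_unique h3 h4)
  rw [← hcv]
  exact h5

/-- A Lie groupoid `Γ ⇉ M` with `dim M = m` and `dim Γ = m + n` (so its Lie algebroid has
rank `n`). The multiplication is a total function in Lean, but it is only meaningful, and is only
ever used, on the set of composable pairs `{(g, h) | β g = α h}`. -/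
structure LieGroupoid (m n : ℕ) (Γ M : Type*)
    [TopologicalSpace Γ] [ChartedSpace (EuclideanSpace ℝ (Fin (m + n))) Γ]
    [IsManifold (𝓡 (m + n)) ∞ Γ]
    [TopologicalSpace M] [ChartedSpace (EuclideanSpace ℝ (Fin m)) M]
    [IsManifold (𝓡 m) ∞ M] where
  /-- the source `α` -/
  src : Γ → M
  /-- the target `β` -/
  tgt : Γ → M
  /-- the identity section `ε` -/
  unit : M → Γ
  /-- the inversion `i` -/
  inv : Γ → Γ
  /-- the multiplication `(g, h) ↦ g h`, for `β g = α h` -/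
  mul : Γ → Γ → Γ
  isSubmersion_src : IsSubmersion (𝓡 (m + n)) (𝓡 m) ∞ src
  isSubmersion_tgt : IsSubmersion (𝓡 (m + n)) (𝓡 m) ∞ tgt
  contMDiff_unit : ContMDiff (𝓡 m) (𝓡 (m + n)) ∞ unit
  contMDiff_inv : ContMDiff (𝓡 (m + n)) (𝓡 (m + n)) ∞ inv
  contMDiffOn_mul : ContMDiffOn ((𝓡 (m + n)).prod (𝓡 (m + n))) (𝓡 (m + n)) ∞
    (fun p : Γ × Γ => mul p.1 p.2) {p | tgt p.1 = src p.2}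
  src_mul : ∀ g h, tgt g = src h → src (mul g h) = src g
  tgt_mul : ∀ g h, tgt g = src h → tgt (mul g h) = tgt h
  mul_assoc : ∀ g h k, tgt g = src h → tgt h = src k → mul g (mul h k) = mul (mul g h) k
  src_unit : ∀ x, src (unit x) = x
  tgt_unit : ∀ x, tgt (unit x) = x
  unit_mul : ∀ g, mul (unit (src g)) g = g
  mul_unit : ∀ g, mul g (unit (tgt g)) = g
  src_inv : ∀ g, src (inv g) = tgt g
  tgt_inv : ∀ g, tgt (inv g) = src g
  inv_mul : ∀ g, mul (inv g) g = unit (tgt g)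
  mul_inv : ∀ g, mul g (inv g) = unit (src g)

namespace LieGroupoid

variable {m n : ℕ} {Γ M : Type*}
  [TopologicalSpace Γ] [ChartedSpace (EuclideanSpace ℝ (Fin (m + n))) Γ]
  [IsManifold (𝓡 (m + n)) ∞ Γ]
  [TopologicalSpace M] [ChartedSpace (EuclideanSpace ℝ (Fin m)) M]
  [IsManifold (𝓡 m) ∞ M]
  (G : LieGroupoid m n Γ M)

theorem inv_unit (x : M) : G.inv (G.unit x) = G.unit x := by
  have h1 := G.unit_mul (G.inv (G.unit x))
  rw [G.src_inv, G.tgt_unit, G.mul_inv, G.src_unit] at h1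
  exact h1.symm

theorem mdifferentiableAt_src (g : Γ) : MDifferentiableAt (𝓡 (m + n)) (𝓡 m) G.src g :=
  G.isSubmersion_src.contMDiff.contMDiffAt.mdifferentiableAt (by simp)

theorem mdifferentiableAt_tgt (g : Γ) : MDifferentiableAt (𝓡 (m + n)) (𝓡 m) G.tgt g :=
  G.isSubmersion_tgt.contMDiff.contMDiffAt.mdifferentiableAt (by simp)

/-- `V_g α = ker T_g α`. -/
def vertSrc (g : Γ) : Submodule ℝ (TangentSpace (𝓡 (m + n)) g) :=
  (mfderiv (𝓡 (m + n)) (𝓡 m) G.src g).ker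

/-- `V_g β = ker T_g β`. -/
def vertTgt (g : Γ) : Submodule ℝ (TangentSpace (𝓡 (m + n)) g) :=
  (mfderiv (𝓡 (m + n)) (𝓡 m) G.tgt g).ker

/-- The fiber `(E_Γ)_x = V_{ε(x)} α` of the Lie algebroid of `Γ`. -/
abbrev algFiber (x : M) : Submodule ℝ (TangentSpace (𝓡 (m + n)) (G.unit x)) :=
  G.vertSrc (G.unit x)

/-- The derivative at `ε(β(g))` of `l_g : α⁻¹(β(g)) → Γ`, `l_g(k) = g k`, along this fiber. -/
def dLeft (g : Γ) :
    TangentSpace (𝓡 (m + n)) (G.unit (G.tgt g)) →L[ℝ] TangentSpace (𝓡 (m + n)) g :=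
  mfderivWithin (𝓡 (m + n)) (𝓡 (m + n)) (fun k => G.mul g k) (G.src ⁻¹' {G.tgt g})
    (G.unit (G.tgt g))

/-- The derivative at `ε(α(g))` of `r_g ∘ i : α⁻¹(α(g)) → Γ`, `(r_g ∘ i)(k) = k⁻¹ g`, along this
fiber. -/
def dRightInv (g : Γ) :
    TangentSpace (𝓡 (m + n)) (G.unit (G.src g)) →L[ℝ] TangentSpace (𝓡 (m + n)) g :=
  mfderivWithin (𝓡 (m + n)) (𝓡 (m + n)) (fun k => G.mul (G.inv k) g) (G.src ⁻¹' {G.src g})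
    (G.unit (G.src g))

/-- The derivative at `g` of `l_{g⁻¹} : α⁻¹(α(g)) → Γ`, `l_{g⁻¹}(k) = g⁻¹ k`, along this
fiber. -/
def dLeftSymm (g : Γ) :
    TangentSpace (𝓡 (m + n)) g →L[ℝ] TangentSpace (𝓡 (m + n)) (G.unit (G.tgt g)) :=
  mfderivWithin (𝓡 (m + n)) (𝓡 (m + n)) (fun k => G.mul (G.inv g) k) (G.src ⁻¹' {G.src g}) g

/-- The derivative at `h` of `i ∘ r_{h⁻¹} : β⁻¹(β(h)) → Γ`, `(i ∘ r_{h⁻¹})(k) = (k h⁻¹)⁻¹`,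
along this fiber. -/
def dRightInvSymm (h : Γ) :
    TangentSpace (𝓡 (m + n)) h →L[ℝ] TangentSpace (𝓡 (m + n)) (G.unit (G.src h)) :=
  mfderivWithin (𝓡 (m + n)) (𝓡 (m + n)) (fun k => G.inv (G.mul k (G.inv h)))
    (G.tgt ⁻¹' {G.tgt h}) h

/-- `v ↦ v(f)` for `v ∈ (E_Γ)_x`: the derivative at `ε(x)` along the fiber `α⁻¹(x)` of a real
function `f` on that fiber. -/
def fiberDeriv (f : Γ → ℝ) (x : M) : TangentSpace (𝓡 (m + n)) (G.unit x) →L[ℝ] ℝ :=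
  mfderivWithin (𝓡 (m + n)) 𝓘(ℝ, ℝ) f (G.src ⁻¹' {x}) (G.unit x)

/-- `T_{ε(β(g))} l_g : (E_Γ)_{β(g)} → V_g α`, where `l_g : α⁻¹(β(g)) → α⁻¹(α(g))`,
`l_g(k) = g k`. -/
def tangentLeft (g : Γ) : G.algFiber (G.tgt g) →ₗ[ℝ] G.vertSrc g :=
  LinearMap.codRestrict (G.vertSrc g)
    ((G.dLeft g).toLinearMap.comp (G.algFiber (G.tgt g)).subtype)
    (fun v => mfderiv_mfderivWithin_fiber (G.isSubmersion_src.isSubmersionAt _) (G.src_unit _)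
      (G.mul_unit g) (G.mdifferentiableAt_src g) (z := G.src g)
      (fun k hk => G.src_mul g k hk.symm) v.1 v.2)

/-- `T_{ε(α(g))} (r_g ∘ i) : (E_Γ)_{α(g)} → V_g β`, where
`r_g ∘ i : α⁻¹(α(g)) → β⁻¹(β(g))`, `(r_g ∘ i)(k) = k⁻¹ g`. -/
def tangentRightInv (g : Γ) : G.algFiber (G.src g) →ₗ[ℝ] G.vertTgt g :=
  LinearMap.codRestrict (G.vertTgt g)
    ((G.dRightInv g).toLinearMap.comp (G.algFiber (G.src g)).subtype)
    (fun v => mfderiv_mfderivWithin_fiber (G.isSubmersion_src.isSubmersionAt _) (G.src_unit _)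
      (by rw [G.inv_unit, G.unit_mul]) (G.mdifferentiableAt_tgt g) (z := G.tgt g)
      (fun k hk => G.tgt_mul (G.inv k) g ((G.tgt_inv k).trans hk)) v.1 v.2)

/-- `T_g l_{g⁻¹} : V_g α → (E_Γ)_{β(g)}`, where `l_{g⁻¹} : α⁻¹(α(g)) → α⁻¹(β(g))`. -/
def tangentLeftSymm (g : Γ) : G.vertSrc g →ₗ[ℝ] G.algFiber (G.tgt g) :=
  LinearMap.codRestrict (G.algFiber (G.tgt g))
    ((G.dLeftSymm g).toLinearMap.comp (G.vertSrc g).subtype)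
    (fun v => mfderiv_mfderivWithin_fiber (G.isSubmersion_src.isSubmersionAt _) rfl
      (G.inv_mul g) (G.mdifferentiableAt_src _) (z := G.tgt g)
      (fun k hk => (G.src_mul _ k ((G.tgt_inv g).trans hk.symm)).trans (G.src_inv g)) v.1 v.2)

/-- `T_h (i ∘ r_{h⁻¹}) : V_h β → (E_Γ)_{α(h)}`, where `i ∘ r_{h⁻¹} : β⁻¹(β(h)) → α⁻¹(α(h))`,
`(i ∘ r_{h⁻¹})(k) = (k h⁻¹)⁻¹`. -/
def tangentRightInvSymm (h : Γ) : G.vertTgt h →ₗ[ℝ] G.algFiber (G.src h) :=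
  LinearMap.codRestrict (G.algFiber (G.src h))
    ((G.dRightInvSymm h).toLinearMap.comp (G.vertTgt h).subtype)
    (fun v => mfderiv_mfderivWithin_fiber (G.isSubmersion_tgt.isSubmersionAt _) rfl
      (by rw [G.mul_inv, G.inv_unit]) (G.mdifferentiableAt_src _) (z := G.src h)
      (fun k hk => by
        rw [G.src_inv, G.tgt_mul _ _ (hk.trans (G.src_inv h).symm), G.tgt_inv]) v.1 v.2)

/-- `a` is a section of the Lie algebroid `E_Γ → M` that is smooth on a neighbourhood of `x`. -/
def IsSectionNear (a : ∀ x, G.algFiber x) (x : M) : Prop :=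
  ∃ U : Set M, IsOpen U ∧ x ∈ U ∧
    ContMDiffOn (𝓡 m) (𝓡 (m + n)).tangent ∞
      (fun y => (⟨G.unit y, (a y).1⟩ : TangentBundle (𝓡 (m + n)) Γ)) U

/-- The left-invariant vector field `g ↦ (T_{ε(β(g))} l_g)(a(β(g)))` of a section `a`. -/
def leftField (a : ∀ x, G.algFiber x) (g : Γ) : G.vertSrc g := G.tangentLeft g (a (G.tgt g))

/-- The right-invariant vector field `g ↦ -(T_{ε(α(g))} (r_g ∘ i))(a(α(g)))` of a section `a`. -/
def rightField (a : ∀ x, G.algFiber x) (g : Γ) : G.vertTgt g :=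
  -G.tangentRightInv g (a (G.src g))

/-- The fiber `V_g β ⊕ V_g α` at `g` of the Lie algebroid `T^Γ Γ → Γ`. -/
abbrev Prol (g : Γ) : Type := G.vertTgt g × G.vertSrc g

/-- The anchor `(X, Y) ↦ X + Y` of `T^Γ Γ`. -/
def anchor (g : Γ) : G.Prol g →ₗ[ℝ] TangentSpace (𝓡 (m + n)) g :=
  (G.vertTgt g).subtype.coprod (G.vertSrc g).subtype

/-- `γ ↦ γ_h^{(1,0)}`, `γ_h^{(1,0)}(X, Y) = γ(T_h (i ∘ r_{h⁻¹})(X))`. -/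
def lift10 (h : Γ) :
    Module.Dual ℝ (G.algFiber (G.src h)) →ₗ[ℝ] Module.Dual ℝ (G.Prol h) :=
  (G.tangentRightInvSymm h ∘ₗ LinearMap.fst ℝ (G.vertTgt h) (G.vertSrc h)).dualMap

/-- `γ ↦ γ_g^{(0,1)}`, `γ_g^{(0,1)}(X, Y) = γ((T_g l_{g⁻¹})(Y))`. -/
def lift01 (g : Γ) :
    Module.Dual ℝ (G.algFiber (G.tgt g)) →ₗ[ℝ] Module.Dual ℝ (G.Prol g) :=
  (G.tangentLeftSymm g ∘ₗ LinearMap.snd ℝ (G.vertTgt g) (G.vertSrc g)).dualMap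

/-- `v ↦ v(f)` for `v ∈ T_g Γ`. -/
def dirDeriv (f : Γ → ℝ) (g : Γ) : TangentSpace (𝓡 (m + n)) g →L[ℝ] ℝ :=
  mfderiv (𝓡 (m + n)) 𝓘(ℝ, ℝ) f g

/-- The Poincaré-Cartan 1-section `Θ⁺(g)(X, Y) = Y(L)`, evaluated on any pair of tangent
vectors at `g`. -/
def thetaPlus (L : Γ → ℝ) (g : Γ)
    (p : TangentSpace (𝓡 (m + n)) g × TangentSpace (𝓡 (m + n)) g) : ℝ :=
  dirDeriv L g p.2

/-- The section `g ↦ (X_a(g), Y_b(g))` of `T^Γ Γ`, with `X_a` the right-invariant field of `a`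
and `Y_b` the left-invariant field of `b`. -/
def prolSection (a b : ∀ x, G.algFiber x) (g : Γ) : G.Prol g :=
  (G.rightField a g, G.leftField b g)

/-- The Lie bracket in `T^Γ Γ` of the sections `prolSection a b` and `prolSection a' b'`. It is
the pair (minus the right-invariant field of `⟦a, a'⟧`, the left-invariant field of `⟦b, b'⟧`),
that is, the pair of the brackets of the right-invariant and of the left-invariant fields. -/
def prolBracket (a b a' b' : ∀ x, G.algFiber x) (g : Γ) :
    TangentSpace (𝓡 (m + n)) g × TangentSpace (𝓡 (m + n)) g :=
  (VectorField.mlieBracket (𝓡 (m + n)) (fun k => (G.rightField a k).1)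
      (fun k => (G.rightField a' k).1) g,
   VectorField.mlieBracket (𝓡 (m + n)) (fun k => (G.leftField b k).1)
      (fun k => (G.leftField b' k).1) g)

/-- `(dΘ⁺)(ξ, η)(g) = ρ(ξ)(Θ⁺(η))(g) - ρ(η)(Θ⁺(ξ))(g) - Θ⁺(⟦ξ, η⟧)(g)` for `ξ = prolSection a b`
and `η = prolSection a' b'`, with `d` the differential of the Lie algebroid `T^Γ Γ`. -/
def dThetaPlus (L : Γ → ℝ) (a b a' b' : ∀ x, G.algFiber x) (g : Γ) : ℝ :=
  dirDeriv (fun k => thetaPlus L k ((G.rightField a' k).1, (G.leftField b' k).1)) g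
      (G.anchor g (G.prolSection a b g))
    - dirDeriv (fun k => thetaPlus L k ((G.rightField a k).1, (G.leftField b k).1)) g
      (G.anchor g (G.prolSection a' b' g))
    - thetaPlus L g (G.prolBracket a b a' b' g)

/-- The Poincaré-Cartan 2-section `Ω_L = -dΘ⁺`, at `g`: the common value of `-(dΘ⁺)(ξ, η)(g)` for
all sections `ξ`, `η` as in `dThetaPlus` (smooth near `g`) with `ξ(g) = u` and `η(g) = v`. -/
def omega (L : Γ → ℝ) (g : Γ) (u v : G.Prol g) : ℝ :=
  Classical.epsilon fun c : ℝ => ∃ a b a' b' : ∀ x, G.algFiber x,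
    G.IsSectionNear a (G.src g) ∧ G.IsSectionNear b (G.tgt g) ∧
    G.IsSectionNear a' (G.src g) ∧ G.IsSectionNear b' (G.tgt g) ∧
    G.prolSection a b g = u ∧ G.prolSection a' b' g = v ∧
    c = -G.dThetaPlus L a b a' b' g

/-- The discrete Lagrangian `L` is regular: `Ω_L` is nondegenerate. -/
def IsRegularLagrangian (L : Γ → ℝ) : Prop :=
  ∀ g, ∀ u : G.Prol g, (∀ v : G.Prol g, G.omega L g u v = 0) → u = 0

/-- `G_g^L(a, b) = Ω_L(g)((-T_{ε(α(g))}(r_g ∘ i)(a), 0), (0, (T_{ε(β(g))} l_g)(b)))`. -/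
def pairingG (L : Γ → ℝ) (g : Γ) (a : G.algFiber (G.src g)) (b : G.algFiber (G.tgt g)) : ℝ :=
  G.omega L g (-G.tangentRightInv g a, 0) (0, G.tangentLeft g b)

end LieGroupoid

/-- A (generalized) discrete nonholonomic Lagrangian system `(L_d, M_c, D_c)` on a Lie groupoid:
a regular discrete Lagrangian `L`, a vector subbundle of rank `r` of the Lie algebroid, given by
a vector bundle `D → M` with its inclusion (an injective morphism of vector bundles over `M`
into `E_Γ`), and an embedded submanifold of dimension `m + r` of `Γ`, given by a manifold `Mc`
with its inclusion (a smooth embedding). -/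
structure NonholonomicSystem {m n : ℕ} {Γ M : Type*}
    [TopologicalSpace Γ] [ChartedSpace (EuclideanSpace ℝ (Fin (m + n))) Γ]
    [IsManifold (𝓡 (m + n)) ∞ Γ]
    [TopologicalSpace M] [ChartedSpace (EuclideanSpace ℝ (Fin m)) M]
    [IsManifold (𝓡 m) ∞ M]
    (G : LieGroupoid m n Γ M) (r : ℕ)
    (Mc : Type*) [TopologicalSpace Mc] [ChartedSpace (EuclideanSpace ℝ (Fin (m + r))) Mc]
    [IsManifold (𝓡 (m + r)) ∞ Mc]
    (D : M → Type*) [∀ x, AddCommGroup (D x)] [∀ x, Module ℝ (D x)]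
    [∀ x, TopologicalSpace (D x)]
    [TopologicalSpace (Bundle.TotalSpace (EuclideanSpace ℝ (Fin r)) D)]
    [FiberBundle (EuclideanSpace ℝ (Fin r)) D] [VectorBundle ℝ (EuclideanSpace ℝ (Fin r)) D]
    [ContMDiffVectorBundle ∞ (EuclideanSpace ℝ (Fin r)) D (𝓡 m)] where
  /-- the discrete Lagrangian `L_d` -/
  L : Γ → ℝ
  contMDiff_L : ContMDiff (𝓡 (m + n)) 𝓘(ℝ, ℝ) ∞ L
  regular_L : G.IsRegularLagrangian L
  /-- the inclusion of `D_c` in `E_Γ`, with `(E_Γ)_x` seen inside `T_{ε(x)} Γ` -/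
  inclD : ∀ x, D x →L[ℝ] TangentSpace (𝓡 (m + n)) (G.unit x)
  inclD_mem : ∀ x (v : D x), inclD x v ∈ G.algFiber x
  inclD_injective : ∀ x, Function.Injective (inclD x)
  contMDiff_inclD : ContMDiff ((𝓡 m).prod 𝓘(ℝ, EuclideanSpace ℝ (Fin r))) (𝓡 (m + n)).tangent ∞
    (fun p : Bundle.TotalSpace (EuclideanSpace ℝ (Fin r)) D =>
      (⟨G.unit p.proj, inclD p.proj p.snd⟩ : TangentBundle (𝓡 (m + n)) Γ))
  /-- the inclusion of `M_c` in `Γ` -/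
  inclM : Mc → Γ
  isSmoothEmbedding_inclM : IsSmoothEmbedding (𝓡 (m + r)) (𝓡 (m + n)) ∞ inclM

namespace NonholonomicSystem

variable {m n : ℕ} {Γ M : Type*}
  [TopologicalSpace Γ] [ChartedSpace (EuclideanSpace ℝ (Fin (m + n))) Γ]
  [IsManifold (𝓡 (m + n)) ∞ Γ]
  [TopologicalSpace M] [ChartedSpace (EuclideanSpace ℝ (Fin m)) M]
  [IsManifold (𝓡 m) ∞ M]
  {G : LieGroupoid m n Γ M} {r : ℕ}
  {Mc : Type*} [TopologicalSpace Mc] [ChartedSpace (EuclideanSpace ℝ (Fin (m + r))) Mc]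
  [IsManifold (𝓡 (m + r)) ∞ Mc]
  {D : M → Type*} [∀ x, AddCommGroup (D x)] [∀ x, Module ℝ (D x)]
  [∀ x, TopologicalSpace (D x)]
  [TopologicalSpace (Bundle.TotalSpace (EuclideanSpace ℝ (Fin r)) D)]
  [FiberBundle (EuclideanSpace ℝ (Fin r)) D] [VectorBundle ℝ (EuclideanSpace ℝ (Fin r)) D]
  [ContMDiffVectorBundle ∞ (EuclideanSpace ℝ (Fin r)) D (𝓡 m)]
  (S : NonholonomicSystem G r Mc D)

/-- The total space of the dual vector bundle `D_c^* → M`. -/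
abbrev DualD (_ : NonholonomicSystem G r Mc D) : Type _ :=
  Bundle.TotalSpace (EuclideanSpace ℝ (Fin r) →L[ℝ] ℝ)
    (fun x => D x →L[ℝ] Bundle.Trivial M ℝ x)

/-- The Legendre transformation `F⁻(L_d, M_c, D_c) : M_c → D_c^*`,
`F⁻(h)(v) = -v(L_d ∘ r_h ∘ i)` for `v ∈ D_c(α(h))`. -/
def legendreMinus (h : Mc) : S.DualD :=
  ⟨G.src (S.inclM h),
    -(G.fiberDeriv (fun k => S.L (G.mul (G.inv k) (S.inclM h))) (G.src (S.inclM h))).comp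
      (S.inclD (G.src (S.inclM h)))⟩

/-- The Legendre transformation `F⁺(L_d, M_c, D_c) : M_c → D_c^*`,
`F⁺(g)(v) = v(L_d ∘ l_g)` for `v ∈ D_c(β(g))`. -/
def legendrePlus (g : Mc) : S.DualD :=
  ⟨G.tgt (S.inclM g),
    (G.fiberDeriv (fun k => S.L (G.mul (S.inclM g) k)) (G.tgt (S.inclM g))).comp
      (S.inclD (G.tgt (S.inclM g)))⟩

/-- The system is regular: both Legendre transformations are local diffeomorphisms. -/
def IsRegular : Prop :=
  IsLocalDiffeomorph (𝓡 (m + r)) ((𝓡 m).prod 𝓘(ℝ, EuclideanSpace ℝ (Fin r) →L[ℝ] ℝ)) ∞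
      S.legendreMinus ∧
    IsLocalDiffeomorph (𝓡 (m + r)) ((𝓡 m).prod 𝓘(ℝ, EuclideanSpace ℝ (Fin r) →L[ℝ] ℝ)) ∞
      S.legendrePlus

/-- The fiber `D_c(x)` as a subspace of `(E_Γ)_x`. -/
def fiberD (x : M) : Submodule ℝ (G.algFiber x) :=
  (S.inclD x).range.comap (G.algFiber x).subtype

/-- The tangent space `T_h M_c` as a subspace of `T_h Γ`. -/
def tangentMc (h : Mc) : Submodule ℝ (TangentSpace (𝓡 (m + n)) (S.inclM h)) :=
  (mfderiv (𝓡 (m + r)) (𝓡 (m + n)) S.inclM h).range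

/-- `F_h = {γ_h^{(1,0)} | γ ∈ D_c(α(h))⁰}⁰`. -/
def subF (h : Γ) : Submodule ℝ (G.Prol h) :=
  ((S.fiberD (G.src h)).dualAnnihilator.map (G.lift10 h)).dualCoannihilator

/-- `F̄_g = {γ_g^{(0,1)} | γ ∈ D_c(β(g))⁰}⁰`. -/
def subFbar (g : Γ) : Submodule ℝ (G.Prol g) :=
  ((S.fiberD (G.tgt g)).dualAnnihilator.map (G.lift01 g)).dualCoannihilator

/-- The symplectic orthogonal `W^⊥` of `W` in `(T^Γ_g Γ, Ω_L(g))`. -/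
def orth (g : Γ) (W : Submodule ℝ (G.Prol g)) : Set (G.Prol g) :=
  {u | ∀ v ∈ W, G.omega S.L g u v = 0}

/-- `ρ⁻¹(T_h M_c)`, with `ρ` the anchor of `T^Γ Γ`. -/
def preTangent (h : Mc) : Submodule ℝ (G.Prol (S.inclM h)) :=
  (S.tangentMc h).comap (G.anchor (S.inclM h))

/-- `H_h = ρ⁻¹(T_h M_c) ∩ F_h`. -/
def subH (h : Mc) : Submodule ℝ (G.Prol (S.inclM h)) :=
  S.preTangent h ⊓ S.subF (S.inclM h)

/-- `H̄_g = ρ⁻¹(T_g M_c) ∩ F̄_g`. -/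
def subHbar (g : Mc) : Submodule ℝ (G.Prol (S.inclM g)) :=
  S.preTangent g ⊓ S.subFbar (S.inclM g)

/-- `W` is a smooth vector subbundle of rank `k` of the restriction `T^Γ_{M_c} Γ` of `T^Γ Γ`
to `M_c`: locally it has smooth frames with `k` elements. -/
def IsSubbundle (k : ℕ) (W : ∀ h : Mc, Submodule ℝ (G.Prol (S.inclM h))) : Prop :=
  ∀ h₀ : Mc, ∃ U : Set Mc, IsOpen U ∧ h₀ ∈ U ∧
    ∃ s : Fin k → ∀ h : Mc, G.Prol (S.inclM h),
      (∀ j, ContMDiffOn (𝓡 (m + r)) (𝓡 (m + n)).tangent ∞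
          (fun h => (⟨S.inclM h, (s j h).1.1⟩ : TangentBundle (𝓡 (m + n)) Γ)) U ∧
        ContMDiffOn (𝓡 (m + r)) (𝓡 (m + n)).tangent ∞
          (fun h => (⟨S.inclM h, (s j h).2.1⟩ : TangentBundle (𝓡 (m + n)) Γ)) U) ∧
      ∀ h ∈ U, LinearIndependent ℝ (fun j => s j h) ∧
        Submodule.span ℝ (Set.range fun j => s j h) = W h

/-- `W` is a symplectic subbundle of rank `k` of `(T^Γ_{M_c} Γ, Ω_L)`: a vector subbundle of
rank `k` to which `Ω_L` restricts as a nondegenerate 2-section. -/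
def IsSymplecticSubbundle (k : ℕ) (W : ∀ h : Mc, Submodule ℝ (G.Prol (S.inclM h))) : Prop :=
  S.IsSubbundle k W ∧
    ∀ h : Mc, ∀ u ∈ W h, (∀ v ∈ W h, G.omega S.L (S.inclM h) u v = 0) → u = 0

/-- The subspace `{b ∈ (E_Γ)_{β(h)} | (T_{ε(β(h))} l_h)(b) ∈ T_h M_c}`. -/
def leftSub (h : Mc) : Submodule ℝ (G.algFiber (G.tgt (S.inclM h))) :=
  (S.tangentMc h).comap ((G.vertSrc (S.inclM h)).subtype ∘ₗ G.tangentLeft (S.inclM h))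

/-- The subspace `{a ∈ (E_Γ)_{α(g)} | (T_{ε(α(g))} (r_g ∘ i))(a) ∈ T_g M_c}`. -/
def rightSub (g : Mc) : Submodule ℝ (G.algFiber (G.src (S.inclM g))) :=
  (S.tangentMc g).comap ((G.vertTgt (S.inclM g)).subtype ∘ₗ G.tangentRightInv (S.inclM g))

/-- The restriction `G_h^{L_d c}` of `G_h^{L_d}` to `D_c(α(h)) × leftSub h` is right
nondegenerate. -/
def IsRightNondegenerate (h : Mc) : Prop :=
  ∀ b ∈ S.leftSub h,
    (∀ a ∈ S.fiberD (G.src (S.inclM h)), G.pairingG S.L (S.inclM h) a b = 0) → b = 0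

/-- The restriction `Ḡ_g^{L_d c}` of `G_g^{L_d}` to `rightSub g × D_c(β(g))` is left
nondegenerate. -/
def IsLeftNondegenerate (g : Mc) : Prop :=
  ∀ a ∈ S.rightSub g,
    (∀ b ∈ S.fiberD (G.tgt (S.inclM g)), G.pairingG S.L (S.inclM g) a b = 0) → a = 0

end NonholonomicSystem

end

/-!
All four conditions say that, at every point of `M_c`, one bilinear pairing has no kernel in the
vertical tangent vectors of `M_c` against the translates of `D_c`.

The pairing is `B_g : V_g β × V_g α → ℝ` (`LieGroupoid.crossDeriv`), the mixed second derivative of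
`L` along right-invariant and left-invariant fields: `B(X, Y) = X(Y(L)) = Y(X(L))`. The two orders
agree because `L(c(s)⁻¹ g d(t))` is a smooth function of `(s, t)`
(`dirDeriv_derivLeft_rightField`). In `Ω_L = -dΘ⁺` all second derivatives along two left-invariant
fields are cancelled by the bracket term, so that
`Ω_L((X, Y), (X', Y')) = B(X', Y) - B(X, Y')` (`omega_eq`). In particular `G^L` is `B` in the
trivialization by translations, and regularity of `L` is nondegeneracy of `B`.

Conditions 2 and 4. As `B` is nondegenerate, the orthogonal of `F_h` consists of the `(0, Y)` with
`Y` orthogonal for `B` to the translates of `D_c(α(h))` (`mem_orth_subF`). Hence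
`ρ⁻¹(T_h M_c) ∩ F_h^⊥ = 0` means that `B` has no right kernel in `V_h α ∩ T_h M_c` against
`D_c(α(h))`, which is the condition on `G_h^{L_d c}` (`preTangent_inter_orth_subF_eq_iff`).

Conditions 3 and 4. The space `ρ⁻¹(T_h M_c) ∩ F_h^⊥` lies in `H_h` and is orthogonal to it, so it
vanishes if `Ω_L` is nondegenerate on `H_h`. Conversely put `P = D_c(α(h))`. There is a map
`H_h → P × P*` under which `Ω_L` is the pullback of the canonical 2-form (`omega_eq_coprojH`), and
it is injective if there is no right kernel. So `dim H_h ≤ 2 r`. This is the smallest dimension that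
the intersection of `ρ⁻¹(T_h M_c)` and `F_h` can have, so the intersection is transversal, `H` is a
smooth subbundle of rank `2 r` (`isSubbundle_of_frame`), the map to `P × P*` is an isomorphism and
`Ω_L` is nondegenerate on `H_h`.

Conditions 1 and 4. In a local trivialization of `D_c^*` the map `F⁻` has the components `α` and the
derivatives of `L` along the right-invariant fields of a frame of `D_c`. So the kernel of its
derivative at `h` is the set of `Y ∈ T_h M_c ∩ V_h α` with `B(X, Y) = 0` for all translates `X` of
elements of `D_c(α(h))` (`mfderiv_legendreMinus_eq_zero_iff`). As `M_c` and `D_c^*` have the same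
dimension, the inverse function theorem (`isLocalDiffeomorphAt_iff_ker_mfderiv`) applies. The other
half of each condition is the same with `α`, `β` and the arguments of `B` interchanged.
-/

/-! ### Local diffeomorphisms and directional derivatives -/

section InverseFunction

variable {E E' H H' A B : Type*} [NormedAddCommGroup E] [NormedSpace ℝ E] [CompleteSpace E]
  [NormedAddCommGroup E'] [NormedSpace ℝ E']
  [TopologicalSpace H] [TopologicalSpace H']
  {I : ModelWithCorners ℝ E H} {J : ModelWithCorners ℝ E' H'} [I.Boundaryless] [J.Boundaryless]
  [TopologicalSpace A] [ChartedSpace H A] [IsManifold I ∞ A]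
  [TopologicalSpace B] [ChartedSpace H' B] [IsManifold J ∞ B]

variable (I) in
/-- The extended chart at a point of a boundaryless manifold, as a partial diffeomorphism. -/
noncomputable def partialDiffeomorphExtChartAt (x : A) : PartialDiffeomorph I 𝓘(ℝ, E) A E ∞ where
  toPartialEquiv := extChartAt I x
  open_source := isOpen_extChartAt_source x
  open_target := isOpen_extChartAt_target x
  contMDiffOn_toFun := by
    have := contMDiffOn_extChartAt (I := I) (x := x) (n := ∞)
    rwa [← extChartAt_source I] at this
  contMDiffOn_invFun := contMDiffOn_extChartAt_symm x

/-- The inverse function theorem for a smooth map between open subsets of Banach spaces, with a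
smooth local inverse. -/
theorem isLocalDiffeomorphAt_of_fderiv_equiv {F : E → E'} {O : Set E} (hO : IsOpen O)
    (hF : ContDiffOn ℝ ∞ F O) {y : E} (hy : y ∈ O) (L : E ≃L[ℝ] E')
    (hL : fderiv ℝ F y = L) :
    ∃ P : PartialDiffeomorph 𝓘(ℝ, E) 𝓘(ℝ, E') E E' ∞, y ∈ P.source ∧ P.source ⊆ O ∧ ⇑P = F := by
  have hFa : ∀ z ∈ O, ContDiffAt ℝ ∞ F z := fun z hz => hF.contDiffAt (hO.mem_nhds hz)
  have hd : HasFDerivAt F (L : E →L[ℝ] E') y := by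
    rw [← hL]; exact ((hFa y hy).differentiableAt (by simp)).hasFDerivAt
  let Q := (hFa y hy).toOpenPartialHomeomorph F hd (by simp)
  have hQ : ⇑Q = F := ContDiffAt.toOpenPartialHomeomorph_coe _ hd _
  have hyQ : y ∈ Q.source := (hFa y hy).mem_toOpenPartialHomeomorph_source hd (by simp)
  -- the inverse is smooth where the derivative of `F` is invertible, which is an open condition
  let W : Set E := O ∩ fderiv ℝ F ⁻¹' (range ((↑) : (E ≃L[ℝ] E') → E →L[ℝ] E'))
  have hW : IsOpen W :=
    (hF.continuousOn_fderiv_of_isOpen hO (by simp)).isOpen_inter_preimage hO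
      (ContinuousLinearEquiv.isOpen)
  let R := Q.restrOpen W hW
  have hRs : R.source = Q.source ∩ W := Q.restrOpen_source W hW
  have hR : ⇑R = F := hQ
  refine ⟨{ toPartialEquiv := R.toPartialEquiv
            open_source := R.open_source
            open_target := R.open_target
            contMDiffOn_toFun := ?_
            contMDiffOn_invFun := ?_ }, ?_, ?_, hR⟩
  · rw [contMDiffOn_iff_contDiffOn]
    refine (hF.mono ?_).congr (fun z _ => congrFun hR z)
    rw [hRs]; exact fun z hz => hz.2.1
  · rw [contMDiffOn_iff_contDiffOn]
    intro z hz
    have h1 : R.symm z ∈ R.source := R.map_target hz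
    rw [hRs] at h1
    obtain ⟨L', hL'⟩ := h1.2.2
    refine (R.contDiffAt_symm (f₀' := L') hz ?_ ?_).contDiffWithinAt
    · rw [hR, hL']; exact ((hFa _ h1.2.1).differentiableAt (by simp)).hasFDerivAt
    · rw [hR]; exact hFa _ h1.2.1
  · change y ∈ R.source
    rw [hRs]; exact ⟨hyQ, hy, L, hL.symm⟩
  · change R.source ⊆ O
    rw [hRs]; exact fun z hz => hz.2.1

/-- The inverse function theorem for smooth maps between boundaryless manifolds. -/
theorem isLocalDiffeomorphAt_of_bijective_mfderiv [CompleteSpace E'] {f : A → B}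
    (hf : ContMDiff I J ∞ f) {x : A}
    (h : Function.Bijective (mfderiv I J f x)) : IsLocalDiffeomorphAt I J ∞ f x := by
  let P := partialDiffeomorphExtChartAt I x
  let Q := partialDiffeomorphExtChartAt J (f x)
  let F : E → E' := extChartAt J (f x) ∘ f ∘ (extChartAt I x).symm
  let O : Set E := (extChartAt I x).target ∩
    (extChartAt I x).symm ⁻¹' (f ⁻¹' (extChartAt J (f x)).source)
  have hO : IsOpen O :=
    (continuousOn_extChartAt_symm x).isOpen_inter_preimage (isOpen_extChartAt_target x)
      ((isOpen_extChartAt_source (f x)).preimage hf.continuous)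
  have hF : ContDiffOn ℝ ∞ F O := by
    rw [← contMDiffOn_iff_contDiffOn]
    refine Q.contMDiffOn_toFun.comp (hf.comp_contMDiffOn
      ((contMDiffOn_extChartAt_symm x).mono inter_subset_left)) fun z hz => hz.2
  have hxO : extChartAt I x x ∈ O :=
    ⟨mem_extChartAt_target x, by simp⟩
  have hfd : MDifferentiableAt I J f x := hf.mdifferentiableAt (by simp)
  have hfder : fderiv ℝ F (extChartAt I x x) = mfderiv I J f x := by
    have h1 : mfderiv I J f x = fderivWithin ℝ F (range I) (extChartAt I x x) := hfd.mfderiv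
    rw [h1, I.range_eq_univ, fderivWithin_univ]
  let L : E ≃L[ℝ] E' := ContinuousLinearEquiv.ofBijective (mfderiv I J f x)
    (LinearMap.ker_eq_bot.2 h.1) (LinearMap.range_eq_top.2 h.2)
  obtain ⟨R, hyR, hRO, hRF⟩ := isLocalDiffeomorphAt_of_fderiv_equiv hO hF hxO L
    (by rw [hfder]; rfl)
  refine ⟨(P.trans R).trans Q.symm, ?_, ?_⟩
  · refine ⟨⟨mem_extChartAt_source x, hyR⟩, ?_⟩
    change R (extChartAt I x x) ∈ (extChartAt J (f x)).target
    rw [hRF]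
    simp [F]
  · rintro z ⟨⟨hz1, hz2⟩, -⟩
    have h3 : extChartAt I x z ∈ O := hRO hz2
    have h4 : f z ∈ (extChartAt J (f x)).source := by
      have := h3.2
      simp only [mem_preimage] at this
      rwa [(extChartAt I x).left_inv hz1] at this
    change f z = (extChartAt J (f x)).symm (R (extChartAt I x z))
    rw [hRF]
    simp only [F, Function.comp]
    rw [(extChartAt I x).left_inv hz1, (extChartAt J (f x)).left_inv h4]

/-- Between manifolds of the same dimension, a smooth map is a local diffeomorphism at a point if
and only if its derivative there is injective. -/
theorem isLocalDiffeomorphAt_iff_ker_mfderiv [FiniteDimensional ℝ E] [FiniteDimensional ℝ E']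
    (hdim : Module.finrank ℝ E = Module.finrank ℝ E') {f : A → B} (hf : ContMDiff I J ∞ f)
    {x : A} : IsLocalDiffeomorphAt I J ∞ f x ↔
      ∀ v : TangentSpace I x, mfderiv I J f x v = 0 → v = 0 := by
  constructor
  · intro h v hv
    exact (h.mfderivToContinuousLinearEquiv (by simp)).injective (hv.trans (map_zero _).symm)
  · intro h
    let T : E →ₗ[ℝ] E' := (mfderiv I J f x).toLinearMap
    have h1 : Function.Injective T := (injective_iff_map_eq_zero T).2 h
    exact isLocalDiffeomorphAt_of_bijective_mfderiv hf
      ⟨h1, (LinearMap.injective_iff_surjective_of_finrank_eq_finrank hdim).1 h1⟩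

end InverseFunction

section VectorDerivative

variable {E H A : Type*} [NormedAddCommGroup E] [NormedSpace ℝ E]
  [TopologicalSpace H] {I : ModelWithCorners ℝ E H}
  [TopologicalSpace A] [ChartedSpace H A]
  {F : Type*} [NormedAddCommGroup F] [NormedSpace ℝ F]

variable (I) in
/-- The derivative of a function with values in a normed space `F`, with the tangent spaces of `F`
identified with `F`. -/
noncomputable def vecDeriv (f : A → F) (x : A) : TangentSpace I x →L[ℝ] F :=
  mfderiv I 𝓘(ℝ, F) f x

theorem vecDeriv_comp {E' H' A' : Type*} [NormedAddCommGroup E'] [NormedSpace ℝ E']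
    [TopologicalSpace H'] {J : ModelWithCorners ℝ E' H'} [TopologicalSpace A'] [ChartedSpace H' A']
    {f : A → F} {φ : A' → A} {x : A'} (hf : MDifferentiableAt I 𝓘(ℝ, F) f (φ x))
    (hφ : MDifferentiableAt J I φ x) (v : TangentSpace J x) :
    vecDeriv J (f ∘ φ) x v = vecDeriv I f (φ x) (mfderiv J I φ x v) := by
  have := mfderiv_comp x hf hφ
  exact congrArg (fun L => L v) this

theorem vecDeriv_congr {f g : A → F} {x : A} (h : f =ᶠ[𝓝 x] g) : vecDeriv I f x = vecDeriv I g x :=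
  h.mfderiv_eq

theorem vecDeriv_vectorSpace (f : E → F) (x v : E) :
    vecDeriv 𝓘(ℝ, E) f x v = fderiv ℝ f x v := by
  have : mfderiv 𝓘(ℝ, E) 𝓘(ℝ, F) f x = fderiv ℝ f x := mfderiv_eq_fderiv
  exact congrArg (fun L => L v) this

end VectorDerivative

section LieBracket

variable {E H A : Type*} [NormedAddCommGroup E] [NormedSpace ℝ E]
  [TopologicalSpace H] {I : ModelWithCorners ℝ E H} [I.Boundaryless]
  [TopologicalSpace A] [ChartedSpace H A] [IsManifold I ∞ A]

/-- In a normed space the bracket of two vector fields is the commutator of the corresponding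
derivations: the second derivatives cancel by symmetry. -/
theorem fderiv_lieBracket {L : E → ℝ} {V W : E → E} {x : E} (hL : ContDiffAt ℝ 2 L x)
    (hV : DifferentiableAt ℝ V x) (hW : DifferentiableAt ℝ W x) :
    fderiv ℝ L x (VectorField.lieBracket ℝ V W x) =
      fderiv ℝ (fun y => fderiv ℝ L y (W y)) x (V x)
        - fderiv ℝ (fun y => fderiv ℝ L y (V y)) x (W x) := by
  have hd : DifferentiableAt ℝ (fderiv ℝ L) x :=
    (hL.fderiv_right (m := 1) (by norm_num)).differentiableAt (by simp)
  have hs := hL.isSymmSndFDerivAt (by simp)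
  rw [fderiv_clm_apply hd hW, fderiv_clm_apply hd hV, VectorField.lieBracket]
  simp [hs.eq (V x) (W x)]

/-- The Lie bracket of two vector fields is the commutator of the corresponding derivations. -/
theorem vecDeriv_mlieBracket [CompleteSpace E] {L : A → ℝ} {V W : ∀ x : A, TangentSpace I x}
    {x : A} (hL : ContMDiff I 𝓘(ℝ, ℝ) ∞ L)
    (hV : MDifferentiableAt I I.tangent (fun y => (⟨y, V y⟩ : TangentBundle I A)) x)
    (hW : MDifferentiableAt I I.tangent (fun y => (⟨y, W y⟩ : TangentBundle I A)) x) :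
    vecDeriv I L x (VectorField.mlieBracket I V W x) =
      vecDeriv I (fun y => vecDeriv I L y (W y)) x (V x)
        - vecDeriv I (fun y => vecDeriv I L y (V y)) x (W x) := by
  have : IsManifold I 2 A := IsManifold.of_le (n := ∞) (by norm_cast)
  have : IsManifold I 1 A := IsManifold.of_le (n := ∞) (by norm_cast)
  set φ := extChartAt I x with hφ
  let pull (V : ∀ x : A, TangentSpace I x) : E → E :=
    VectorField.mpullbackWithin 𝓘(ℝ, E) I φ.symm V (range I)
  let Lh : E → ℝ := L ∘ φ.symm
  have hxs : x ∈ φ.source := mem_extChartAt_source x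
  have hLh : ContDiffAt ℝ ∞ Lh (φ x) := by
    have := (contMDiffAt_iff.1 (hL x)).2
    rw [I.range_eq_univ, contDiffWithinAt_univ] at this
    exact this
  have hpd : ∀ V : ∀ x : A, TangentSpace I x,
      MDifferentiableAt I I.tangent (fun y => (⟨y, V y⟩ : TangentBundle I A)) x →
      DifferentiableAt ℝ (pull V) (φ x) := by
    intro V hV
    have : DifferentiableWithinAt ℝ (pull V) (φ.symm ⁻¹' univ ∩ range I) (φ x) :=
      (hV.mdifferentiableWithinAt
        (s := univ)).differentiableWithinAt_mpullbackWithin_vectorField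
    rwa [preimage_univ, univ_inter, I.range_eq_univ, differentiableWithinAt_univ] at this
  have hφd : ∀ y ∈ φ.source, MDifferentiableAt I 𝓘(ℝ, E) φ y := fun y hy =>
    mdifferentiableAt_extChartAt (by rwa [← extChartAt_source I])
  have hpull : ∀ (V : ∀ x : A, TangentSpace I x), ∀ y ∈ φ.source,
      pull V (φ y) = mfderiv I 𝓘(ℝ, E) φ y (V y) := by
    intro V y hy
    refine (isInvertible_mfderivWithin_extChartAt_symm (φ.map_source hy)).inverse_apply_eq.2 ?_
    have h1 := congrArg (fun T => T (V y))
      (mfderivWithin_extChartAt_symm_comp_mfderiv_extChartAt' hy)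
    exact (congrArg (fun z => (V z : E)) (φ.left_inv hy)).trans h1.symm
  have hLφ : ∀ y ∈ φ.source, ∀ v : TangentSpace I y,
      vecDeriv I L y v = fderiv ℝ Lh (φ y) (mfderiv I 𝓘(ℝ, E) φ y v) := by
    intro y hy v
    have h1 : L =ᶠ[𝓝 y] Lh ∘ φ := by
      filter_upwards [(isOpen_extChartAt_source (I := I) x).mem_nhds hy] with z hz
      simp only [Lh, Function.comp]
      rw [φ.left_inv hz]
    have h2 : MDifferentiableAt 𝓘(ℝ, E) 𝓘(ℝ, ℝ) Lh (φ y) := by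
      have h3 := (contMDiffOn_extChartAt_symm (I := I) (n := ∞) x).contMDiffAt
        ((isOpen_extChartAt_target x).mem_nhds (φ.map_source hy))
      exact ((hL _).comp _ h3).mdifferentiableAt (by simp)
    rw [vecDeriv_congr h1, vecDeriv_comp h2 (hφd y hy) v]
    exact vecDeriv_vectorSpace _ _ _
  -- the derivative of a function along a field, transported to the chart
  have key : ∀ V W : ∀ x : A, TangentSpace I x,
      MDifferentiableAt I I.tangent (fun y => (⟨y, W y⟩ : TangentBundle I A)) x →
      vecDeriv I (fun y => vecDeriv I L y (W y)) x (V x)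
        = fderiv ℝ (fun z => fderiv ℝ Lh z (pull W z)) (φ x) (pull V (φ x)) := by
    intro V W hW
    have h1 : (fun y => vecDeriv I L y (W y)) =ᶠ[𝓝 x]
        (fun z => fderiv ℝ Lh z (pull W z)) ∘ φ := by
      filter_upwards [(isOpen_extChartAt_source (I := I) x).mem_nhds hxs] with y hy
      simp only [Function.comp]
      rw [hpull W y hy, hLφ y hy]
    have h2 : DifferentiableAt ℝ (fun z => fderiv ℝ Lh z (pull W z)) (φ x) :=
      ((hLh.fderiv_right (m := 1) (by norm_cast)).differentiableAt (by simp)).clm_apply (hpd W hW)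
    rw [vecDeriv_congr h1, vecDeriv_comp h2.mdifferentiableAt (hφd x hxs), hpull V x hxs]
    exact vecDeriv_vectorSpace _ _ _
  have hbr : mfderiv I 𝓘(ℝ, E) φ x (VectorField.mlieBracket I V W x)
      = VectorField.lieBracket ℝ (pull V) (pull W) (φ x) := by
    refine ((isInvertible_mfderiv_extChartAt hxs).self_apply_inverse _).trans ?_
    rw [preimage_univ, univ_inter, I.range_eq_univ]
    have h1 : VectorField.lieBracketWithin ℝ (pull V) (pull W) univ (φ x)
        = VectorField.lieBracket ℝ (pull V) (pull W) (φ x) := by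
      rw [VectorField.lieBracketWithin_univ]
    rw [← h1]
    simp only [pull, I.range_eq_univ]
    rfl
  rw [key V W hW, key W V hV, hLφ x hxs, hbr]
  exact fderiv_lieBracket (hLh.of_le (by norm_cast)) (hpd V hV) (hpd W hW)

end LieBracket

/-! ### Smooth families of tangent vectors and of linear maps -/

section TangentMaps

variable {E E' E'' H H' H'' A B N : Type*} [NormedAddCommGroup E] [NormedSpace ℝ E]
  [NormedAddCommGroup E'] [NormedSpace ℝ E'] [NormedAddCommGroup E''] [NormedSpace ℝ E'']
  [TopologicalSpace H] [TopologicalSpace H'] [TopologicalSpace H'']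
  {I : ModelWithCorners ℝ E H} {I' : ModelWithCorners ℝ E' H'} {J : ModelWithCorners ℝ E'' H''}
  [TopologicalSpace A] [ChartedSpace H A] [IsManifold I ∞ A]
  [TopologicalSpace B] [ChartedSpace H' B] [IsManifold I' ∞ B]
  [TopologicalSpace N] [ChartedSpace H'' N]
  {F : Type*} [NormedAddCommGroup F] [NormedSpace ℝ F]

/-- The derivative of a smooth map, applied to a smooth family of tangent vectors, is smooth. -/
theorem ContMDiffAt.tangentMap_comp {f : A → B} {U : Set A} (hU : IsOpen U)
    (hf : ContMDiffOn I I' ∞ f U) {X : N → TangentBundle I A} {x : N}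
    (hX : ContMDiffAt J I.tangent ∞ X x) (hx : (X x).proj ∈ U) :
    ContMDiffAt J I'.tangent ∞ (fun y => tangentMap I I' f (X y)) x := by
  have : IsManifold I 1 A := IsManifold.of_le (n := ∞) (by norm_cast)
  have : IsManifold I' 1 B := IsManifold.of_le (n := ∞) (by norm_cast)
  have hpre : IsOpen (Bundle.TotalSpace.proj ⁻¹' U : Set (TangentBundle I A)) :=
    hU.preimage (FiberBundle.continuous_proj E (TangentSpace I))
  have h1 := (hf.contMDiffOn_tangentMapWithin (m := ∞) (by norm_cast)
    hU.uniqueMDiffOn).contMDiffAt (hpre.mem_nhds hx)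
  refine (h1.comp x hX).congr_of_eventuallyEq ?_
  filter_upwards [hX.continuousAt (hpre.mem_nhds hx)] with y hy
  simp only [Function.comp, tangentMap, tangentMapWithin]
  rw [mfderivWithin_of_isOpen hU hy]

/-- The derivative of a smooth function with values in a normed space, applied to a smooth family
of tangent vectors, is smooth. -/
theorem ContMDiffAt.vecDeriv_comp {f : A → F} {U : Set A} (hU : IsOpen U)
    (hf : ContMDiffOn I 𝓘(ℝ, F) ∞ f U) {X : N → TangentBundle I A} {x : N}
    (hX : ContMDiffAt J I.tangent ∞ X x) (hx : (X x).proj ∈ U) :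
    ContMDiffAt J 𝓘(ℝ, F) ∞ (fun y => vecDeriv I f (X y).proj (X y).2) x :=
  ((contMDiff_snd_tangentBundle_modelSpace F 𝓘(ℝ, F)).contMDiffAt (n := ∞)).comp x
    (ContMDiffAt.tangentMap_comp hU hf hX hx)

omit [IsManifold I ∞ A] in
theorem tangentBundle_mk_eq {a a' : A} (h : a = a') {v : TangentSpace I a}
    {v' : TangentSpace I a'} (hv : (v : E) = (v' : E)) :
    (⟨a, v⟩ : TangentBundle I A) = ⟨a', v'⟩ := by
  subst h; rw [show v = v' from hv]

omit [IsManifold I ∞ A] in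
/-- Linear combinations with smooth coefficients of smooth families of vectors of a vector bundle
over the same smooth map are smooth. -/
theorem ContMDiffAt.sum_smul_along {W : A → Type*} [∀ x, AddCommGroup (W x)] [∀ x, Module ℝ (W x)]
    [∀ x, TopologicalSpace (W x)] [TopologicalSpace (Bundle.TotalSpace F W)]
    [FiberBundle F W] [VectorBundle ℝ F W] {φ : N → A} {ι : Type*} (t : Finset ι)
    {X : ι → ∀ y, W (φ y)} {c : ι → N → ℝ} {x : N} (hφ : ContMDiffAt J I ∞ φ x)
    (hX : ∀ i ∈ t, ContMDiffAt J (I.prod 𝓘(ℝ, F)) ∞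
      (fun y => (⟨φ y, X i y⟩ : Bundle.TotalSpace F W)) x)
    (hc : ∀ i ∈ t, ContMDiffAt J 𝓘(ℝ, ℝ) ∞ (c i) x) :
    ContMDiffAt J (I.prod 𝓘(ℝ, F)) ∞
      (fun y => (⟨φ y, ∑ i ∈ t, c i y • X i y⟩ : Bundle.TotalSpace F W)) x := by
  rw [Bundle.contMDiffAt_totalSpace]
  refine ⟨hφ, ?_⟩
  let e := trivializationAt F W (φ x)
  have h1 : ContMDiffAt J 𝓘(ℝ, F) ∞
      (fun y => ∑ i ∈ t, c i y • (e ⟨φ y, X i y⟩).2) x :=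
    ContMDiffAt.sum fun i hi => (hc i hi).smul (Bundle.contMDiffAt_totalSpace.1 (hX i hi)).2
  refine h1.congr_of_eventuallyEq ?_
  have h2 : φ ⁻¹' e.baseSet ∈ 𝓝 x :=
    hφ.continuousAt (e.open_baseSet.mem_nhds (FiberBundle.mem_baseSet_trivializationAt' _))
  filter_upwards [h2] with y hy
  have h3 : ∀ v : W (φ y), (e ⟨φ y, v⟩).2 = e.linearMapAt ℝ (φ y) v := fun v => by
    rw [e.coe_linearMapAt_of_mem hy]
  change (e ⟨φ y, ∑ i ∈ t, c i y • X i y⟩).2 = _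
  simp only [h3, map_sum, map_smul]

end TangentMaps

section KernelFrames

variable {E H N : Type*} [NormedAddCommGroup E] [NormedSpace ℝ E]
  [TopologicalSpace H] {J : ModelWithCorners ℝ E H} [TopologicalSpace N] [ChartedSpace H N]
  {V F : Type*} [NormedAddCommGroup V] [NormedSpace ℝ V] [FiniteDimensional ℝ V]
  [NormedAddCommGroup F] [NormedSpace ℝ F] [FiniteDimensional ℝ F]

omit [FiniteDimensional ℝ F] in
/-- A family of linear maps of a finite-dimensional space is smooth if its values on each vector
are smooth. -/
theorem contMDiffAt_clm_of_apply {T : N → V →L[ℝ] F} {x : N}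
    (h : ∀ v, ContMDiffAt J 𝓘(ℝ, F) ∞ (fun y => T y v) x) :
    ContMDiffAt J 𝓘(ℝ, V →L[ℝ] F) ∞ T x := by
  let b := Module.finBasis ℝ V
  let φ (i) : V →L[ℝ] ℝ := LinearMap.toContinuousLinearMap (b.coord i)
  have h1 : T = fun y => ∑ i, ContinuousLinearMap.smulRightL ℝ V F (φ i) (T y (b i)) := by
    ext y v
    conv_lhs => rw [← b.sum_repr v, map_sum]
    simp [φ]
  rw [h1]
  exact ContMDiffAt.sum fun i _ =>
    (ContinuousLinearMap.smulRightL ℝ V F (φ i)).contMDiff.contMDiffAt.comp x (h (b i))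

/-- The kernels of a smooth family of surjective linear maps have local smooth frames. -/
theorem exists_smooth_frame_ker {T : N → V →L[ℝ] F} {U : Set N} (hU : IsOpen U) {x : N}
    (hx : x ∈ U) (hT : ∀ y ∈ U, ContMDiffAt J 𝓘(ℝ, V →L[ℝ] F) ∞ T y)
    (hs : Function.Surjective (T x)) {k : ℕ}
    (hk : Module.finrank ℝ V = Module.finrank ℝ F + k) :
    ∃ U' ⊆ U, IsOpen U' ∧ x ∈ U' ∧ ∃ s : Fin k → N → V,
      (∀ j, ∀ y ∈ U', ContMDiffAt J 𝓘(ℝ, V) ∞ (s j) y) ∧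
      ∀ y ∈ U', LinearIndependent ℝ (fun j => s j y) ∧
        Submodule.span ℝ (range fun j => s j y) = LinearMap.ker (T y : V →ₗ[ℝ] F) := by
  obtain ⟨R, hR⟩ := (T x).exists_rightInverse_of_surjective (LinearMap.range_eq_top.2 hs)
  -- `T y ∘ R` is invertible near `x`, where it is the identity
  let Q : N → F →L[ℝ] F := fun y => (T y).comp R
  have hQ : ∀ y ∈ U, ContMDiffAt J 𝓘(ℝ, F →L[ℝ] F) ∞ Q y := fun y hy =>
    (hT y hy).clm_comp contMDiffAt_const
  have hQx : Q x = 1 := hR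
  have hQc : ContinuousOn Q U := fun y hy => (hQ y hy).continuousAt.continuousWithinAt
  let U' : Set N := U ∩ Q ⁻¹' {u | IsUnit u}
  have hU' : IsOpen U' := hQc.isOpen_inter_preimage hU Units.isOpen
  have hxU' : x ∈ U' := ⟨hx, by simp [hQx]⟩
  let P : N → V →L[ℝ] V := fun y =>
    ContinuousLinearMap.id ℝ V - R.comp ((Ring.inverse (Q y)).comp (T y))
  have hP : ∀ y ∈ U', ContMDiffAt J 𝓘(ℝ, V →L[ℝ] V) ∞ P y := by
    rintro y ⟨hy, u, hu⟩
    have h1 : ContMDiffAt J 𝓘(ℝ, F →L[ℝ] F) ∞ (fun y => Ring.inverse (Q y)) y := by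
      have h2 : ContDiffAt ℝ ∞ (Ring.inverse : (F →L[ℝ] F) → F →L[ℝ] F) (Q y) := by
        rw [← hu]; exact contDiffAt_ringInverse ℝ u
      exact h2.contMDiffAt.comp y (hQ y hy)
    exact contMDiffAt_const.sub (contMDiffAt_const.clm_comp (h1.clm_comp (hT y hy)))
  have hker : ∀ y ∈ U', ∀ v, T y (P y v) = 0 := by
    rintro y ⟨hy, hu⟩ v
    have h1 := congrArg (fun L => L (T y v)) (Ring.mul_inverse_cancel (Q y) hu)
    have h2 : T y (R (Ring.inverse (Q y) (T y v))) = T y v := h1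
    simp [P, h2]
  have hsurj : ∀ y ∈ U', Function.Surjective (T y) := by
    rintro y ⟨hy, hu⟩ w
    exact ⟨R (Ring.inverse (Q y) w), congrArg (fun L => L w) (Ring.mul_inverse_cancel (Q y) hu)⟩
  have hrank : ∀ y ∈ U', Module.finrank ℝ (LinearMap.ker (T y : V →ₗ[ℝ] F)) = k := by
    intro y hy
    have h1 := (T y : V →ₗ[ℝ] F).finrank_range_add_finrank_ker
    rw [LinearMap.range_eq_top.2 (hsurj y hy), finrank_top] at h1
    omega
  obtain ⟨b⟩ : Nonempty (Module.Basis (Fin k) ℝ (LinearMap.ker (T x : V →ₗ[ℝ] F))) :=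
    ⟨Module.finBasisOfFinrankEq ℝ _ (hrank x hxU')⟩
  have hli : ∀ y ∈ U', LinearIndependent ℝ (fun j => P y (b j)) := by
    rintro y hy
    have h1 : LinearIndependent ℝ (fun j => (b j : V)) :=
      b.linearIndependent.map' _ (Submodule.ker_subtype _)
    have hdisj : Disjoint (Submodule.span ℝ (range fun j => (b j : V)))
        (LinearMap.ker (P y : V →ₗ[ℝ] V)) := by
      rw [Submodule.disjoint_def]
      intro v hv hv'
      have hv1 : T x v = 0 := by
        have : Submodule.span ℝ (range fun j => (b j : V)) ≤ LinearMap.ker (T x : V →ₗ[ℝ] F) := by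
          rw [Submodule.span_le]; rintro _ ⟨j, rfl⟩; exact (b j).2
        exact this hv
      have hv2 : v = R (Ring.inverse (Q y) (T y v)) := sub_eq_zero.1 hv'
      have hv3 : Ring.inverse (Q y) (T y v) = 0 := by
        have := congrArg (fun L => L (Ring.inverse (Q y) (T y v))) hQx
        change T x (R (Ring.inverse (Q y) (T y v))) = _ at this
        rw [← hv2, hv1] at this
        exact this.symm
      rw [hv2, hv3, map_zero]
    exact h1.map hdisj
  refine ⟨U', inter_subset_left, hU', hxU', fun j y => P y (b j), fun j y hy =>
    (hP y hy).clm_apply contMDiffAt_const, fun y hy => ⟨hli y hy, ?_⟩⟩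
  refine Submodule.eq_of_le_of_finrank_eq ?_ ?_
  · rw [Submodule.span_le]; rintro _ ⟨j, rfl⟩; exact hker y hy _
  · rw [finrank_span_eq_card (hli y hy), hrank y hy, Fintype.card_fin]

end KernelFrames

/-! ### Submersions: adapted charts, curves and derivatives along fibers -/

section Submersion

variable {p q : ℕ} {A B : Type*}
  [TopologicalSpace A] [ChartedSpace (EuclideanSpace ℝ (Fin p)) A]
  [TopologicalSpace B] [ChartedSpace (EuclideanSpace ℝ (Fin q)) B]
  {f : A → B} {a : A}

namespace Manifold.IsSubmersionAt

variable (hf : IsSubmersionAt (𝓡 p) (𝓡 q) ∞ f a)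
include hf

theorem mdifferentiable_domChart : hf.domChart.MDifferentiable (𝓡 p) (𝓡 p) :=
  ⟨(contMDiffOn_of_mem_maximalAtlas hf.domChart_mem_maximalAtlas).mdifferentiableOn (by simp),
   (contMDiffOn_symm_of_mem_maximalAtlas hf.domChart_mem_maximalAtlas).mdifferentiableOn (by simp)⟩

theorem mdifferentiable_codChart : hf.codChart.MDifferentiable (𝓡 q) (𝓡 q) :=
  ⟨(contMDiffOn_of_mem_maximalAtlas hf.codChart_mem_maximalAtlas).mdifferentiableOn (by simp),
   (contMDiffOn_symm_of_mem_maximalAtlas hf.codChart_mem_maximalAtlas).mdifferentiableOn (by simp)⟩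

theorem codChart_apply_domChart_symm {y : EuclideanSpace ℝ (Fin p)}
    (hy : y ∈ hf.domChart.target) :
    hf.codChart (f (hf.domChart.symm y)) = (hf.equiv y).1 := by
  have hy' : y ∈ (hf.domChart.extend (𝓡 p)).target := by
    simpa [OpenPartialHomeomorph.extend_target] using hy
  simpa using hf.writtenInCharts hy'

theorem apply_domChart_symm_mem {y : EuclideanSpace ℝ (Fin p)}
    (hy : y ∈ hf.domChart.target) : f (hf.domChart.symm y) ∈ hf.codChart.source :=
  hf.source_subset_preimage_source (hf.domChart.map_target hy)

/-- In adapted charts, the kernel of the derivative of a submersion consists of the vectors whose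
first component vanishes. -/
theorem mfderiv_domChart_symm_eq_zero_iff {y : EuclideanSpace ℝ (Fin p)}
    (hy : y ∈ hf.domChart.target) (w : EuclideanSpace ℝ (Fin p)) :
    (mfderiv (𝓡 p) (𝓡 q) f (hf.domChart.symm y)
      (mfderiv (𝓡 p) (𝓡 p) hf.domChart.symm y w) : EuclideanSpace ℝ (Fin q)) = 0 ↔
      (hf.equiv w).1 = 0 := by
  have hs := hf.domChart.map_target hy
  have h1 : mfderiv (𝓡 p) (𝓡 q) (fun y => (hf.equiv y).1) y w = (hf.equiv w).1 := by
    rw [mfderiv_eq_fderiv]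
    let P : EuclideanSpace ℝ (Fin p) →L[ℝ] EuclideanSpace ℝ (Fin q) :=
      (ContinuousLinearMap.fst ℝ _ hf.complement).comp
        (hf.equiv : EuclideanSpace ℝ (Fin p) →L[ℝ] (EuclideanSpace ℝ (Fin q) × hf.complement))
    have : HasFDerivAt (fun y => (hf.equiv y).1) P y := P.hasFDerivAt
    rw [this.fderiv]; rfl
  have h2 : (fun y => (hf.equiv y).1) =ᶠ[𝓝 y] (hf.codChart ∘ (f ∘ hf.domChart.symm)) := by
    filter_upwards [hf.domChart.open_target.mem_nhds hy] with z hz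
    exact (hf.codChart_apply_domChart_symm hz).symm
  have hfd : MDifferentiableAt (𝓡 p) (𝓡 q) f (hf.domChart.symm y) :=
    (hf.contMDiffOn.contMDiffAt (hf.domChart.open_source.mem_nhds hs)).mdifferentiableAt (by simp)
  have h3 := HasMFDerivAt.comp y hfd.hasMFDerivAt
    (hf.mdifferentiable_domChart.mdifferentiableAt_symm hy).hasMFDerivAt
  have hc := hf.apply_domChart_symm_mem hy
  have h4 : MDifferentiableAt (𝓡 q) (𝓡 q) hf.codChart ((f ∘ hf.domChart.symm) y) :=
    hf.mdifferentiable_codChart.mdifferentiableAt hc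
  have h5 := (HasMFDerivAt.comp y h4.hasMFDerivAt h3).congr_of_eventuallyEq h2
  have h6 : (hf.equiv w).1 = mfderiv (𝓡 q) (𝓡 q) hf.codChart (f (hf.domChart.symm y))
      (mfderiv (𝓡 p) (𝓡 q) f (hf.domChart.symm y)
        (mfderiv (𝓡 p) (𝓡 p) hf.domChart.symm y w)) :=
    h1.symm.trans (congrArg (fun L => L w) h5.mfderiv)
  rw [h6]
  exact ⟨fun h => (congrArg _ h).trans (map_zero _), fun h =>
    hf.mdifferentiable_codChart.mfderiv_injective hc (h.trans (map_zero _).symm)⟩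

theorem finrank_complement : Module.finrank ℝ hf.complement = p - q ∧
    FiniteDimensional ℝ hf.complement := by
  have hfin : FiniteDimensional ℝ (EuclideanSpace ℝ (Fin q) × hf.complement) :=
    hf.equiv.toLinearEquiv.finiteDimensional
  have hfin' : FiniteDimensional ℝ hf.complement :=
    Module.Finite.of_surjective (LinearMap.snd ℝ (EuclideanSpace ℝ (Fin q)) hf.complement)
      LinearMap.snd_surjective
  have h := hf.equiv.toLinearEquiv.finrank_eq
  rw [Module.finrank_prod, finrank_euclideanSpace_fin, finrank_euclideanSpace_fin] at h
  exact ⟨by omega, hfin'⟩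

/-- Through every vector tangent to a fiber of a submersion there is a curve in that fiber that
is smooth. -/
theorem exists_smooth_curve (v : TangentSpace (𝓡 p) a) (hv : mfderiv (𝓡 p) (𝓡 q) f a v = 0) :
    ∃ c : ℝ → A, c 0 = a ∧ (∀ᶠ t in 𝓝 (0 : ℝ), f (c t) = f a) ∧
      ContMDiffAt 𝓘(ℝ, ℝ) (𝓡 p) ∞ c 0 ∧
      (mfderiv 𝓘(ℝ, ℝ) (𝓡 p) c 0 (1 : ℝ) : EuclideanSpace ℝ (Fin p)) = v := by
  set e := hf.domChart with he
  have hea : a ∈ e.source := hf.mem_domChart_source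
  have hea' : e.symm (e a) = a := e.left_inv hea
  let w : EuclideanSpace ℝ (Fin p) := mfderiv (𝓡 p) (𝓡 p) e a v
  have hw : mfderiv (𝓡 p) (𝓡 p) e.symm (e a) w = v :=
    congrArg (fun L => L v) (hf.mdifferentiable_domChart.symm_comp_deriv hea)
  have hw0 : (hf.equiv w).1 = 0 := by
    rw [← hf.mfderiv_domChart_symm_eq_zero_iff (e.map_source hea)]
    have h5 : mfderiv (𝓡 p) (𝓡 q) f (e.symm (e a)) v = 0 := by rw [hea']; exact hv
    exact (congrArg _ hw).trans h5
  let ℓ : ℝ → EuclideanSpace ℝ (Fin p) := fun t => e a + t • w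
  have hℓ : HasFDerivAt ℓ ((1 : ℝ →L[ℝ] ℝ).smulRight w) 0 :=
    ((hasFDerivAt_id (𝕜 := ℝ) (0:ℝ)).smul_const w).const_add (e a)
  have hℓs : ContMDiff 𝓘(ℝ, ℝ) (𝓡 p) ∞ ℓ :=
    (contDiff_const.add (contDiff_id.smul contDiff_const)).contMDiff
  have hℓ0 : ℓ 0 = e a := by simp [ℓ]
  have hsm : ContMDiffAt (𝓡 p) (𝓡 p) ∞ e.symm (ℓ 0) := by
    rw [hℓ0]
    exact (contMDiffOn_symm_of_mem_maximalAtlas hf.domChart_mem_maximalAtlas).contMDiffAt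
      (e.open_target.mem_nhds (e.map_source hea))
  refine ⟨fun t => e.symm (ℓ t), by simp [hℓ0, hea'], ?_, hsm.comp 0 hℓs.contMDiffAt, ?_⟩
  · have h1 : ∀ᶠ t in 𝓝 (0:ℝ), ℓ t ∈ e.target :=
      hℓ.continuousAt.eventually_mem (by rw [hℓ0]; exact e.open_target.mem_nhds (e.map_source hea))
    filter_upwards [h1] with t ht
    apply hf.codChart.injOn (hf.apply_domChart_symm_mem ht) hf.mem_codChart_source
    have h3 := hf.codChart_apply_domChart_symm (e.map_source hea)
    rw [← he, hea'] at h3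
    rw [h3, hf.codChart_apply_domChart_symm ht]
    simp [ℓ, hw0]
  · have h8 : HasMFDerivAt 𝓘(ℝ, ℝ) (𝓡 p) (e.symm ∘ ℓ) 0 _ :=
      HasMFDerivAt.comp (0:ℝ) (hsm.mdifferentiableAt (by simp)).hasMFDerivAt hℓ.hasMFDerivAt
    refine (congrArg (fun L => L (1:ℝ)) h8.mfderiv).trans ?_
    change mfderiv (𝓡 p) (𝓡 p) e.symm (ℓ 0) ((1:ℝ) • w) = v
    rw [one_smul, hℓ0]
    exact hw

/-- Near a point, the fibers of a submersion `f` are smooth retracts, smoothly in the fiber: there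
is a smooth `P (x, j)` with values in the fiber over `x` and with `P (f j, j) = j`. -/
theorem exists_retraction : ∃ U : Set (B × A), IsOpen U ∧ (f a, a) ∈ U ∧ ∃ P : B × A → A,
    ContMDiffOn ((𝓡 q).prod (𝓡 p)) (𝓡 p) ∞ P U ∧ (∀ z ∈ U, f (P z) = z.1) ∧
    ∀ j, (f j, j) ∈ U → P (f j, j) = j := by
  set e := hf.domChart with he
  set d := hf.codChart with hd
  let R : B × A → EuclideanSpace ℝ (Fin p) :=
    fun z => hf.equiv.symm (d z.1, (hf.equiv (e z.2)).2)
  let S : Set (B × A) := d.source ×ˢ e.source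
  have hS : IsOpen S := d.open_source.prod e.open_source
  have hR : ContMDiffOn ((𝓡 q).prod (𝓡 p)) (𝓡 p) ∞ R S := by
    have h1 : ContMDiffOn ((𝓡 q).prod (𝓡 p)) (𝓡 q) ∞ (fun z : B × A => d z.1) S :=
      (contMDiffOn_of_mem_maximalAtlas hf.codChart_mem_maximalAtlas).comp contMDiffOn_fst
        fun z hz => hz.1
    have h2 : ContMDiffOn ((𝓡 q).prod (𝓡 p)) (𝓡 p) ∞ (fun z : B × A => e z.2) S :=
      (contMDiffOn_of_mem_maximalAtlas hf.domChart_mem_maximalAtlas).comp contMDiffOn_snd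
        fun z hz => hz.2
    have h3 : ContMDiffOn ((𝓡 q).prod (𝓡 p)) 𝓘(ℝ, hf.complement) ∞
        (fun z : B × A => (hf.equiv (e z.2)).2) S :=
      ((contDiff_snd.comp hf.equiv.contDiff).contMDiff).comp_contMDiffOn h2
    exact hf.equiv.symm.contDiff.contMDiff.comp_contMDiffOn (h1.prodMk_space h3)
  have hRe : ∀ j ∈ e.source, R (f j, j) = e j := by
    intro j hj
    have h1 := hf.codChart_apply_domChart_symm (e.map_source hj)
    rw [← he, e.left_inv hj] at h1
    simp only [R]
    rw [hd, h1]
    simp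
  have hea : a ∈ e.source := hf.mem_domChart_source
  refine ⟨S ∩ R ⁻¹' e.target, hR.continuousOn.isOpen_inter_preimage hS e.open_target,
    ⟨⟨hf.mem_codChart_source, hea⟩, ?_⟩, e.symm ∘ R, ?_, ?_, ?_⟩
  · rw [mem_preimage, hRe a hea]; exact e.map_source hea
  · exact (contMDiffOn_symm_of_mem_maximalAtlas hf.domChart_mem_maximalAtlas).comp
      (hR.mono inter_subset_left) fun z hz => hz.2
  · rintro z ⟨hz1, hz2⟩
    apply d.injOn (hf.apply_domChart_symm_mem hz2) hz1.1
    rw [hd, hf.codChart_apply_domChart_symm hz2]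
    simp [R, hd]
  · rintro j ⟨hj, -⟩
    rw [Function.comp_apply, hRe j hj.2, e.left_inv hj.2]

end Manifold.IsSubmersionAt

end Submersion

section DerivativeAlongFibers

variable {p q k : ℕ} {A B C : Type*}
  [TopologicalSpace A] [ChartedSpace (EuclideanSpace ℝ (Fin p)) A] [IsManifold (𝓡 p) ∞ A]
  [TopologicalSpace B] [ChartedSpace (EuclideanSpace ℝ (Fin q)) B] [IsManifold (𝓡 q) ∞ B]
  {E H : Type*} [NormedAddCommGroup E] [NormedSpace ℝ E] [TopologicalSpace H]
  {J : ModelWithCorners ℝ E H} [TopologicalSpace C] [ChartedSpace H C]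
  {f : A → B} {b : B}

omit [IsManifold (𝓡 p) ∞ A] [TopologicalSpace B] [ChartedSpace (EuclideanSpace ℝ (Fin q)) B]
  [IsManifold (𝓡 q) ∞ B] in
/-- The derivative along a fiber, on the velocity of a curve in the fiber. -/
theorem hasMFDerivAt_comp_curve_fiber {φ : A → C} {c : ℝ → A}
    (hφ : MDifferentiableWithinAt (𝓡 p) J φ (f ⁻¹' {b}) (c 0))
    (hc : MDifferentiableAt 𝓘(ℝ, ℝ) (𝓡 p) c 0) (hcf : ∀ᶠ t in 𝓝 (0 : ℝ), f (c t) = b) :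
    HasMFDerivAt 𝓘(ℝ, ℝ) J (φ ∘ c) 0
      ((mfderivWithin (𝓡 p) J φ (f ⁻¹' {b}) (c 0)).comp (mfderiv 𝓘(ℝ, ℝ) (𝓡 p) c 0)) := by
  have h1 : HasMFDerivWithinAt 𝓘(ℝ, ℝ) (𝓡 p) c (c ⁻¹' (f ⁻¹' {b})) 0 _ :=
    hc.hasMFDerivAt.hasMFDerivWithinAt
  exact (hφ.hasMFDerivWithinAt.comp 0 h1 subset_rfl).hasMFDerivAt hcf

omit [IsManifold (𝓡 p) ∞ A] [TopologicalSpace B] [ChartedSpace (EuclideanSpace ℝ (Fin q)) B]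
  [IsManifold (𝓡 q) ∞ B] in
theorem mfderiv_comp_curve_fiber {φ : A → C} {c : ℝ → A} {a : A} (ha : c 0 = a)
    (hφ : MDifferentiableWithinAt (𝓡 p) J φ (f ⁻¹' {b}) a)
    (hc : MDifferentiableAt 𝓘(ℝ, ℝ) (𝓡 p) c 0) (hcf : ∀ᶠ t in 𝓝 (0 : ℝ), f (c t) = b)
    (v : TangentSpace (𝓡 p) a)
    (hv : (mfderiv 𝓘(ℝ, ℝ) (𝓡 p) c 0 (1 : ℝ) : EuclideanSpace ℝ (Fin p)) = v) :
    (mfderiv 𝓘(ℝ, ℝ) J (φ ∘ c) 0 (1 : ℝ) : E) = mfderivWithin (𝓡 p) J φ (f ⁻¹' {b}) a v := by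
  subst ha
  have h1 := (hasMFDerivAt_comp_curve_fiber hφ hc hcf).mfderiv
  refine (congrArg (fun L => L (1 : ℝ)) h1).trans ?_
  exact congrArg (mfderivWithin (𝓡 p) J φ (f ⁻¹' {b}) (c 0)) hv

/-- On vectors tangent to a fiber, the derivative along the fiber is the derivative of any
extension to a neighbourhood. -/
theorem mfderivWithin_fiber_eq_mfderiv {φ ψ : A → C} {a : A}
    (hf : IsSubmersionAt (𝓡 p) (𝓡 q) ∞ f a) (hb : f a = b)
    (hψ : MDifferentiableAt (𝓡 p) J ψ a) (h : ∀ᶠ a' in 𝓝 a, f a' = b → φ a' = ψ a')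
    (v : TangentSpace (𝓡 p) a) (hv : mfderiv (𝓡 p) (𝓡 q) f a v = 0) :
    (mfderivWithin (𝓡 p) J φ (f ⁻¹' {b}) a v : E) = mfderiv (𝓡 p) J ψ a v := by
  subst hb
  have hev : φ =ᶠ[𝓝[f ⁻¹' {f a}] a] ψ := by
    filter_upwards [mem_nhdsWithin_of_mem_nhds h, self_mem_nhdsWithin] with x hx hx' using hx hx'
  have h1 : MDifferentiableWithinAt (𝓡 p) J φ (f ⁻¹' {f a}) a :=
    hψ.mdifferentiableWithinAt.congr_of_eventuallyEq hev (h.self_of_nhds rfl)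
  obtain ⟨c, hc0, hcf, hcd, hcv⟩ := exists_curve_in_fiber hf v hv
  rw [← mfderiv_comp_curve_fiber hc0 h1 hcd hcf v hcv]
  subst hc0
  have h2 : φ ∘ c =ᶠ[𝓝 0] ψ ∘ c := by
    filter_upwards [hcf, hcd.continuousAt h] with t ht ht' using ht' ht
  have h3 := (HasMFDerivAt.comp 0 hψ.hasMFDerivAt hcd.hasMFDerivAt).congr_of_eventuallyEq h2
  refine (congrArg (fun L => L (1 : ℝ)) h3.mfderiv).trans ?_
  exact congrArg (mfderiv (𝓡 p) J ψ (c 0)) hcv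

/-- Mutually inverse maps between fibers have mutually inverse derivatives along the fibers. -/
theorem mfderivWithin_fiber_leftInverse {p' : ℕ} {C B' : Type*} [TopologicalSpace C]
    [ChartedSpace (EuclideanSpace ℝ (Fin p')) C] {f' : C → B'} {φ : A → C} {ψ : C → A} {a : A}
    {y : C} {b' : B'} (hf : IsSubmersionAt (𝓡 p) (𝓡 q) ∞ f a) (hb : f a = b) (hy : φ a = y)
    (hφ : MDifferentiableWithinAt (𝓡 p) (𝓡 p') φ (f ⁻¹' {b}) a)
    (hψ : MDifferentiableWithinAt (𝓡 p') (𝓡 p) ψ (f' ⁻¹' {b'}) y)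
    (hmap : ∀ a', f a' = b → f' (φ a') = b') (hinv : ∀ a', f a' = b → ψ (φ a') = a')
    (v : TangentSpace (𝓡 p) a) (hv : mfderiv (𝓡 p) (𝓡 q) f a v = 0) :
    (mfderivWithin (𝓡 p') (𝓡 p) ψ (f' ⁻¹' {b'}) y
      (mfderivWithin (𝓡 p) (𝓡 p') φ (f ⁻¹' {b}) a v : EuclideanSpace ℝ (Fin p')) :
      EuclideanSpace ℝ (Fin p)) = v := by
  subst hb
  obtain ⟨c, hc0, hcf, hcd, hcv⟩ := exists_curve_in_fiber hf v hv
  have h1 := mfderiv_comp_curve_fiber hc0 hφ hcd hcf v hcv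
  have hcd' : MDifferentiableAt 𝓘(ℝ, ℝ) (𝓡 p') (φ ∘ c) 0 := by
    subst hc0
    exact (hasMFDerivAt_comp_curve_fiber hφ hcd hcf).mdifferentiableAt
  have h2 := mfderiv_comp_curve_fiber (f := f') (b := b') (c := φ ∘ c)
    (by rw [Function.comp_apply, hc0, hy]) hψ hcd' (hcf.mono fun t ht => hmap _ ht) _ h1
  refine h2.symm.trans (Eq.trans ?_ hcv)
  have h3 : ψ ∘ (φ ∘ c) =ᶠ[𝓝 0] c := hcf.mono fun t ht => hinv _ ht
  exact congrArg (fun L : ℝ →L[ℝ] EuclideanSpace ℝ (Fin p) => L (1 : ℝ)) h3.mfderiv_eq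

end DerivativeAlongFibers

/-! ### Translations in a Lie groupoid and invariant vector fields -/

namespace LieGroupoid

variable {m n : ℕ} {Γ M : Type*}
  [TopologicalSpace Γ] [ChartedSpace (EuclideanSpace ℝ (Fin (m + n))) Γ]
  [IsManifold (𝓡 (m + n)) ∞ Γ]
  [TopologicalSpace M] [ChartedSpace (EuclideanSpace ℝ (Fin m)) M]
  [IsManifold (𝓡 m) ∞ M]
  (G : LieGroupoid m n Γ M)

theorem inv_inv (g : Γ) : G.inv (G.inv g) = g := by
  have h1 := G.mul_unit (G.inv (G.inv g))
  rw [G.tgt_inv, G.src_inv, ← G.inv_mul, G.mul_assoc _ _ _ (G.tgt_inv _) (G.tgt_inv _), G.inv_mul,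
    G.tgt_inv, G.unit_mul] at h1
  exact h1.symm

theorem eq_inv_of_mul_eq_unit {x y : Γ} (h : G.tgt x = G.src y)
    (hxy : G.mul x y = G.unit (G.src x)) : y = G.inv x := by
  have h1 := G.mul_assoc (G.inv x) x y (G.tgt_inv x) h
  rw [hxy, G.inv_mul, h, G.unit_mul, ← G.tgt_inv, G.mul_unit] at h1
  exact h1.symm

theorem inv_mul_cancel_left {g k : Γ} (h : G.tgt g = G.src k) :
    G.mul (G.inv g) (G.mul g k) = k := by
  rw [G.mul_assoc _ _ _ (G.tgt_inv g) h, G.inv_mul, h, G.unit_mul]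

theorem mul_inv_cancel_left {g k : Γ} (h : G.src g = G.src k) :
    G.mul g (G.mul (G.inv g) k) = k := by
  rw [G.mul_assoc _ _ _ (G.src_inv g).symm ((G.tgt_inv g).trans h), G.mul_inv, h, G.unit_mul]

theorem mul_inv_cancel_right {g k : Γ} (h : G.tgt k = G.src g) :
    G.mul (G.mul k g) (G.inv g) = k := by
  rw [← G.mul_assoc _ _ _ h (G.src_inv g).symm, G.mul_inv, ← h, G.mul_unit]

theorem inv_mul_cancel_right {g k : Γ} (h : G.tgt k = G.tgt g) :
    G.mul (G.mul k (G.inv g)) g = k := by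
  rw [← G.mul_assoc _ _ _ (h.trans (G.src_inv g).symm) (G.tgt_inv g), G.inv_mul, ← h, G.mul_unit]

theorem inv_inv_mul {g k : Γ} (h : G.src k = G.src g) :
    G.inv (G.mul (G.inv g) k) = G.mul (G.inv k) g := by
  have h1 : G.tgt (G.inv g) = G.src k := (G.tgt_inv g).trans h.symm
  have h2 : G.tgt (G.inv k) = G.src g := (G.tgt_inv k).trans h
  refine (G.eq_inv_of_mul_eq_unit ?_ ?_).symm
  · rw [G.tgt_mul _ _ h1, G.src_mul _ _ h2, G.src_inv]
  · rw [← G.mul_assoc _ _ _ h1 (by rw [G.src_mul _ _ h2, G.src_inv]), G.mul_inv_cancel_left h,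
      G.inv_mul, G.src_mul _ _ h1, G.src_inv]

section Smoothness

variable {E H N : Type*} [NormedAddCommGroup E] [NormedSpace ℝ E] [TopologicalSpace H]
  {J : ModelWithCorners ℝ E H} [TopologicalSpace N] [ChartedSpace H N]

theorem contMDiffWithinAt_mul_comp {u w : N → Γ} {s : Set N} {y : N} (hy : y ∈ s)
    (hu : ContMDiffWithinAt J (𝓡 (m + n)) ∞ u s y) (hw : ContMDiffWithinAt J (𝓡 (m + n)) ∞ w s y)
    (h : ∀ z ∈ s, G.tgt (u z) = G.src (w z)) :
    ContMDiffWithinAt J (𝓡 (m + n)) ∞ (fun z => G.mul (u z) (w z)) s y :=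
  (G.contMDiffOn_mul (u y, w y) (h y hy)).comp y (hu.prodMk hw) fun z hz => h z hz

theorem contMDiffAt_mul_comp {u w : N → Γ} {y : N} (hu : ContMDiffAt J (𝓡 (m + n)) ∞ u y)
    (hw : ContMDiffAt J (𝓡 (m + n)) ∞ w y) (h : ∀ᶠ z in 𝓝 y, G.tgt (u z) = G.src (w z)) :
    ContMDiffAt J (𝓡 (m + n)) ∞ (fun z => G.mul (u z) (w z)) y :=
  (G.contMDiffWithinAt_mul_comp (s := {z | G.tgt (u z) = G.src (w z)}) h.self_of_nhds
    hu.contMDiffWithinAt hw.contMDiffWithinAt fun _ hz => hz).contMDiffAt h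

end Smoothness

theorem mdifferentiableWithinAt_mul_left (g : Γ) {x : M} (hx : G.tgt g = x) {k : Γ}
    (hk : G.src k = x) : MDifferentiableWithinAt (𝓡 (m + n)) (𝓡 (m + n)) (fun k => G.mul g k)
      (G.src ⁻¹' {x}) k :=
  (G.contMDiffWithinAt_mul_comp (s := G.src ⁻¹' {x}) hk contMDiffWithinAt_const
    contMDiffWithinAt_id fun _ hz => hx.trans (Eq.symm hz)).mdifferentiableWithinAt (by simp)

theorem mdifferentiableWithinAt_inv_mul (g : Γ) {x : M} (hx : G.src g = x) {k : Γ}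
    (hk : G.src k = x) : MDifferentiableWithinAt (𝓡 (m + n)) (𝓡 (m + n))
      (fun k => G.mul (G.inv k) g) (G.src ⁻¹' {x}) k :=
  (G.contMDiffWithinAt_mul_comp (s := G.src ⁻¹' {x}) hk
    G.contMDiff_inv.contMDiffAt.contMDiffWithinAt contMDiffWithinAt_const fun z hz =>
      (G.tgt_inv z).trans ((show G.src z = x from hz).trans hx.symm)).mdifferentiableWithinAt
    (by simp)

theorem mdifferentiableWithinAt_inv_mul_inv (g : Γ) {k : Γ} (hk : G.tgt k = G.tgt g) :
    MDifferentiableWithinAt (𝓡 (m + n)) (𝓡 (m + n))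
      (fun k => G.inv (G.mul k (G.inv g))) (G.tgt ⁻¹' {G.tgt g}) k :=
  (G.contMDiff_inv.contMDiffAt.comp_contMDiffWithinAt k
    (G.contMDiffWithinAt_mul_comp hk contMDiffWithinAt_id contMDiffWithinAt_const
      fun _ hz => (show _ = _ from hz).trans (G.src_inv g).symm)).mdifferentiableWithinAt (by simp)

theorem tangentLeftSymm_tangentLeft (g : Γ) (v : G.algFiber (G.tgt g)) :
    G.tangentLeftSymm g (G.tangentLeft g v) = v :=
  Subtype.ext <| mfderivWithin_fiber_leftInverse (f' := G.src)
    (G.isSubmersion_src.isSubmersionAt _) (G.src_unit _) (G.mul_unit g)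
    (G.mdifferentiableWithinAt_mul_left g rfl (G.src_unit _))
    (G.mdifferentiableWithinAt_mul_left (G.inv g) (G.tgt_inv g) rfl)
    (fun k hk => G.src_mul g k hk.symm) (fun _ hk => G.inv_mul_cancel_left hk.symm) v.1 v.2

theorem tangentLeft_tangentLeftSymm (g : Γ) (v : G.vertSrc g) :
    G.tangentLeft g (G.tangentLeftSymm g v) = v :=
  Subtype.ext <| mfderivWithin_fiber_leftInverse (f' := G.src)
    (G.isSubmersion_src.isSubmersionAt _) rfl (G.inv_mul g)
    (G.mdifferentiableWithinAt_mul_left (G.inv g) (G.tgt_inv g) rfl)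
    (G.mdifferentiableWithinAt_mul_left g rfl (G.src_unit _))
    (fun k hk => (G.src_mul _ k ((G.tgt_inv g).trans hk.symm)).trans (G.src_inv g))
    (fun _ hk => G.mul_inv_cancel_left hk.symm) v.1 v.2

theorem tangentRightInvSymm_tangentRightInv (g : Γ) (v : G.algFiber (G.src g)) :
    G.tangentRightInvSymm g (G.tangentRightInv g v) = v :=
  Subtype.ext <| mfderivWithin_fiber_leftInverse (f' := G.tgt)
    (G.isSubmersion_src.isSubmersionAt _) (G.src_unit _)
    (by rw [G.inv_unit, G.unit_mul])
    (G.mdifferentiableWithinAt_inv_mul g rfl (G.src_unit _))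
    (G.mdifferentiableWithinAt_inv_mul_inv g rfl)
    (fun k hk => G.tgt_mul (G.inv k) g ((G.tgt_inv k).trans hk))
    (fun k hk => by rw [G.mul_inv_cancel_right ((G.tgt_inv k).trans hk), G.inv_inv]) v.1 v.2

theorem tangentRightInv_tangentRightInvSymm (g : Γ) (v : G.vertTgt g) :
    G.tangentRightInv g (G.tangentRightInvSymm g v) = v :=
  Subtype.ext <| mfderivWithin_fiber_leftInverse (f' := G.src)
    (G.isSubmersion_tgt.isSubmersionAt _) rfl (by rw [G.mul_inv, G.inv_unit])
    (G.mdifferentiableWithinAt_inv_mul_inv g rfl)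
    (G.mdifferentiableWithinAt_inv_mul g rfl (G.src_unit _))
    (fun k hk => by
      rw [G.src_inv, G.tgt_mul _ _ (hk.trans (G.src_inv g).symm), G.tgt_inv])
    (fun k hk => by rw [G.inv_inv, G.inv_mul_cancel_right hk]) v.1 v.2

/-- Left-invariant fields of sections that are smooth near `β g` are smooth at `g`. -/
theorem contMDiffAt_leftField (b : ∀ x, G.algFiber x) (g : Γ)
    (hb : ContMDiffAt (𝓡 m) (𝓡 (m + n)).tangent ∞
      (fun y => (⟨G.unit y, (b y).1⟩ : TangentBundle (𝓡 (m + n)) Γ)) (G.tgt g)) :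
    ContMDiffAt (𝓡 (m + n)) (𝓡 (m + n)).tangent ∞
      (fun k => (⟨k, (G.leftField b k).1⟩ : TangentBundle (𝓡 (m + n)) Γ)) g := by
  obtain ⟨U, hU, hgU, P, hP, hPf, hPj⟩ :=
    (G.isSubmersion_src.isSubmersionAt (G.unit (G.tgt g))).exists_retraction
  rw [G.src_unit] at hgU
  have htgt : ContMDiff (𝓡 (m + n)) (𝓡 m) ∞ G.tgt := G.isSubmersion_tgt.contMDiff
  -- a smooth extension of the multiplication to a neighbourhood of `(g, ε (β g))`
  let μ : Γ × Γ → Γ := fun z => G.mul z.1 (P (G.tgt z.1, z.2))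
  let W : Set (Γ × Γ) := {z | (G.tgt z.1, z.2) ∈ U}
  have hW : IsOpen W := hU.preimage
    ((htgt.continuous.comp continuous_fst).prodMk continuous_snd)
  have hμ : ContMDiffOn ((𝓡 (m + n)).prod (𝓡 (m + n))) (𝓡 (m + n)) ∞ μ W := by
    intro z hz
    have h1 : ContMDiffWithinAt ((𝓡 (m + n)).prod (𝓡 (m + n))) ((𝓡 m).prod (𝓡 (m + n))) ∞
        (fun z : Γ × Γ => (G.tgt z.1, z.2)) W z :=
      (htgt.contMDiffAt.comp z contMDiffAt_fst).prodMk contMDiffAt_snd |>.contMDiffWithinAt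
    exact G.contMDiffWithinAt_mul_comp hz contMDiffWithinAt_fst
      ((hP _ hz).comp z h1 fun z hz => hz) fun z hz => (hPf _ hz).symm
  let X : Γ → TangentBundle ((𝓡 (m + n)).prod (𝓡 (m + n))) (Γ × Γ) := fun k =>
    (equivTangentBundleProd (𝓡 (m + n)) Γ (𝓡 (m + n)) Γ).symm
      (⟨k, 0⟩, ⟨G.unit (G.tgt k), (b (G.tgt k)).1⟩)
  have hX : ContMDiffAt (𝓡 (m + n)) ((𝓡 (m + n)).prod (𝓡 (m + n))).tangent ∞ X g := by
    have h0 : ContMDiffAt (𝓡 (m + n)) (𝓡 (m + n)).tangent ∞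
        (fun k => (⟨k, 0⟩ : TangentBundle (𝓡 (m + n)) Γ)) g :=
      (Bundle.contMDiff_zeroSection ℝ (TangentSpace (𝓡 (m + n)) : Γ → Type _)).contMDiffAt
    exact contMDiff_equivTangentBundleProd_symm.contMDiffAt.comp g
      (h0.prodMk (hb.comp g htgt.contMDiffAt))
  have hXg : (X g).proj ∈ W := hgU
  have hWg : ∀ᶠ k in 𝓝 g, (X k).proj ∈ W := by
    have : Continuous fun k => (X k).proj :=
      continuous_id.prodMk (G.contMDiff_unit.continuous.comp htgt.continuous)
    exact this.continuousAt.eventually (hW.mem_nhds hXg)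
  refine (ContMDiffAt.tangentMap_comp hW hμ hX hXg).congr_of_eventuallyEq ?_
  filter_upwards [hWg] with k hk
  have hkU : (G.src (G.unit (G.tgt k)), G.unit (G.tgt k)) ∈ U := by rw [G.src_unit]; exact hk
  have hbase : k = μ (k, G.unit (G.tgt k)) := by
    have := hPj _ hkU
    rw [G.src_unit] at this
    simp only [μ, this, G.mul_unit]
  refine tangentBundle_mk_eq hbase ?_
  have hμd : MDifferentiableAt ((𝓡 (m + n)).prod (𝓡 (m + n))) (𝓡 (m + n)) μ
      (k, G.unit (G.tgt k)) := (hμ.contMDiffAt (hW.mem_nhds hk)).mdifferentiableAt (by simp)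
  have hid : MDifferentiableAt (𝓡 (m + n)) ((𝓡 (m + n)).prod (𝓡 (m + n)))
      (fun j : Γ => (k, j)) (G.unit (G.tgt k)) :=
    mdifferentiableAt_const.prodMk mdifferentiableAt_id
  have h1 := mfderivWithin_fiber_eq_mfderiv (J := 𝓡 (m + n)) (φ := fun j => G.mul k j)
    (ψ := μ ∘ fun j => (k, j)) (G.isSubmersion_src.isSubmersionAt (G.unit (G.tgt k)))
    (G.src_unit _) (hμd.comp _ hid) ?_ (b (G.tgt k)).1 (b (G.tgt k)).2
  · refine h1.trans ?_
    rw [mfderiv_comp _ hμd hid, mfderiv_prod_right]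
    rfl
  · have : ∀ᶠ j in 𝓝 (G.unit (G.tgt k)), (G.tgt k, j) ∈ U :=
      (Continuous.prodMk_right (G.tgt k)).continuousAt.eventually (hU.mem_nhds hk)
    filter_upwards [this] with j hj hjk
    have h2 := hPj j (by rw [hjk]; exact hj)
    simp only [Function.comp_apply, μ]
    rw [← hjk, h2]

/-- As `k⁻¹ g = (g⁻¹ k)⁻¹`, right translations are left translations composed with the inversion.
The vectors `v` and `w` are equal, in fibers over the equal points `α(g)` and `β(g⁻¹)`. -/
theorem dRightInv_eq (g : Γ) (v : G.algFiber (G.src g)) (w : G.algFiber (G.tgt (G.inv g)))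
    (hvw : (v.1 : EuclideanSpace ℝ (Fin (m + n))) = w.1) :
    (G.dRightInv g v.1 : EuclideanSpace ℝ (Fin (m + n))) =
      mfderiv (𝓡 (m + n)) (𝓡 (m + n)) G.inv (G.inv g) (G.dLeft (G.inv g) w.1) := by
  obtain ⟨c, hc0, hcf, hcd, hcv⟩ := exists_curve_in_fiber
    (G.isSubmersion_src.isSubmersionAt (G.unit (G.src g))) v.1 v.2
  rw [G.src_unit] at hcf
  have h1 := mfderiv_comp_curve_fiber hc0
    (G.mdifferentiableWithinAt_inv_mul g rfl (G.src_unit _)) hcd hcf v.1 hcv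
  have hc0' : c 0 = G.unit (G.tgt (G.inv g)) := by rw [hc0, G.tgt_inv]
  have hcf' : ∀ᶠ t in 𝓝 (0 : ℝ), G.src (c t) = G.tgt (G.inv g) := by simpa [G.tgt_inv] using hcf
  have hdl := G.mdifferentiableWithinAt_mul_left (G.inv g) rfl (G.src_unit (G.tgt (G.inv g)))
  have h2 := mfderiv_comp_curve_fiber hc0' hdl hcd hcf' w.1 (hcv.trans hvw)
  have hlc : MDifferentiableAt 𝓘(ℝ, ℝ) (𝓡 (m + n)) ((fun k => G.mul (G.inv g) k) ∘ c) 0 :=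
    (hasMFDerivAt_comp_curve_fiber (by rw [hc0']; exact hdl) hcd hcf').mdifferentiableAt
  have h3 : (fun k => G.mul (G.inv k) g) ∘ c =ᶠ[𝓝 0]
      G.inv ∘ ((fun k => G.mul (G.inv g) k) ∘ c) := by
    filter_upwards [hcf] with t ht
    exact (G.inv_inv_mul ht).symm
  have hb : ((fun k => G.mul (G.inv g) k) ∘ c) 0 = G.inv g := by
    simp only [Function.comp_apply, hc0', G.mul_unit]
  have hid : MDifferentiableAt (𝓡 (m + n)) (𝓡 (m + n)) G.inv
      (((fun k => G.mul (G.inv g) k) ∘ c) 0) := G.contMDiff_inv.mdifferentiableAt (by simp)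
  have h4 := (HasMFDerivAt.comp 0 hid.hasMFDerivAt hlc.hasMFDerivAt).congr_of_eventuallyEq h3
  refine h1.symm.trans ((congrArg (fun L => L (1 : ℝ)) h4.mfderiv).trans ?_)
  change mfderiv (𝓡 (m + n)) (𝓡 (m + n)) G.inv (((fun k => G.mul (G.inv g) k) ∘ c) 0)
    (mfderiv 𝓘(ℝ, ℝ) (𝓡 (m + n)) ((fun k => G.mul (G.inv g) k) ∘ c) 0 (1 : ℝ)) = _
  rw [hb]
  exact congrArg _ h2

/-- Right-invariant fields of sections that are smooth near `α g` are smooth at `g`. The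
inversion carries them to left-invariant fields. -/
theorem contMDiffAt_rightField (a : ∀ x, G.algFiber x) (g : Γ)
    (ha : ContMDiffAt (𝓡 m) (𝓡 (m + n)).tangent ∞
      (fun y => (⟨G.unit y, (a y).1⟩ : TangentBundle (𝓡 (m + n)) Γ)) (G.src g)) :
    ContMDiffAt (𝓡 (m + n)) (𝓡 (m + n)).tangent ∞
      (fun k => (⟨k, (G.rightField a k).1⟩ : TangentBundle (𝓡 (m + n)) Γ)) g := by
  have h1 : ContMDiffAt (𝓡 (m + n)) (𝓡 (m + n)).tangent ∞ (fun k =>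
      (⟨G.inv k, (G.leftField a (G.inv k)).1⟩ : TangentBundle (𝓡 (m + n)) Γ)) g :=
    (G.contMDiffAt_leftField a (G.inv g) (by rw [G.tgt_inv]; exact ha)).comp g
      G.contMDiff_inv.contMDiffAt
  have h2 := ContMDiffAt.tangentMap_comp isOpen_univ G.contMDiff_inv.contMDiffOn h1 (mem_univ _)
  have h3 : ContMDiffAt (𝓡 (m + n)) (𝓡 (m + n)).tangent ∞ (fun k =>
      (⟨k, (G.tangentRightInv k (a (G.src k))).1⟩ : TangentBundle (𝓡 (m + n)) Γ)) g := by
    refine h2.congr_of_eventuallyEq (Filter.Eventually.of_forall fun k => ?_)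
    exact tangentBundle_mk_eq (G.inv_inv k).symm
      (G.dRightInv_eq k _ _ (congrArg (fun x => ((a x).1 : EuclideanSpace ℝ (Fin (m + n))))
        (G.tgt_inv k).symm))
  have h4 := ContMDiffAt.sum_smul_along (I := 𝓡 (m + n)) (J := 𝓡 (m + n))
    (W := (TangentSpace (𝓡 (m + n)) : Γ → Type _)) (φ := id) {()}
    (X := fun _ k => (G.tangentRightInv k (a (G.src k))).1) (c := fun _ _ => (-1 : ℝ))
    (x := g) contMDiffAt_id (fun _ _ => h3) (fun _ _ => contMDiffAt_const)
  refine h4.congr_of_eventuallyEq (Filter.Eventually.of_forall fun k => ?_)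
  refine tangentBundle_mk_eq rfl ?_
  simp [rightField]

end LieGroupoid

/-! ### The Poincaré-Cartan 2-section -/

/-- Symmetry of mixed partial derivatives. -/
theorem deriv_deriv_comm_of_contDiffAt {f : ℝ × ℝ → ℝ} (hf : ContDiffAt ℝ 2 f (0, 0)) :
    deriv (fun s => deriv (fun t => f (s, t)) 0) 0 =
      deriv (fun t => deriv (fun s => f (s, t)) 0) 0 := by
  have hev : ∀ᶠ z in 𝓝 ((0, 0) : ℝ × ℝ), DifferentiableAt ℝ f z :=
    (hf.eventually (by simp)).mono fun z hz => hz.differentiableAt (by simp)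
  have hd : HasFDerivAt (fderiv ℝ f) (fderiv ℝ (fderiv ℝ f) (0, 0)) (0, 0) :=
    ((hf.fderiv_right (m := 1) (by norm_num)).differentiableAt (by simp)).hasFDerivAt
  have hs : ∀ s t : ℝ, HasDerivAt (fun s : ℝ => (s, t)) ((1, 0) : ℝ × ℝ) s := fun s t =>
    (hasDerivAt_id s).prodMk (hasDerivAt_const s t)
  have ht : ∀ s t : ℝ, HasDerivAt (fun t : ℝ => (s, t)) ((0, 1) : ℝ × ℝ) t := fun s t =>
    (hasDerivAt_const t s).prodMk (hasDerivAt_id t)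
  have h1 : (fun s => deriv (fun t => f (s, t)) 0) =ᶠ[𝓝 0] fun s => fderiv ℝ f (s, 0) (0, 1) := by
    filter_upwards [(hs 0 0).continuousAt.eventually hev] with s h
    exact (h.hasFDerivAt.comp_hasDerivAt (0 : ℝ) (ht s 0)).deriv
  have h2 : (fun t => deriv (fun s => f (s, t)) 0) =ᶠ[𝓝 0] fun t => fderiv ℝ f (0, t) (1, 0) := by
    filter_upwards [(ht 0 0).continuousAt.eventually hev] with t h
    exact (h.hasFDerivAt.comp_hasDerivAt (0 : ℝ) (hs 0 t)).deriv
  have h3 := ((hd.comp_hasDerivAt (f := fun s : ℝ => (s, (0 : ℝ))) (0 : ℝ)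
    (hs 0 0)).clm_apply (hasDerivAt_const (0 : ℝ) (0, 1)))
  have h4 := ((hd.comp_hasDerivAt (f := fun t : ℝ => ((0 : ℝ), t)) (0 : ℝ)
    (ht 0 0)).clm_apply (hasDerivAt_const (0 : ℝ) (1, 0)))
  rw [h1.deriv_eq, h2.deriv_eq]
  refine h3.deriv.trans (Eq.trans ?_ h4.deriv.symm)
  simpa using (hf.isSymmSndFDerivAt (by simp)).eq (1, 0) (0, 1)

namespace LieGroupoid

variable {m n : ℕ} {Γ M : Type*}
  [TopologicalSpace Γ] [ChartedSpace (EuclideanSpace ℝ (Fin (m + n))) Γ]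
  [IsManifold (𝓡 (m + n)) ∞ Γ]
  [TopologicalSpace M] [ChartedSpace (EuclideanSpace ℝ (Fin m)) M]
  [IsManifold (𝓡 m) ∞ M]
  (G : LieGroupoid m n Γ M)

/-- The section `a` of the Lie algebroid is smooth at `x`. -/
def SectionSmoothAt (a : ∀ x, G.algFiber x) (x : M) : Prop :=
  ContMDiffAt (𝓡 m) (𝓡 (m + n)).tangent ∞
    (fun y => (⟨G.unit y, (a y).1⟩ : TangentBundle (𝓡 (m + n)) Γ)) x

variable {G} in
theorem IsSectionNear.smoothAt {a : ∀ x, G.algFiber x} {x : M} (h : G.IsSectionNear a x) :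
    G.SectionSmoothAt a x := by
  obtain ⟨U, hU, hx, h⟩ := h
  exact h.contMDiffAt (hU.mem_nhds hx)

/-- The Lie algebroid has local smooth frames, given as linear maps from the model
fiber `ℝⁿ` to sections. -/
theorem exists_frame (x₀ : M) : ∃ U : Set M, IsOpen U ∧ x₀ ∈ U ∧
    ∃ s : EuclideanSpace ℝ (Fin n) →ₗ[ℝ] (∀ x, G.algFiber x),
      (∀ w, ∀ y ∈ U, G.SectionSmoothAt (s w) y) ∧ ∀ y ∈ U, Function.Bijective fun w => s w y := by
  classical
  have hf := G.isSubmersion_src.isSubmersionAt (G.unit x₀)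
  obtain ⟨hrank, hfin⟩ := hf.finrank_complement
  rw [Nat.add_sub_cancel_left] at hrank
  let ε : EuclideanSpace ℝ (Fin n) ≃ₗ[ℝ] hf.complement :=
    LinearEquiv.ofFinrankEq _ _ (by rw [hrank, finrank_euclideanSpace_fin])
  let ι : EuclideanSpace ℝ (Fin n) →ₗ[ℝ] EuclideanSpace ℝ (Fin (m + n)) :=
    hf.equiv.symm.toLinearMap ∘ₗ LinearMap.inr ℝ _ _ ∘ₗ ε.toLinearMap
  set e := hf.domChart with he
  let U : Set M := G.unit ⁻¹' e.source
  have hU : IsOpen U := e.open_source.preimage G.contMDiff_unit.continuous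
  have hvert : ∀ y ∈ U, ∀ w, (mfderiv (𝓡 (m + n)) (𝓡 (m + n)) e.symm (e (G.unit y)) (ι w) :
      EuclideanSpace ℝ (Fin (m + n))) ∈ G.algFiber y := by
    intro y hy w
    have h1 := (hf.mfderiv_domChart_symm_eq_zero_iff (e.map_source hy) (ι w)).2 (by simp [ι])
    have h2 : e.symm (e (G.unit y)) = G.unit y := e.left_inv hy
    rw [← he, h2] at h1
    exact h1
  let s : EuclideanSpace ℝ (Fin n) →ₗ[ℝ] (∀ x, G.algFiber x) :=
    { toFun := fun w y => if hy : y ∈ U then ⟨_, hvert y hy w⟩ else 0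
      map_add' := by
        intro w w'; funext y
        by_cases hy : y ∈ U
        · simp only [hy, dite_true, Pi.add_apply]
          refine Subtype.ext ?_
          have := map_add (mfderiv (𝓡 (m + n)) (𝓡 (m + n)) e.symm (e (G.unit y))) (ι w) (ι w')
          exact (congrArg _ (map_add ι w w')).trans this
        · simp [hy]
      map_smul' := by
        intro c w; funext y
        by_cases hy : y ∈ U
        · simp only [hy, dite_true, Pi.smul_apply, RingHom.id_apply]
          refine Subtype.ext ?_
          have := map_smul (mfderiv (𝓡 (m + n)) (𝓡 (m + n)) e.symm (e (G.unit y))) c (ι w)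
          exact (congrArg _ (map_smul ι c w)).trans this
        · simp [hy] }
  have hs : ∀ w, ∀ y ∈ U, ((s w y).1 : EuclideanSpace ℝ (Fin (m + n))) =
      mfderiv (𝓡 (m + n)) (𝓡 (m + n)) e.symm (e (G.unit y)) (ι w) := by
    intro w y hy
    simp only [s, LinearMap.coe_mk, AddHom.coe_mk, hy, dite_true]
    rfl
  have hinj : ∀ y ∈ U, Function.Injective
      (mfderiv (𝓡 (m + n)) (𝓡 (m + n)) e.symm (e (G.unit y))) := fun y hy =>
    hf.mdifferentiable_domChart.symm.mfderiv_injective (e.map_source hy)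
  refine ⟨U, hU, hf.mem_domChart_source, s, ?_, ?_⟩
  · intro w y hy
    have h1 : ContMDiffAt (𝓡 m) (𝓡 (m + n)).tangent ∞ (fun y =>
        (⟨e (G.unit y), ι w⟩ : TangentBundle (𝓡 (m + n)) (EuclideanSpace ℝ (Fin (m + n))))) y := by
      have h2 : ContMDiff (𝓡 (m + n)) (𝓡 (m + n)).tangent ∞ (fun z =>
          (⟨z, ι w⟩ : TangentBundle (𝓡 (m + n)) (EuclideanSpace ℝ (Fin (m + n))))) :=
        contMDiff_vectorSpace_iff_contDiff.2 contDiff_const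
      exact h2.contMDiffAt.comp y (((contMDiffOn_of_mem_maximalAtlas
        hf.domChart_mem_maximalAtlas).contMDiffAt (e.open_source.mem_nhds hy)).comp y
          G.contMDiff_unit.contMDiffAt)
    have h3 := ContMDiffAt.tangentMap_comp e.open_target
      (contMDiffOn_symm_of_mem_maximalAtlas hf.domChart_mem_maximalAtlas) h1 (e.map_source hy)
    refine h3.congr_of_eventuallyEq ?_
    filter_upwards [hU.mem_nhds hy] with z hz
    exact tangentBundle_mk_eq (e.left_inv hz).symm (hs w z hz)
  · intro y hy
    constructor
    · intro w w' hww'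
      have h1 : (s w y).1 = (s w' y).1 := congrArg Subtype.val hww'
      have h2 := hinj y hy ((hs w y hy).symm.trans (h1.trans (hs w' y hy)))
      have h3 := congrArg Prod.snd (hf.equiv.symm.injective h2)
      exact ε.injective h3
    · intro v
      have hsurj : Function.Surjective
          (mfderiv (𝓡 (m + n)) (𝓡 (m + n)) e.symm (e (G.unit y))) :=
        hf.mdifferentiable_domChart.symm.mfderiv_surjective (e.map_source hy)
      obtain ⟨w, hw⟩ := hsurj (v.1 : EuclideanSpace ℝ (Fin (m + n)))
      have h2 : e.symm (e (G.unit y)) = G.unit y := e.left_inv hy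
      have h1 := hf.mfderiv_domChart_symm_eq_zero_iff (e.map_source hy) w
      rw [← he, h2] at h1
      have h3 : (hf.equiv w).1 = 0 := h1.1 ((congrArg _ hw).trans v.2)
      refine ⟨ε.symm (hf.equiv w).2, Subtype.ext ?_⟩
      refine (hs _ y hy).trans (Eq.trans ?_ hw)
      have h4 : ι (ε.symm (hf.equiv w).2) = w := by
        apply hf.equiv.injective
        exact Prod.ext (by simp [ι, h3]) (by simp [ι])
      rw [h4]

/-- Every element of a fiber extends to a section that is smooth near the base point. -/
theorem exists_isSectionNear {x : M} (v : G.algFiber x) :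
    ∃ a, G.IsSectionNear a x ∧ a x = v := by
  obtain ⟨U, hU, hx, s, hs, hb⟩ := G.exists_frame x
  obtain ⟨w, hw⟩ := (hb x hx).2 v
  exact ⟨s w, ⟨U, hU, hx, fun y hy => (hs w y hy).contMDiffWithinAt⟩, hw⟩

/-- The derivative of `L` along the left-invariant field of `b`. -/
noncomputable def derivLeft (L : Γ → ℝ) (b : ∀ x, G.algFiber x) (k : Γ) : ℝ :=
  dirDeriv L k (G.leftField b k).1

/-- The derivative of `L` along the right-invariant field of `a`. -/
noncomputable def derivRight (L : Γ → ℝ) (a : ∀ x, G.algFiber x) (k : Γ) : ℝ :=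
  dirDeriv L k (G.rightField a k).1

variable {G}

theorem contMDiffAt_derivLeft {L : Γ → ℝ} (hL : ContMDiff (𝓡 (m + n)) 𝓘(ℝ, ℝ) ∞ L)
    {b : ∀ x, G.algFiber x} {g : Γ} (hb : G.SectionSmoothAt b (G.tgt g)) :
    ContMDiffAt (𝓡 (m + n)) 𝓘(ℝ, ℝ) ∞ (G.derivLeft L b) g :=
  ContMDiffAt.vecDeriv_comp isOpen_univ hL.contMDiffOn (G.contMDiffAt_leftField b g hb)
    (mem_univ _)

theorem contMDiffAt_derivRight {L : Γ → ℝ} (hL : ContMDiff (𝓡 (m + n)) 𝓘(ℝ, ℝ) ∞ L)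
    {a : ∀ x, G.algFiber x} {g : Γ} (ha : G.SectionSmoothAt a (G.src g)) :
    ContMDiffAt (𝓡 (m + n)) 𝓘(ℝ, ℝ) ∞ (G.derivRight L a) g :=
  ContMDiffAt.vecDeriv_comp isOpen_univ hL.contMDiffOn (G.contMDiffAt_rightField a g ha)
    (mem_univ _)

omit [IsManifold (𝓡 (m + n)) ∞ Γ] in
theorem hasDerivAt_comp_curve {ψ : Γ → ℝ} {γ : ℝ → Γ} {g : Γ} (hγ0 : γ 0 = g)
    (hγ : MDifferentiableAt 𝓘(ℝ, ℝ) (𝓡 (m + n)) γ 0)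
    (hψ : MDifferentiableAt (𝓡 (m + n)) 𝓘(ℝ, ℝ) ψ g) (v : TangentSpace (𝓡 (m + n)) g)
    (hv : (mfderiv 𝓘(ℝ, ℝ) (𝓡 (m + n)) γ 0 (1 : ℝ) : EuclideanSpace ℝ (Fin (m + n))) = v) :
    HasDerivAt (ψ ∘ γ) (dirDeriv ψ g v) 0 := by
  subst hγ0
  let T : ℝ →L[ℝ] ℝ :=
    (mfderiv (𝓡 (m + n)) 𝓘(ℝ, ℝ) ψ (γ 0)).comp (mfderiv 𝓘(ℝ, ℝ) (𝓡 (m + n)) γ 0)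
  have h1 : HasFDerivAt (ψ ∘ γ) T 0 :=
    hasMFDerivAt_iff_hasFDerivAt.1 (HasMFDerivAt.comp 0 hψ.hasMFDerivAt hγ.hasMFDerivAt)
  have h2 : T 1 = dirDeriv ψ (γ 0) v := congrArg (mfderiv (𝓡 (m + n)) 𝓘(ℝ, ℝ) ψ (γ 0)) hv
  rw [← h2]
  exact h1.hasDerivAt

/-- The curve `t ↦ k d(t)` is tangent to the left-invariant field of `b` at `k`, for a curve `d`
in a fiber of `α` that starts at a unit with velocity `b`. -/
theorem hasDerivAt_mul_curve {ψ : Γ → ℝ} {k : Γ} {x : M} (hk : G.tgt k = x) {d : ℝ → Γ}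
    (hd0 : d 0 = G.unit x) (hdx : ∀ᶠ t in 𝓝 (0 : ℝ), G.src (d t) = x)
    (hd : MDifferentiableAt 𝓘(ℝ, ℝ) (𝓡 (m + n)) d 0) {b : ∀ x, G.algFiber x}
    (hdb : (mfderiv 𝓘(ℝ, ℝ) (𝓡 (m + n)) d 0 (1 : ℝ) : EuclideanSpace ℝ (Fin (m + n))) = (b x).1)
    (hψ : MDifferentiableAt (𝓡 (m + n)) 𝓘(ℝ, ℝ) ψ k) :
    HasDerivAt (fun t => ψ (G.mul k (d t))) (dirDeriv ψ k (G.leftField b k).1) 0 := by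
  subst hk
  have hm := G.mdifferentiableWithinAt_mul_left k rfl (G.src_unit (G.tgt k))
  have h1 := mfderiv_comp_curve_fiber hd0 hm hd hdx _ hdb
  refine hasDerivAt_comp_curve (γ := (fun j => G.mul k j) ∘ d) ?_ ?_ hψ _ h1
  · simp only [Function.comp_apply, hd0, G.mul_unit]
  · exact (hasMFDerivAt_comp_curve_fiber (by rw [hd0]; exact hm) hd hdx).mdifferentiableAt

/-- The curve `s ↦ c(s)⁻¹ k` is tangent to minus the right-invariant field of `a` at `k`, for a
curve `c` in a fiber of `α` that starts at a unit with velocity `a`. -/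
theorem hasDerivAt_inv_curve_mul {ψ : Γ → ℝ} {k : Γ} {x : M} (hk : G.src k = x) {c : ℝ → Γ}
    (hc0 : c 0 = G.unit x) (hcx : ∀ᶠ t in 𝓝 (0 : ℝ), G.src (c t) = x)
    (hc : MDifferentiableAt 𝓘(ℝ, ℝ) (𝓡 (m + n)) c 0) {a : ∀ x, G.algFiber x}
    (hca : (mfderiv 𝓘(ℝ, ℝ) (𝓡 (m + n)) c 0 (1 : ℝ) : EuclideanSpace ℝ (Fin (m + n))) = (a x).1)
    (hψ : MDifferentiableAt (𝓡 (m + n)) 𝓘(ℝ, ℝ) ψ k) :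
    HasDerivAt (fun t => ψ (G.mul (G.inv (c t)) k)) (-dirDeriv ψ k (G.rightField a k).1) 0 := by
  subst hk
  have hm := G.mdifferentiableWithinAt_inv_mul k rfl (G.src_unit (G.src k))
  have h1 := mfderiv_comp_curve_fiber hc0 hm hc hcx _ hca
  have h2 : -dirDeriv ψ k (G.rightField a k).1 =
      dirDeriv ψ k (G.tangentRightInv k (a (G.src k))).1 := by
    simp [rightField]
  rw [h2]
  refine hasDerivAt_comp_curve (γ := (fun j => G.mul (G.inv j) k) ∘ c) ?_ ?_ hψ _ h1
  · simp only [Function.comp_apply, hc0, G.inv_unit, G.unit_mul]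
  · exact (hasMFDerivAt_comp_curve_fiber (by rw [hc0]; exact hm) hc hcx).mdifferentiableAt

/-- Left-invariant and right-invariant derivatives commute: both mixed derivatives at `g` are, up
to sign, the mixed second derivative at `0` of `L (c(s)⁻¹ g d(t))`. -/
theorem dirDeriv_derivLeft_rightField {L : Γ → ℝ} (hL : ContMDiff (𝓡 (m + n)) 𝓘(ℝ, ℝ) ∞ L)
    {g : Γ} {a b : ∀ x, G.algFiber x} (ha : G.SectionSmoothAt a (G.src g))
    (hb : G.SectionSmoothAt b (G.tgt g)) :
    dirDeriv (G.derivLeft L b) g (G.rightField a g).1 =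
      dirDeriv (G.derivRight L a) g (G.leftField b g).1 := by
  obtain ⟨c, hc0, hcx, hc, hca⟩ := (G.isSubmersion_src.isSubmersionAt
    (G.unit (G.src g))).exists_smooth_curve (a (G.src g)).1 (a (G.src g)).2
  obtain ⟨d, hd0, hdx, hd, hdb⟩ := (G.isSubmersion_src.isSubmersionAt
    (G.unit (G.tgt g))).exists_smooth_curve (b (G.tgt g)).1 (b (G.tgt g)).2
  rw [G.src_unit] at hcx hdx
  have hLd : ∀ k, MDifferentiableAt (𝓡 (m + n)) 𝓘(ℝ, ℝ) L k := fun k =>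
    hL.mdifferentiableAt (by simp)
  have hcd := hc.mdifferentiableAt (n := ∞) (by simp)
  have hdd := hd.mdifferentiableAt (n := ∞) (by simp)
  let k : ℝ → Γ := fun s => G.mul (G.inv (c s)) g
  have hcg : ∀ s, G.src (c s) = G.src g → G.tgt (G.inv (c s)) = G.src g := fun s hs =>
    (G.tgt_inv _).trans hs
  have hk : ContMDiffAt 𝓘(ℝ, ℝ) (𝓡 (m + n)) ∞ k 0 :=
    G.contMDiffAt_mul_comp (G.contMDiff_inv.contMDiffAt.comp 0 hc) contMDiffAt_const
      (hcx.mono hcg)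
  let f : ℝ × ℝ → ℝ := fun z => L (G.mul (k z.1) (d z.2))
  have hf : ContDiffAt ℝ ∞ f (0, 0) := by
    rw [← contMDiffAt_iff_contDiffAt]
    refine hL.contMDiffAt.comp (0, 0) (G.contMDiffAt_mul_comp
      (hk.comp ((0, 0) : ℝ × ℝ) contDiff_fst.contMDiff.contMDiffAt)
      (hd.comp ((0, 0) : ℝ × ℝ) contDiff_snd.contMDiff.contMDiffAt) ?_)
    rw [nhds_prod_eq]
    filter_upwards [hcx.prod_mk hdx] with z hz
    exact (G.tgt_mul _ _ (hcg _ hz.1)).trans hz.2.symm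
  have h1 : (fun s => deriv (fun t => f (s, t)) 0) =ᶠ[𝓝 0] fun s => G.derivLeft L b (k s) := by
    filter_upwards [hcx] with s hs
    exact (hasDerivAt_mul_curve (G.tgt_mul _ _ (hcg s hs)) hd0 hdx hdd hdb (hLd _)).deriv
  have h2 : (fun t => deriv (fun s => f (s, t)) 0) =ᶠ[𝓝 0]
      fun t => -G.derivRight L a (G.mul g (d t)) := by
    filter_upwards [hdx] with t ht
    have h3 : (fun s => f (s, t)) =ᶠ[𝓝 0] fun s => L (G.mul (G.inv (c s)) (G.mul g (d t))) := by
      filter_upwards [hcx] with s hs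
      simp only [f, k]
      rw [G.mul_assoc _ _ _ (hcg s hs) ht.symm]
    rw [h3.deriv_eq]
    exact (hasDerivAt_inv_curve_mul (G.src_mul _ _ ht.symm) hc0 hcx hcd hca (hLd _)).deriv
  have h4 := hasDerivAt_inv_curve_mul rfl hc0 hcx hcd hca
    ((contMDiffAt_derivLeft hL hb).mdifferentiableAt (by simp))
  have h5 := hasDerivAt_mul_curve rfl hd0 hdx hdd hdb
    ((contMDiffAt_derivRight hL ha).mdifferentiableAt (by simp))
  have h6 := deriv_deriv_comm_of_contDiffAt (hf.of_le (by norm_cast))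
  rw [h1.deriv_eq, h2.deriv_eq, h4.deriv, h5.fun_neg.deriv] at h6
  exact neg_injective h6

/-- The pairing of `V_g β` and `V_g α` given by the second derivatives of `L` along
right-invariant and left-invariant fields. -/
theorem exists_crossDeriv {L : Γ → ℝ} (hL : ContMDiff (𝓡 (m + n)) 𝓘(ℝ, ℝ) ∞ L) (g : Γ) :
    ∃ B : G.vertTgt g →ₗ[ℝ] G.vertSrc g →ₗ[ℝ] ℝ,
      (∀ b, G.SectionSmoothAt b (G.tgt g) → ∀ X,
        B X (G.leftField b g) = dirDeriv (G.derivLeft L b) g X.1) ∧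
      ∀ a, G.SectionSmoothAt a (G.src g) → ∀ Y,
        B (G.rightField a g) Y = dirDeriv (G.derivRight L a) g Y.1 := by
  have hsb : ∀ Y : G.vertSrc g, ∃ b, G.SectionSmoothAt b (G.tgt g) ∧ G.leftField b g = Y := by
    intro Y
    obtain ⟨b, hb, hbY⟩ := G.exists_isSectionNear (G.tangentLeftSymm g Y)
    exact ⟨b, hb.smoothAt, by rw [leftField, hbY, G.tangentLeft_tangentLeftSymm]⟩
  have hsa : ∀ X : G.vertTgt g, ∃ a, G.SectionSmoothAt a (G.src g) ∧ G.rightField a g = X := by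
    intro X
    obtain ⟨a, ha, haX⟩ := G.exists_isSectionNear (-G.tangentRightInvSymm g X)
    exact ⟨a, ha.smoothAt, by
      rw [rightField, haX, map_neg, G.tangentRightInv_tangentRightInvSymm, neg_neg]⟩
  choose sb hsb hsbY using hsb
  choose sa hsa hsaX using hsa
  have hcomm : ∀ X Y, dirDeriv (G.derivLeft L (sb Y)) g X.1 =
      dirDeriv (G.derivRight L (sa X)) g Y.1 := by
    intro X Y
    have := dirDeriv_derivLeft_rightField hL (hsa X) (hsb Y)
    rwa [hsaX, hsbY] at this
  refine ⟨LinearMap.mk₂ ℝ (fun X Y => dirDeriv (G.derivLeft L (sb Y)) g X.1)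
    (fun X X' Y => map_add _ _ _) (fun c X Y => map_smul _ _ _) ?_ ?_, ?_, ?_⟩
  · intro X Y Y'
    rw [hcomm, hcomm, hcomm]
    exact map_add _ _ _
  · intro c X Y
    rw [hcomm, hcomm]
    exact map_smul _ _ _
  · intro b hb X
    rw [LinearMap.mk₂_apply, hcomm]
    have := dirDeriv_derivLeft_rightField hL (hsa X) hb
    rw [hsaX] at this
    exact this.symm
  · intro a ha Y
    rw [LinearMap.mk₂_apply]
    have := dirDeriv_derivLeft_rightField hL ha (hsb Y)
    rw [hsbY] at this
    exact this

/-- The pairing `(X, Y) ↦ X(Y(L))` of `V_g β` and `V_g α`, where `Y` is extended to a left-invariant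
field; equivalently `Y(X(L))`, where `X` is extended to a right-invariant field. -/
noncomputable def crossDeriv {L : Γ → ℝ} (hL : ContMDiff (𝓡 (m + n)) 𝓘(ℝ, ℝ) ∞ L) (g : Γ) :
    G.vertTgt g →ₗ[ℝ] G.vertSrc g →ₗ[ℝ] ℝ :=
  Classical.choose (exists_crossDeriv (G := G) hL g)

theorem crossDeriv_leftField {L : Γ → ℝ} (hL : ContMDiff (𝓡 (m + n)) 𝓘(ℝ, ℝ) ∞ L) {g : Γ}
    {b : ∀ x, G.algFiber x} (hb : G.SectionSmoothAt b (G.tgt g)) (X : G.vertTgt g) :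
    crossDeriv hL g X (G.leftField b g) = dirDeriv (G.derivLeft L b) g X.1 :=
  (Classical.choose_spec (exists_crossDeriv (G := G) hL g)).1 b hb X

theorem crossDeriv_rightField {L : Γ → ℝ} (hL : ContMDiff (𝓡 (m + n)) 𝓘(ℝ, ℝ) ∞ L) {g : Γ}
    {a : ∀ x, G.algFiber x} (ha : G.SectionSmoothAt a (G.src g)) (Y : G.vertSrc g) :
    crossDeriv hL g (G.rightField a g) Y = dirDeriv (G.derivRight L a) g Y.1 :=
  (Classical.choose_spec (exists_crossDeriv (G := G) hL g)).2 a ha Y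

/-- In `-dΘ⁺` all second derivatives of `L` along two left-invariant fields cancel, since the
bracket of vector fields is their commutator. -/
theorem neg_dThetaPlus_eq {L : Γ → ℝ} (hL : ContMDiff (𝓡 (m + n)) 𝓘(ℝ, ℝ) ∞ L) {g : Γ}
    {a b a' b' : ∀ x, G.algFiber x} (hb : G.SectionSmoothAt b (G.tgt g))
    (hb' : G.SectionSmoothAt b' (G.tgt g)) :
    -G.dThetaPlus L a b a' b' g = crossDeriv hL g (G.rightField a' g) (G.leftField b g)
      - crossDeriv hL g (G.rightField a g) (G.leftField b' g) := by
  have hbr := vecDeriv_mlieBracket hL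
    ((G.contMDiffAt_leftField b g hb).mdifferentiableAt (by simp))
    ((G.contMDiffAt_leftField b' g hb').mdifferentiableAt (by simp))
  have h1 : G.dThetaPlus L a b a' b' g =
      dirDeriv (G.derivLeft L b') g ((G.rightField a g).1 + (G.leftField b g).1)
      - dirDeriv (G.derivLeft L b) g ((G.rightField a' g).1 + (G.leftField b' g).1)
      - (dirDeriv (G.derivLeft L b') g (G.leftField b g).1
        - dirDeriv (G.derivLeft L b) g (G.leftField b' g).1) :=
    congrArg (fun z => dirDeriv (G.derivLeft L b') g ((G.rightField a g).1 + (G.leftField b g).1)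
      - dirDeriv (G.derivLeft L b) g ((G.rightField a' g).1 + (G.leftField b' g).1) - z) hbr
  rw [h1, crossDeriv_leftField hL hb, crossDeriv_leftField hL hb', map_add, map_add]
  ring

/-- The Poincaré-Cartan 2-section in terms of the pairing `crossDeriv`. -/
theorem omega_eq {L : Γ → ℝ} (hL : ContMDiff (𝓡 (m + n)) 𝓘(ℝ, ℝ) ∞ L) (g : Γ) (u v : G.Prol g) :
    G.omega L g u v = crossDeriv hL g v.1 u.2 - crossDeriv hL g u.1 v.2 := by
  have key : ∀ c : ℝ, (∃ a b a' b' : ∀ x, G.algFiber x,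
      G.IsSectionNear a (G.src g) ∧ G.IsSectionNear b (G.tgt g) ∧
      G.IsSectionNear a' (G.src g) ∧ G.IsSectionNear b' (G.tgt g) ∧
      G.prolSection a b g = u ∧ G.prolSection a' b' g = v ∧
      c = -G.dThetaPlus L a b a' b' g) →
      c = crossDeriv hL g v.1 u.2 - crossDeriv hL g u.1 v.2 := by
    rintro c ⟨a, b, a', b', -, hb, -, hb', rfl, rfl, rfl⟩
    exact neg_dThetaPlus_eq hL hb.smoothAt hb'.smoothAt
  refine key _ (Classical.epsilon_spec (p := fun c : ℝ => ∃ a b a' b' : ∀ x, G.algFiber x,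
    G.IsSectionNear a (G.src g) ∧ G.IsSectionNear b (G.tgt g) ∧
    G.IsSectionNear a' (G.src g) ∧ G.IsSectionNear b' (G.tgt g) ∧
    G.prolSection a b g = u ∧ G.prolSection a' b' g = v ∧
    c = -G.dThetaPlus L a b a' b' g) ?_)
  obtain ⟨a, ha, hau⟩ := G.exists_isSectionNear (-G.tangentRightInvSymm g u.1)
  obtain ⟨b, hb, hbu⟩ := G.exists_isSectionNear (G.tangentLeftSymm g u.2)
  obtain ⟨a', ha', hav⟩ := G.exists_isSectionNear (-G.tangentRightInvSymm g v.1)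
  obtain ⟨b', hb', hbv⟩ := G.exists_isSectionNear (G.tangentLeftSymm g v.2)
  refine ⟨_, a, b, a', b', ha, hb, ha', hb', ?_, ?_, rfl⟩
  · simp only [prolSection, rightField, leftField, hau, hbu, map_neg, neg_neg,
      G.tangentRightInv_tangentRightInvSymm, G.tangentLeft_tangentLeftSymm]
  · simp only [prolSection, rightField, leftField, hav, hbv, map_neg, neg_neg,
      G.tangentRightInv_tangentRightInvSymm, G.tangentLeft_tangentLeftSymm]

theorem pairingG_eq {L : Γ → ℝ} (hL : ContMDiff (𝓡 (m + n)) 𝓘(ℝ, ℝ) ∞ L) (g : Γ)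
    (a : G.algFiber (G.src g)) (b : G.algFiber (G.tgt g)) :
    G.pairingG L g a b = crossDeriv hL g (G.tangentRightInv g a) (G.tangentLeft g b) := by
  rw [pairingG, omega_eq hL]
  simp

end LieGroupoid

/-! ### Immersions, and the canonical form of `P × P*` -/

section Immersion

variable {p q : ℕ} {A B : Type*}
  [TopologicalSpace A] [ChartedSpace (EuclideanSpace ℝ (Fin p)) A]
  [TopologicalSpace B] [ChartedSpace (EuclideanSpace ℝ (Fin q)) B]
  {f : A → B} {a : A}

namespace Manifold.IsImmersionAt

variable (hf : IsImmersionAt (𝓡 p) (𝓡 q) ∞ f a)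
include hf

theorem mdifferentiable_domChart : hf.domChart.MDifferentiable (𝓡 p) (𝓡 p) :=
  ⟨(contMDiffOn_of_mem_maximalAtlas hf.domChart_mem_maximalAtlas).mdifferentiableOn (by simp),
   (contMDiffOn_symm_of_mem_maximalAtlas hf.domChart_mem_maximalAtlas).mdifferentiableOn (by simp)⟩

theorem mdifferentiable_codChart : hf.codChart.MDifferentiable (𝓡 q) (𝓡 q) :=
  ⟨(contMDiffOn_of_mem_maximalAtlas hf.codChart_mem_maximalAtlas).mdifferentiableOn (by simp),
   (contMDiffOn_symm_of_mem_maximalAtlas hf.codChart_mem_maximalAtlas).mdifferentiableOn (by simp)⟩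

/-- In adapted charts, an immersion has the derivative `u ↦ (u, 0)`. -/
theorem mfderiv_codChart_mfderiv_domChart_symm {y : EuclideanSpace ℝ (Fin p)}
    (hy : y ∈ hf.domChart.target) (u : EuclideanSpace ℝ (Fin p)) :
    (mfderiv (𝓡 q) (𝓡 q) hf.codChart (f (hf.domChart.symm y))
      (mfderiv (𝓡 p) (𝓡 q) f (hf.domChart.symm y)
        (mfderiv (𝓡 p) (𝓡 p) hf.domChart.symm y u)) : EuclideanSpace ℝ (Fin q)) =
      hf.equiv (u, 0) := by
  have hs := hf.domChart.map_target hy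
  let P : EuclideanSpace ℝ (Fin p) →L[ℝ] EuclideanSpace ℝ (Fin q) :=
    (hf.equiv : (EuclideanSpace ℝ (Fin p) × hf.complement) →L[ℝ] EuclideanSpace ℝ (Fin q)).comp
      (ContinuousLinearMap.inl ℝ _ _)
  have h1 : HasMFDerivAt (𝓡 p) (𝓡 q) P y P := P.hasFDerivAt.hasMFDerivAt
  have h2 : hf.codChart ∘ (f ∘ hf.domChart.symm) =ᶠ[𝓝 y] P := by
    filter_upwards [hf.domChart.open_target.mem_nhds hy] with z hz
    have hz' : z ∈ (hf.domChart.extend (𝓡 p)).target := by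
      simpa [OpenPartialHomeomorph.extend_target] using hz
    simpa [P] using hf.writtenInCharts hz'
  have hfd : MDifferentiableAt (𝓡 p) (𝓡 q) f (hf.domChart.symm y) :=
    (hf.contMDiffOn.contMDiffAt (hf.domChart.open_source.mem_nhds hs)).mdifferentiableAt (by simp)
  have h3 := HasMFDerivAt.comp y hfd.hasMFDerivAt
    (hf.mdifferentiable_domChart.mdifferentiableAt_symm hy).hasMFDerivAt
  have h4 : MDifferentiableAt (𝓡 q) (𝓡 q) hf.codChart ((f ∘ hf.domChart.symm) y) :=
    hf.mdifferentiable_codChart.mdifferentiableAt (hf.source_subset_preimage_source hs)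
  have h5 := (HasMFDerivAt.comp y h4.hasMFDerivAt h3)
  exact congrArg (fun L => L u) (hasMFDerivAt_unique h5 (h1.congr_of_eventuallyEq h2))

theorem mfderiv_injective : Function.Injective (mfderiv (𝓡 p) (𝓡 q) f a) := by
  have ha := hf.mem_domChart_source
  rw [injective_iff_map_eq_zero]
  intro v hv
  obtain ⟨u, hu⟩ : ∃ u : EuclideanSpace ℝ (Fin p),
      (mfderiv (𝓡 p) (𝓡 p) hf.domChart.symm (hf.domChart a) u : EuclideanSpace ℝ (Fin p)) = v :=
    hf.mdifferentiable_domChart.symm.mfderiv_surjective (hf.domChart.map_source ha) v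
  have h1 := hf.mfderiv_codChart_mfderiv_domChart_symm (hf.domChart.map_source ha) u
  rw [hf.domChart.left_inv ha] at h1
  have h2 : (mfderiv (𝓡 q) (𝓡 q) hf.codChart (f a)
      (mfderiv (𝓡 p) (𝓡 q) f a v) : EuclideanSpace ℝ (Fin q)) = 0 :=
    (congrArg _ hv).trans (map_zero _)
  have h3 : hf.equiv (u, 0) = 0 := h1.symm.trans ((congrArg (fun z : EuclideanSpace ℝ (Fin p) =>
    (mfderiv (𝓡 q) (𝓡 q) hf.codChart (f a)
      (mfderiv (𝓡 p) (𝓡 q) f a z) : EuclideanSpace ℝ (Fin q))) hu).trans h2)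
  have h4 : u = 0 := congrArg Prod.fst ((hf.equiv.map_eq_zero_iff).1 h3)
  refine hu.symm.trans ?_
  rw [h4]
  exact map_zero _

/-- The image of an immersion is locally, near the image of a point, cut out by a submersion whose
derivative vanishes exactly on the tangent spaces of the image. -/
theorem exists_defining_function : ∃ l : ℕ, p + l = q ∧ ∃ (Q : B → EuclideanSpace ℝ (Fin l))
    (U : Set B) (W : Set A), IsOpen U ∧ IsOpen W ∧ a ∈ W ∧ MapsTo f W U ∧
    ContMDiffOn (𝓡 q) 𝓘(ℝ, EuclideanSpace ℝ (Fin l)) ∞ Q U ∧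
    ∀ x ∈ W, ∀ w : TangentSpace (𝓡 q) (f x),
      vecDeriv (𝓡 q) Q (f x) w = 0 ↔ w ∈ (mfderiv (𝓡 p) (𝓡 q) f x).range := by
  have hfin : FiniteDimensional ℝ (EuclideanSpace ℝ (Fin p) × hf.complement) :=
    hf.equiv.symm.toLinearEquiv.finiteDimensional
  have hfin' : FiniteDimensional ℝ hf.complement :=
    Module.Finite.of_surjective (LinearMap.snd ℝ (EuclideanSpace ℝ (Fin p)) hf.complement)
      LinearMap.snd_surjective
  have hrank := hf.equiv.toLinearEquiv.finrank_eq
  rw [Module.finrank_prod, finrank_euclideanSpace_fin, finrank_euclideanSpace_fin] at hrank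
  let κ : hf.complement ≃L[ℝ] EuclideanSpace ℝ (Fin (Module.finrank ℝ hf.complement)) :=
    ContinuousLinearEquiv.ofFinrankEq (by rw [finrank_euclideanSpace_fin])
  let Λ : EuclideanSpace ℝ (Fin q) →L[ℝ] EuclideanSpace ℝ (Fin (Module.finrank ℝ hf.complement)) :=
    (κ : hf.complement →L[ℝ] _).comp ((ContinuousLinearMap.snd ℝ (EuclideanSpace ℝ (Fin p))
      hf.complement).comp (hf.equiv.symm : EuclideanSpace ℝ (Fin q) →L[ℝ] _))
  have hΛ : ∀ y, Λ y = 0 ↔ ∃ u, y = hf.equiv (u, 0) := by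
    intro y
    constructor
    · intro h
      have h1 : (hf.equiv.symm y).2 = 0 := κ.map_eq_zero_iff.1 h
      refine ⟨(hf.equiv.symm y).1, ?_⟩
      rw [← h1]
      exact (hf.equiv.apply_symm_apply y).symm
    · rintro ⟨u, rfl⟩
      simp [Λ]
  refine ⟨_, hrank, Λ ∘ hf.codChart, hf.codChart.source, hf.domChart.source,
    hf.codChart.open_source, hf.domChart.open_source, hf.mem_domChart_source,
    hf.source_subset_preimage_source, Λ.contMDiff.comp_contMDiffOn
      (contMDiffOn_of_mem_maximalAtlas hf.codChart_mem_maximalAtlas), ?_⟩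
  intro x hx w
  have hfx := hf.source_subset_preimage_source hx
  have hd := hf.mdifferentiable_codChart.mdifferentiableAt hfx
  have h1 : vecDeriv (𝓡 q) (Λ ∘ hf.codChart) (f x) w =
      Λ (mfderiv (𝓡 q) (𝓡 q) hf.codChart (f x) w) := by
    rw [vecDeriv_comp Λ.differentiableAt.mdifferentiableAt hd]
    refine (vecDeriv_vectorSpace _ _ _).trans ?_
    rw [Λ.fderiv]
  have key := fun u => hf.mfderiv_codChart_mfderiv_domChart_symm (hf.domChart.map_source hx) u
  rw [hf.domChart.left_inv hx] at key
  rw [h1]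
  refine (hΛ _).trans ?_
  constructor
  · rintro ⟨u, hu⟩
    refine ⟨mfderiv (𝓡 p) (𝓡 p) hf.domChart.symm (hf.domChart x) u, ?_⟩
    exact hf.mdifferentiable_codChart.mfderiv_injective hfx ((key u).trans hu.symm)
  · rintro ⟨v, rfl⟩
    obtain ⟨u, hu⟩ : ∃ u : EuclideanSpace ℝ (Fin p),
        (mfderiv (𝓡 p) (𝓡 p) hf.domChart.symm (hf.domChart x) u : EuclideanSpace ℝ (Fin p)) = v :=
      hf.mdifferentiable_domChart.symm.mfderiv_surjective (hf.domChart.map_source hx) v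
    refine ⟨u, ?_⟩
    exact ((congrArg (fun z : EuclideanSpace ℝ (Fin p) =>
      (mfderiv (𝓡 q) (𝓡 q) hf.codChart (f x)
        (mfderiv (𝓡 p) (𝓡 q) f x z) : EuclideanSpace ℝ (Fin q))) hu).symm.trans (key u))

end Manifold.IsImmersionAt

end Immersion

section LinearAlgebra

variable {K W P : Type*} [Field K] [AddCommGroup W] [Module K W] [FiniteDimensional K W]
  [AddCommGroup P] [Module K P] [FiniteDimensional K P]

theorem finrank_prod_dual : Module.finrank K (P × Module.Dual K P) = 2 * Module.finrank K P := by
  rw [Module.finrank_prod, Subspace.dual_finrank_eq, two_mul]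

omit [FiniteDimensional K W] in
/-- A space that embeds into `P × P*` has at most twice the dimension of `P`. -/
theorem finrank_le_of_prod_dual {p : W →ₗ[K] P} {q : W →ₗ[K] Module.Dual K P}
    (h : ∀ u, p u = 0 → q u = 0 → u = 0) : Module.finrank K W ≤ 2 * Module.finrank K P := by
  rw [← finrank_prod_dual (K := K)]
  refine LinearMap.finrank_le_finrank_of_injective (f := p.prod q) ?_
  rw [injective_iff_map_eq_zero]
  exact fun u hu => h u (congrArg Prod.fst hu) (congrArg Prod.snd hu)

/-- The canonical 2-form of `P × P*` is nondegenerate. -/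
theorem eq_zero_of_prod_dual {p : W →ₗ[K] P} {q : W →ₗ[K] Module.Dual K P}
    (h : ∀ u, p u = 0 → q u = 0 → u = 0) (hrank : Module.finrank K W = 2 * Module.finrank K P)
    {u : W} (hu : ∀ v, q u (p v) = q v (p u)) : u = 0 := by
  have hinj : Function.Injective (p.prod q) := by
    rw [injective_iff_map_eq_zero]
    exact fun u hu => h u (congrArg Prod.fst hu) (congrArg Prod.snd hu)
  have hsurj := (LinearMap.injective_iff_surjective_of_finrank_eq_finrank
    (hrank.trans finrank_prod_dual.symm)).1 hinj
  have hp : p u = 0 := by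
    refine (Module.forall_dual_apply_eq_zero_iff K _).1 fun φ => ?_
    obtain ⟨v, hv⟩ := hsurj (0, φ)
    have h1 : p v = 0 := congrArg Prod.fst hv
    have h2 : q v = φ := congrArg Prod.snd hv
    rw [← h2, ← hu v, h1, map_zero]
  refine h u hp (LinearMap.ext fun x => ?_)
  obtain ⟨v, hv⟩ := hsurj (x, 0)
  have h1 : p v = x := congrArg Prod.fst hv
  rw [← h1, hu v, hp, map_zero, LinearMap.zero_apply]

end LinearAlgebra

/-! ### Pointwise algebra of nonholonomic systems -/

namespace NonholonomicSystem

variable {m n : ℕ} {Γ M : Type*}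
  [TopologicalSpace Γ] [ChartedSpace (EuclideanSpace ℝ (Fin (m + n))) Γ]
  [IsManifold (𝓡 (m + n)) ∞ Γ]
  [TopologicalSpace M] [ChartedSpace (EuclideanSpace ℝ (Fin m)) M]
  [IsManifold (𝓡 m) ∞ M]
  {G : LieGroupoid m n Γ M} {r : ℕ}
  {Mc : Type*} [TopologicalSpace Mc] [ChartedSpace (EuclideanSpace ℝ (Fin (m + r))) Mc]
  [IsManifold (𝓡 (m + r)) ∞ Mc]
  {D : M → Type*} [∀ x, AddCommGroup (D x)] [∀ x, Module ℝ (D x)]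
  [∀ x, TopologicalSpace (D x)]
  [TopologicalSpace (Bundle.TotalSpace (EuclideanSpace ℝ (Fin r)) D)]
  [FiberBundle (EuclideanSpace ℝ (Fin r)) D] [VectorBundle ℝ (EuclideanSpace ℝ (Fin r)) D]
  [ContMDiffVectorBundle ∞ (EuclideanSpace ℝ (Fin r)) D (𝓡 m)]
  (S : NonholonomicSystem G r Mc D)

theorem mem_subF {h : Γ} {u : G.Prol h} :
    u ∈ S.subF h ↔ G.tangentRightInvSymm h u.1 ∈ S.fiberD (G.src h) := by
  rw [← Subspace.dualAnnihilator_dualCoannihilator_eq (W := S.fiberD (G.src h)), subF]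
  simp only [Submodule.mem_dualCoannihilator, Submodule.mem_map, forall_exists_index, and_imp,
    forall_apply_eq_imp_iff₂]
  rfl

theorem mem_subFbar {g : Γ} {u : G.Prol g} :
    u ∈ S.subFbar g ↔ G.tangentLeftSymm g u.2 ∈ S.fiberD (G.tgt g) := by
  rw [← Subspace.dualAnnihilator_dualCoannihilator_eq (W := S.fiberD (G.tgt g)), subFbar]
  simp only [Submodule.mem_dualCoannihilator, Submodule.mem_map, forall_exists_index, and_imp,
    forall_apply_eq_imp_iff₂]
  rfl

/-- The pairing of `V_g β` and `V_g α` that determines `Ω_L`, for the Lagrangian of the system. -/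
noncomputable abbrev pairing (g : Γ) : G.vertTgt g →ₗ[ℝ] G.vertSrc g →ₗ[ℝ] ℝ :=
  LieGroupoid.crossDeriv S.contMDiff_L g

theorem eq_zero_of_pairing_left {g : Γ} {X : G.vertTgt g} (h : ∀ Y, S.pairing g X Y = 0) :
    X = 0 := by
  have h1 := S.regular_L g (X, 0) fun v => by
    rw [LieGroupoid.omega_eq S.contMDiff_L]
    change S.pairing g v.1 0 - S.pairing g X v.2 = 0
    rw [h, map_zero, sub_zero]
  exact congrArg Prod.fst h1

theorem eq_zero_of_pairing_right {g : Γ} {Y : G.vertSrc g} (h : ∀ X, S.pairing g X Y = 0) :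
    Y = 0 := by
  have h1 := S.regular_L g (0, Y) fun v => by
    rw [LieGroupoid.omega_eq S.contMDiff_L]
    change S.pairing g v.1 Y - S.pairing g 0 v.2 = 0
    rw [h, map_zero, LinearMap.zero_apply, sub_zero]
  exact congrArg Prod.snd h1

/-- The orthogonal of `F_h` is the `pairing`-orthogonal, in `V_h α`, of the translate of
`D_c(α(h))`: by nondegeneracy its elements have no component in `V_h β`. -/
theorem mem_orth_subF {h : Γ} {u : G.Prol h} : u ∈ S.orth h (S.subF h) ↔
    u.1 = 0 ∧ ∀ a ∈ S.fiberD (G.src h), S.pairing h (G.tangentRightInv h a) u.2 = 0 := by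
  simp only [orth, Set.mem_ofPred_eq, LieGroupoid.omega_eq S.contMDiff_L, S.mem_subF]
  constructor
  · intro hu
    constructor
    · refine S.eq_zero_of_pairing_left fun Y => ?_
      simpa using hu (0, Y) (by simp)
    · intro a ha
      simpa using hu (G.tangentRightInv h a, 0)
        (by rwa [G.tangentRightInvSymm_tangentRightInv])
  · rintro ⟨h1, h2⟩ v hv
    have h3 := h2 _ hv
    rw [G.tangentRightInv_tangentRightInvSymm] at h3
    rw [h1, h3]
    simp

theorem mem_orth_subFbar {g : Γ} {u : G.Prol g} : u ∈ S.orth g (S.subFbar g) ↔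
    u.2 = 0 ∧ ∀ b ∈ S.fiberD (G.tgt g), S.pairing g u.1 (G.tangentLeft g b) = 0 := by
  simp only [orth, Set.mem_ofPred_eq, LieGroupoid.omega_eq S.contMDiff_L, S.mem_subFbar]
  constructor
  · intro hu
    constructor
    · refine S.eq_zero_of_pairing_right fun X => ?_
      simpa using hu (X, 0) (by simp)
    · intro b hb
      simpa using hu (0, G.tangentLeft g b) (by rwa [G.tangentLeftSymm_tangentLeft])
  · rintro ⟨h1, h2⟩ v hv
    have h3 := h2 _ hv
    rw [G.tangentLeft_tangentLeftSymm] at h3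
    rw [h1, h3]
    simp

/-- Right nondegeneracy of `G_h^{L_d c}`, with `(E_Γ)_{β(h)}` replaced by its translate `V_h α`. -/
theorem isRightNondegenerate_iff (h : Mc) : S.IsRightNondegenerate h ↔
    ∀ Y : G.vertSrc (S.inclM h), Y.1 ∈ S.tangentMc h → (∀ a ∈ S.fiberD (G.src (S.inclM h)),
      S.pairing (S.inclM h) (G.tangentRightInv (S.inclM h) a) Y = 0) → Y = 0 := by
  simp only [IsRightNondegenerate, LieGroupoid.pairingG_eq S.contMDiff_L]
  constructor
  · intro H Y hY h1
    rw [← G.tangentLeft_tangentLeftSymm _ Y] at hY h1 ⊢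
    rw [H _ hY h1, map_zero]
  · intro H b hb h1
    rw [← G.tangentLeftSymm_tangentLeft _ b, H _ hb h1, map_zero]

/-- Left nondegeneracy of `Ḡ_g^{L_d c}`, with `(E_Γ)_{α(g)}` replaced by its translate `V_g β`. -/
theorem isLeftNondegenerate_iff (g : Mc) : S.IsLeftNondegenerate g ↔
    ∀ X : G.vertTgt (S.inclM g), X.1 ∈ S.tangentMc g → (∀ b ∈ S.fiberD (G.tgt (S.inclM g)),
      S.pairing (S.inclM g) X (G.tangentLeft (S.inclM g) b) = 0) → X = 0 := by
  simp only [IsLeftNondegenerate, LieGroupoid.pairingG_eq S.contMDiff_L]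
  constructor
  · intro H X hX h1
    rw [← G.tangentRightInv_tangentRightInvSymm _ X] at hX h1 ⊢
    rw [H _ hX h1, map_zero]
  · intro H a ha h1
    rw [← G.tangentRightInvSymm_tangentRightInv _ a, H _ ha h1, map_zero]

theorem mem_preTangent {h : Mc} {u : G.Prol (S.inclM h)} :
    u ∈ S.preTangent h ↔ u.1.1 + u.2.1 ∈ S.tangentMc h := Iff.rfl

theorem preTangent_inter_orth_subF_eq_iff (h : Mc) :
    (S.preTangent h : Set (G.Prol (S.inclM h))) ∩ S.orth (S.inclM h) (S.subF (S.inclM h)) = {0} ↔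
      S.IsRightNondegenerate h := by
  rw [isRightNondegenerate_iff]
  constructor
  · intro H Y hY h1
    have h2 : ((0, Y) : G.Prol (S.inclM h)) ∈ ({0} : Set (G.Prol (S.inclM h))) := by
      rw [← H]
      refine ⟨S.mem_preTangent.2 ?_, S.mem_orth_subF.2 ⟨rfl, h1⟩⟩
      simpa using hY
    exact congrArg Prod.snd h2
  · intro H
    ext ⟨X, Y⟩
    constructor
    · rintro ⟨h1, h2⟩
      obtain ⟨h3, h4⟩ := S.mem_orth_subF.1 h2
      obtain rfl : X = 0 := h3
      have h5 := S.mem_preTangent.1 h1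
      rw [H Y (by simpa using h5) h4]
      rfl
    · rintro h1
      obtain ⟨rfl, rfl⟩ : X = 0 ∧ Y = 0 := Prod.ext_iff.1 h1
      exact ⟨(S.preTangent h).zero_mem, S.mem_orth_subF.2 ⟨rfl, by simp⟩⟩

theorem preTangent_inter_orth_subFbar_eq_iff (g : Mc) :
    (S.preTangent g : Set (G.Prol (S.inclM g))) ∩
      S.orth (S.inclM g) (S.subFbar (S.inclM g)) = {0} ↔ S.IsLeftNondegenerate g := by
  rw [isLeftNondegenerate_iff]
  constructor
  · intro H X hX h1
    have h2 : ((X, 0) : G.Prol (S.inclM g)) ∈ ({0} : Set (G.Prol (S.inclM g))) := by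
      rw [← H]
      refine ⟨S.mem_preTangent.2 ?_, S.mem_orth_subFbar.2 ⟨rfl, h1⟩⟩
      simpa using hX
    exact congrArg Prod.fst h2
  · intro H
    ext ⟨X, Y⟩
    constructor
    · rintro ⟨h1, h2⟩
      obtain ⟨h3, h4⟩ := S.mem_orth_subFbar.1 h2
      obtain rfl : Y = 0 := h3
      have h5 := S.mem_preTangent.1 h1
      rw [H X (by simpa using h5) h4]
      rfl
    · rintro h1
      obtain ⟨rfl, rfl⟩ : X = 0 ∧ Y = 0 := Prod.ext_iff.1 h1
      exact ⟨(S.preTangent g).zero_mem, S.mem_orth_subFbar.2 ⟨rfl, by simp⟩⟩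

/-- If `Ω_L` is nondegenerate on `H_h`, then `G_h^{L_d c}` is right nondegenerate: its right kernel
lies in `H_h` and is orthogonal to `H_h`. -/
theorem isRightNondegenerate_of_subH {h : Mc}
    (H : ∀ u ∈ S.subH h, (∀ v ∈ S.subH h, G.omega S.L (S.inclM h) u v = 0) → u = 0) :
    S.IsRightNondegenerate h := by
  rw [isRightNondegenerate_iff]
  intro Y hY h1
  refine congrArg Prod.snd (H (0, Y) ⟨S.mem_preTangent.2 (by simpa using hY), S.mem_subF.2 ?_⟩
    fun v hv => S.mem_orth_subF.2 ⟨rfl, h1⟩ v hv.2)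
  simp

theorem isLeftNondegenerate_of_subHbar {g : Mc}
    (H : ∀ u ∈ S.subHbar g, (∀ v ∈ S.subHbar g, G.omega S.L (S.inclM g) u v = 0) → u = 0) :
    S.IsLeftNondegenerate g := by
  rw [isLeftNondegenerate_iff]
  intro X hX h1
  refine congrArg Prod.fst (H (X, 0) ⟨S.mem_preTangent.2 (by simpa using hX), S.mem_subFbar.2 ?_⟩
    fun v hv => S.mem_orth_subFbar.2 ⟨rfl, h1⟩ v hv.2)
  simp

omit [IsManifold (𝓡 (m + n)) ∞ Γ] in
theorem finiteDimensional_tangentSpace (g : Γ) :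
    FiniteDimensional ℝ (TangentSpace (𝓡 (m + n)) g) :=
  inferInstanceAs (FiniteDimensional ℝ (EuclideanSpace ℝ (Fin (m + n))))

theorem finrank_fiberD (x : M) : Module.finrank ℝ (S.fiberD x) = r := by
  have h1 : (S.inclD x).range ≤ G.algFiber x := by
    rintro _ ⟨v, rfl⟩
    exact S.inclD_mem x v
  have h2 : Module.finrank ℝ (S.fiberD x) = Module.finrank ℝ (S.inclD x).range :=
    (Submodule.comapSubtypeEquivOfLe h1).finrank_eq
  have h3 : Module.finrank ℝ (S.inclD x).range = Module.finrank ℝ (D x) :=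
    LinearMap.finrank_range_of_inj (S.inclD_injective x)
  have h4 := (Bundle.Trivialization.continuousLinearEquivAt ℝ
    (trivializationAt (EuclideanSpace ℝ (Fin r)) D x) x
    (FiberBundle.mem_baseSet_trivializationAt' x)).toLinearEquiv.finrank_eq
  rw [h2, h3, h4, finrank_euclideanSpace_fin]

/-- The map `H_h → D_c(α(h))`, `(X, Y) ↦ T_h (i ∘ r_{h⁻¹})(X)`. -/
noncomputable def projH (h : Mc) : S.subH h →ₗ[ℝ] S.fiberD (G.src (S.inclM h)) :=
  LinearMap.codRestrict _ (G.tangentRightInvSymm (S.inclM h) ∘ₗ LinearMap.fst ℝ _ _ ∘ₗ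
    (S.subH h).subtype) fun u => S.mem_subF.1 u.2.2

/-- The map `H_h → D_c(α(h))^*` that pairs the component in `V_h α` with `D_c(α(h))`. -/
noncomputable def coprojH (h : Mc) :
    S.subH h →ₗ[ℝ] Module.Dual ℝ (S.fiberD (G.src (S.inclM h))) :=
  (LinearMap.lcomp ℝ ℝ (G.tangentRightInv (S.inclM h) ∘ₗ Submodule.subtype _)) ∘ₗ
    (S.pairing (S.inclM h)).flip ∘ₗ LinearMap.snd ℝ _ _ ∘ₗ (S.subH h).subtype

theorem omega_eq_coprojH (h : Mc) (u v : S.subH h) : G.omega S.L (S.inclM h) u.1 v.1 =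
    S.coprojH h u (S.projH h v) - S.coprojH h v (S.projH h u) := by
  have h1 : ∀ u v : S.subH h, S.coprojH h u (S.projH h v) =
      S.pairing (S.inclM h) v.1.1 u.1.2 := fun u v => by
    change S.pairing (S.inclM h) (G.tangentRightInv (S.inclM h)
      (G.tangentRightInvSymm (S.inclM h) v.1.1)) u.1.2 = _
    rw [G.tangentRightInv_tangentRightInvSymm]
  rw [h1, h1, LieGroupoid.omega_eq S.contMDiff_L]

/-- The kernel of `H_h → P × P*`, for `P = D_c(α(h))`, is the right kernel of `G_h^{L_d c}`. -/
theorem eq_zero_of_projH {h : Mc} (H : S.IsRightNondegenerate h) (u : S.subH h)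
    (hp : S.projH h u = 0) (hq : S.coprojH h u = 0) : u = 0 := by
  have h1 : u.1.1 = 0 := by
    rw [← G.tangentRightInv_tangentRightInvSymm _ u.1.1]
    exact (congrArg _ (congrArg Subtype.val hp)).trans (map_zero _)
  have h2 : u.1.2 = 0 := by
    refine (S.isRightNondegenerate_iff h).1 H _ ?_ fun a ha => ?_
    · have := S.mem_preTangent.1 u.2.1
      rwa [h1, ZeroMemClass.coe_zero, zero_add] at this
    · exact congrArg (fun φ => φ ⟨a, ha⟩) hq
  exact Subtype.ext (Prod.ext h1 h2)

theorem finrank_subH_le {h : Mc} (H : S.IsRightNondegenerate h) :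
    Module.finrank ℝ (S.subH h) ≤ 2 * r := by
  have := finiteDimensional_tangentSpace (m := m) (n := n) (G.unit (G.src (S.inclM h)))
  refine (finrank_le_of_prod_dual (S.eq_zero_of_projH H)).trans_eq ?_
  rw [S.finrank_fiberD]

/-- On `H_h` the form `Ω_L` is the pullback of the canonical form of `P × P*`, for
`P = D_c(α(h))`. -/
theorem eq_zero_of_omega_subH {h : Mc} (H : S.IsRightNondegenerate h)
    (hrank : Module.finrank ℝ (S.subH h) = 2 * r) (u : G.Prol (S.inclM h)) (hu : u ∈ S.subH h)
    (h0 : ∀ v ∈ S.subH h, G.omega S.L (S.inclM h) u v = 0) : u = 0 := by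
  have := finiteDimensional_tangentSpace (m := m) (n := n) (G.unit (G.src (S.inclM h)))
  have := finiteDimensional_tangentSpace (m := m) (n := n) (S.inclM h)
  refine congrArg Subtype.val (eq_zero_of_prod_dual (u := (⟨u, hu⟩ : S.subH h))
    (S.eq_zero_of_projH H) (by rw [hrank, S.finrank_fiberD]) fun v => ?_)
  exact sub_eq_zero.1 ((S.omega_eq_coprojH h ⟨u, hu⟩ v).symm.trans (h0 v.1 v.2))

/-- The map `H̄_g → D_c(β(g))`, `(X, Y) ↦ T_g l_{g⁻¹}(Y)`. -/
noncomputable def projHbar (g : Mc) : S.subHbar g →ₗ[ℝ] S.fiberD (G.tgt (S.inclM g)) :=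
  LinearMap.codRestrict _ (G.tangentLeftSymm (S.inclM g) ∘ₗ LinearMap.snd ℝ _ _ ∘ₗ
    (S.subHbar g).subtype) fun u => S.mem_subFbar.1 u.2.2

/-- The map `H̄_g → D_c(β(g))^*` that pairs the component in `V_g β` with `D_c(β(g))`. -/
noncomputable def coprojHbar (g : Mc) :
    S.subHbar g →ₗ[ℝ] Module.Dual ℝ (S.fiberD (G.tgt (S.inclM g))) :=
  (LinearMap.lcomp ℝ ℝ (G.tangentLeft (S.inclM g) ∘ₗ Submodule.subtype _)) ∘ₗ
    S.pairing (S.inclM g) ∘ₗ LinearMap.fst ℝ _ _ ∘ₗ (S.subHbar g).subtype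

theorem omega_eq_coprojHbar (g : Mc) (u v : S.subHbar g) : G.omega S.L (S.inclM g) u.1 v.1 =
    S.coprojHbar g v (S.projHbar g u) - S.coprojHbar g u (S.projHbar g v) := by
  have h1 : ∀ u v : S.subHbar g, S.coprojHbar g u (S.projHbar g v) =
      S.pairing (S.inclM g) u.1.1 v.1.2 := fun u v => by
    change S.pairing (S.inclM g) u.1.1 (G.tangentLeft (S.inclM g)
      (G.tangentLeftSymm (S.inclM g) v.1.2)) = _
    rw [G.tangentLeft_tangentLeftSymm]
  rw [h1, h1, LieGroupoid.omega_eq S.contMDiff_L]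

theorem eq_zero_of_projHbar {g : Mc} (H : S.IsLeftNondegenerate g) (u : S.subHbar g)
    (hp : S.projHbar g u = 0) (hq : S.coprojHbar g u = 0) : u = 0 := by
  have h1 : u.1.2 = 0 := by
    rw [← G.tangentLeft_tangentLeftSymm _ u.1.2]
    exact (congrArg _ (congrArg Subtype.val hp)).trans (map_zero _)
  have h2 : u.1.1 = 0 := by
    refine (S.isLeftNondegenerate_iff g).1 H _ ?_ fun b hb => ?_
    · have := S.mem_preTangent.1 u.2.1
      rwa [h1, ZeroMemClass.coe_zero, add_zero] at this
    · exact congrArg (fun φ => φ ⟨b, hb⟩) hq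
  exact Subtype.ext (Prod.ext h2 h1)

theorem finrank_subHbar_le {g : Mc} (H : S.IsLeftNondegenerate g) :
    Module.finrank ℝ (S.subHbar g) ≤ 2 * r := by
  have := finiteDimensional_tangentSpace (m := m) (n := n) (G.unit (G.tgt (S.inclM g)))
  refine (finrank_le_of_prod_dual (S.eq_zero_of_projHbar H)).trans_eq ?_
  rw [S.finrank_fiberD]

theorem eq_zero_of_omega_subHbar {g : Mc} (H : S.IsLeftNondegenerate g)
    (hrank : Module.finrank ℝ (S.subHbar g) = 2 * r) (u : G.Prol (S.inclM g))
    (hu : u ∈ S.subHbar g)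
    (h0 : ∀ v ∈ S.subHbar g, G.omega S.L (S.inclM g) u v = 0) : u = 0 := by
  have := finiteDimensional_tangentSpace (m := m) (n := n) (G.unit (G.tgt (S.inclM g)))
  have := finiteDimensional_tangentSpace (m := m) (n := n) (S.inclM g)
  refine congrArg Subtype.val (eq_zero_of_prod_dual (u := (⟨u, hu⟩ : S.subHbar g))
    (S.eq_zero_of_projHbar H) (by rw [hrank, S.finrank_fiberD]) fun v => ?_)
  exact (sub_eq_zero.1 ((S.omega_eq_coprojHbar g ⟨u, hu⟩ v).symm.trans (h0 v.1 v.2))).symm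

end NonholonomicSystem

/-! ### The subbundles `H` and `H̄` -/

namespace LieGroupoid

variable {m n : ℕ} {Γ M : Type*}
  [TopologicalSpace Γ] [ChartedSpace (EuclideanSpace ℝ (Fin (m + n))) Γ]
  [IsManifold (𝓡 (m + n)) ∞ Γ]
  [TopologicalSpace M] [ChartedSpace (EuclideanSpace ℝ (Fin m)) M]
  [IsManifold (𝓡 m) ∞ M]
  (G : LieGroupoid m n Γ M)
  {V V' : Type*} [AddCommGroup V] [Module ℝ V] [AddCommGroup V'] [Module ℝ V']

/-- The sections of `T^Γ Γ` given by a right-invariant and a left-invariant field, for sections of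
the Lie algebroid that depend linearly on parameters. -/
noncomputable def prolFrame (a : V →ₗ[ℝ] (∀ x, G.algFiber x)) (b : V' →ₗ[ℝ] (∀ x, G.algFiber x)) :
    (V × V') →ₗ[ℝ] (∀ g, G.Prol g) where
  toFun c := G.prolSection (a c.1) (b c.2)
  map_add' c c' := by
    funext g
    refine Prod.ext ?_ ?_
    · change -G.tangentRightInv g (a (c.1 + c'.1) (G.src g)) = -_ + -_
      rw [map_add, Pi.add_apply, map_add, neg_add]
    · change G.tangentLeft g (b (c.2 + c'.2) (G.tgt g)) = _ + _
      rw [map_add, Pi.add_apply, map_add]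
      rfl
  map_smul' t c := by
    funext g
    refine Prod.ext ?_ ?_
    · change -G.tangentRightInv g (a (t • c.1) (G.src g)) = t • -_
      rw [map_smul, Pi.smul_apply, map_smul, smul_neg]
    · change G.tangentLeft g (b (t • c.2) (G.tgt g)) = t • _
      rw [map_smul, Pi.smul_apply, map_smul]
      rfl

variable {G} {a : V →ₗ[ℝ] (∀ x, G.algFiber x)} {b : V' →ₗ[ℝ] (∀ x, G.algFiber x)} {g : Γ}

theorem tangentRightInvSymm_prolFrame (c : V × V') :
    G.tangentRightInvSymm g (G.prolFrame a b c g).1 = -a c.1 (G.src g) := by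
  change G.tangentRightInvSymm g (-G.tangentRightInv g (a c.1 (G.src g))) = _
  rw [map_neg, G.tangentRightInvSymm_tangentRightInv]

theorem tangentLeftSymm_prolFrame (c : V × V') :
    G.tangentLeftSymm g (G.prolFrame a b c g).2 = b c.2 (G.tgt g) :=
  G.tangentLeftSymm_tangentLeft _ _

theorem prolFrame_eq {c : V × V'} {u : G.Prol g}
    (h1 : a c.1 (G.src g) = -G.tangentRightInvSymm g u.1)
    (h2 : b c.2 (G.tgt g) = G.tangentLeftSymm g u.2) : G.prolFrame a b c g = u := by
  refine Prod.ext ?_ ?_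
  · change -G.tangentRightInv g (a c.1 (G.src g)) = u.1
    rw [h1, map_neg, neg_neg, G.tangentRightInv_tangentRightInvSymm]
  · change G.tangentLeft g (b c.2 (G.tgt g)) = u.2
    rw [h2, G.tangentLeft_tangentLeftSymm]

theorem prolFrame_injective (ha : Function.Injective fun v => a v (G.src g))
    (hb : Function.Injective fun v => b v (G.tgt g)) :
    Function.Injective fun c => G.prolFrame a b c g := by
  intro c c' h
  have h1 := congrArg (fun u => G.tangentRightInvSymm g u.1) h
  have h2 := congrArg (fun u => G.tangentLeftSymm g u.2) h
  simp only [tangentRightInvSymm_prolFrame, tangentLeftSymm_prolFrame, neg_inj] at h1 h2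
  exact Prod.ext (ha h1) (hb h2)

end LieGroupoid

namespace NonholonomicSystem

variable {m n : ℕ} {Γ M : Type*}
  [TopologicalSpace Γ] [ChartedSpace (EuclideanSpace ℝ (Fin (m + n))) Γ]
  [IsManifold (𝓡 (m + n)) ∞ Γ]
  [TopologicalSpace M] [ChartedSpace (EuclideanSpace ℝ (Fin m)) M]
  [IsManifold (𝓡 m) ∞ M]
  {G : LieGroupoid m n Γ M} {r : ℕ}
  {Mc : Type*} [TopologicalSpace Mc] [ChartedSpace (EuclideanSpace ℝ (Fin (m + r))) Mc]
  [IsManifold (𝓡 (m + r)) ∞ Mc]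
  {D : M → Type*} [∀ x, AddCommGroup (D x)] [∀ x, Module ℝ (D x)]
  [∀ x, TopologicalSpace (D x)]
  [TopologicalSpace (Bundle.TotalSpace (EuclideanSpace ℝ (Fin r)) D)]
  [FiberBundle (EuclideanSpace ℝ (Fin r)) D] [VectorBundle ℝ (EuclideanSpace ℝ (Fin r)) D]
  [ContMDiffVectorBundle ∞ (EuclideanSpace ℝ (Fin r)) D (𝓡 m)]
  (S : NonholonomicSystem G r Mc D)

/-- The local frame of `D_c` near `x₀` given by a local trivialization, as a linear map from the
model fiber to sections of the Lie algebroid. These sections vanish outside the base set of the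
trivialization. -/
noncomputable def frameD (x₀ : M) : EuclideanSpace ℝ (Fin r) →ₗ[ℝ] (∀ x, G.algFiber x) where
  toFun w x := ⟨S.inclD x ((trivializationAt (EuclideanSpace ℝ (Fin r)) D x₀).symmL ℝ x w),
    S.inclD_mem x _⟩
  map_add' w w' := by
    funext x
    exact Subtype.ext (by simp)
  map_smul' c w := by
    funext x
    exact Subtype.ext (by simp)

theorem sectionSmoothAt_frameD {x₀ x : M}
    (hx : x ∈ (trivializationAt (EuclideanSpace ℝ (Fin r)) D x₀).baseSet)
    (w : EuclideanSpace ℝ (Fin r)) : G.SectionSmoothAt (S.frameD x₀ w) x := by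
  have h1 : ContMDiffAt (𝓡 m) ((𝓡 m).prod 𝓘(ℝ, EuclideanSpace ℝ (Fin r))) ∞
      (fun y => (⟨y, (trivializationAt (EuclideanSpace ℝ (Fin r)) D x₀).symmL ℝ y w⟩ :
        Bundle.TotalSpace (EuclideanSpace ℝ (Fin r)) D)) x := by
    rw [Bundle.Trivialization.contMDiffAt_section_iff _ hx]
    refine (contMDiffAt_const (c := w)).congr_of_eventuallyEq ?_
    filter_upwards [(trivializationAt (EuclideanSpace ℝ (Fin r)) D x₀).open_baseSet.mem_nhds hx]
      with y hy
    simp [hy]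
  exact S.contMDiff_inclD.contMDiffAt.comp x h1

theorem frameD_mem (x₀ : M) (w : EuclideanSpace ℝ (Fin r)) (x : M) :
    S.frameD x₀ w x ∈ S.fiberD x := ⟨_, rfl⟩

theorem exists_frameD_eq {x₀ x : M}
    (hx : x ∈ (trivializationAt (EuclideanSpace ℝ (Fin r)) D x₀).baseSet) {a : G.algFiber x}
    (ha : a ∈ S.fiberD x) : ∃ w, S.frameD x₀ w x = a := by
  obtain ⟨v, hv⟩ := ha
  refine ⟨(trivializationAt (EuclideanSpace ℝ (Fin r)) D x₀).continuousLinearMapAt ℝ x v,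
    Subtype.ext ?_⟩
  refine Eq.trans ?_ hv
  change S.inclD x _ = S.inclD x v
  rw [Bundle.Trivialization.symmL_continuousLinearMapAt _ hx]

theorem frameD_injective {x₀ x : M}
    (hx : x ∈ (trivializationAt (EuclideanSpace ℝ (Fin r)) D x₀).baseSet) :
    Function.Injective fun w => S.frameD x₀ w x := by
  intro w w' h
  have h1 := S.inclD_injective x (congrArg Subtype.val h)
  have h2 := congrArg
    ((trivializationAt (EuclideanSpace ℝ (Fin r)) D x₀).continuousLinearMapAt ℝ x) h1
  rwa [Bundle.Trivialization.continuousLinearMapAt_symmL _ hx,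
    Bundle.Trivialization.continuousLinearMapAt_symmL _ hx] at h2

theorem mem_subF_iff_exists_prolFrame {V : Type*} [AddCommGroup V] [Module ℝ V] {x₀ : M} {g : Γ}
    (hx : G.src g ∈ (trivializationAt (EuclideanSpace ℝ (Fin r)) D x₀).baseSet)
    {s : V →ₗ[ℝ] (∀ x, G.algFiber x)} (hs : Function.Surjective fun v => s v (G.tgt g))
    (u : G.Prol g) : u ∈ S.subF g ↔ ∃ c, G.prolFrame (S.frameD x₀) s c g = u := by
  rw [S.mem_subF]
  constructor
  · intro hu
    obtain ⟨w, hw⟩ := S.exists_frameD_eq hx (Submodule.neg_mem _ hu)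
    obtain ⟨z, hz⟩ := hs (G.tangentLeftSymm _ u.2)
    exact ⟨(w, z), LieGroupoid.prolFrame_eq hw hz⟩
  · rintro ⟨c, rfl⟩
    rw [LieGroupoid.tangentRightInvSymm_prolFrame]
    exact Submodule.neg_mem _ (S.frameD_mem _ _ _)

theorem mem_subFbar_iff_exists_prolFrame {V : Type*} [AddCommGroup V] [Module ℝ V] {x₀ : M} {g : Γ}
    (hx : G.tgt g ∈ (trivializationAt (EuclideanSpace ℝ (Fin r)) D x₀).baseSet)
    {s : V →ₗ[ℝ] (∀ x, G.algFiber x)} (hs : Function.Surjective fun v => s v (G.src g))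
    (u : G.Prol g) : u ∈ S.subFbar g ↔ ∃ c, G.prolFrame s (S.frameD x₀) c g = u := by
  rw [S.mem_subFbar]
  constructor
  · intro hu
    obtain ⟨w, hw⟩ := S.exists_frameD_eq hx hu
    obtain ⟨z, hz⟩ := hs (-G.tangentRightInvSymm _ u.1)
    exact ⟨(z, w), LieGroupoid.prolFrame_eq hz hw⟩
  · rintro ⟨c, rfl⟩
    rw [LieGroupoid.tangentLeftSymm_prolFrame]
    exact S.frameD_mem _ _ _

/-- If `F` has local smooth frames of rank `r + n` and `ρ⁻¹(T M_c) ∩ F` has at most the dimension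
`2 r` that is expected for an intersection of these codimensions, then the intersection is
transversal and is a vector subbundle. -/
theorem isSubbundle_of_frame {V : Type*} [NormedAddCommGroup V] [NormedSpace ℝ V]
    [FiniteDimensional ℝ V] (hV : Module.finrank ℝ V = r + n)
    (F : ∀ h : Mc, Submodule ℝ (G.Prol (S.inclM h)))
    (hrank : ∀ h, Module.finrank ℝ ↥(S.preTangent h ⊓ F h) ≤ 2 * r)
    (hF : ∀ h₀ : Mc, ∃ U : Set Mc, IsOpen U ∧ h₀ ∈ U ∧
      ∃ σ : V →ₗ[ℝ]
        (∀ h : Mc, G.Prol (S.inclM h)),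
        (∀ c, ∀ h ∈ U,
          ContMDiffAt (𝓡 (m + r)) (𝓡 (m + n)).tangent ∞
            (fun h => (⟨S.inclM h, (σ c h).1.1⟩ : TangentBundle (𝓡 (m + n)) Γ)) h ∧
          ContMDiffAt (𝓡 (m + r)) (𝓡 (m + n)).tangent ∞
            (fun h => (⟨S.inclM h, (σ c h).2.1⟩ : TangentBundle (𝓡 (m + n)) Γ)) h) ∧
        ∀ h ∈ U, (Function.Injective fun c => σ c h) ∧ ∀ u, u ∈ F h ↔ ∃ c, σ c h = u) :
    S.IsSubbundle (2 * r) fun h => S.preTangent h ⊓ F h := by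
  intro h₀
  obtain ⟨U₁, hU₁, hh₁, σ, hσ, hσF⟩ := hF h₀
  obtain ⟨l, hl, Q, U₂, W, hU₂, hW, hhW, hWU, hQ, hQker⟩ :=
    (S.isSmoothEmbedding_inclM.isImmersion.isImmersionAt h₀).exists_defining_function
  have hincl : ContMDiff (𝓡 (m + r)) (𝓡 (m + n)) ∞ S.inclM :=
    S.isSmoothEmbedding_inclM.isImmersion.contMDiff
  let σh (h : Mc) : V →ₗ[ℝ]
      G.Prol (S.inclM h) := LinearMap.proj h ∘ₗ σ
  let T (h : Mc) : V →L[ℝ]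
      EuclideanSpace ℝ (Fin l) := LinearMap.toContinuousLinearMap
    ((vecDeriv (𝓡 (m + n)) Q (S.inclM h)).toLinearMap ∘ₗ G.anchor (S.inclM h) ∘ₗ σh h)
  have hTapply : ∀ h c, T h c = vecDeriv (𝓡 (m + n)) Q (S.inclM h) (σ c h).1.1 +
      vecDeriv (𝓡 (m + n)) Q (S.inclM h) (σ c h).2.1 := fun h c =>
    map_add (vecDeriv (𝓡 (m + n)) Q (S.inclM h)) _ _
  have hTsmooth : ∀ h ∈ U₁ ∩ W, ContMDiffAt (𝓡 (m + r)) 𝓘(ℝ,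
      V →L[ℝ] EuclideanSpace ℝ (Fin l)) ∞
      T h := by
    rintro h ⟨hh, hhW'⟩
    refine contMDiffAt_clm_of_apply fun c => ?_
    simp only [hTapply]
    exact (ContMDiffAt.vecDeriv_comp hU₂ hQ (hσ c h hh).1 (hWU hhW')).add
      (ContMDiffAt.vecDeriv_comp hU₂ hQ (hσ c h hh).2 (hWU hhW'))
  have hTker : ∀ h ∈ W, ∀ c, T h c = 0 ↔ σ c h ∈ S.preTangent h := fun h hh c =>
    hQker h hh (G.anchor (S.inclM h) (σ c h))
  have hdim : Module.finrank ℝ V =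
      Module.finrank ℝ (EuclideanSpace ℝ (Fin l)) + 2 * r := by
    rw [hV, finrank_euclideanSpace_fin]
    omega
  -- the bound on the rank of the kernel makes `T h₀` surjective
  have hsurj : Function.Surjective (T h₀) := by
    have hfin := finiteDimensional_tangentSpace (m := m) (n := n) (S.inclM h₀)
    have h1 : Module.finrank ℝ (LinearMap.ker (T h₀).toLinearMap) ≤ 2 * r := by
      refine le_trans ?_ (hrank h₀)
      refine LinearMap.finrank_le_finrank_of_injective
        (f := ((σh h₀) ∘ₗ (LinearMap.ker (T h₀).toLinearMap).subtype).codRestrict _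
          fun c => ⟨(hTker h₀ hhW c.1).1 c.2, ((hσF h₀ hh₁).2 _).2 ⟨c.1, rfl⟩⟩) ?_
      intro c c' hcc'
      exact Subtype.ext ((hσF h₀ hh₁).1 (congrArg Subtype.val hcc'))
    have h2 := (T h₀).toLinearMap.finrank_range_add_finrank_ker
    have h3 : LinearMap.range (T h₀).toLinearMap = ⊤ := by
      refine Submodule.eq_top_of_finrank_eq (le_antisymm (Submodule.finrank_le _) ?_)
      omega
    exact LinearMap.range_eq_top.1 h3
  obtain ⟨U, hUU, hU, hhU, s, hs, hsker⟩ :=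
    exists_smooth_frame_ker (hU₁.inter hW) ⟨hh₁, hhW⟩ hTsmooth hsurj hdim
  refine ⟨U, hU, hhU, fun j h => σ (s j h) h, fun j => ?_, fun h hh => ?_⟩
  · let b := Module.finBasis ℝ V
    have hc : ∀ i, ∀ h ∈ U, ContMDiffAt (𝓡 (m + r)) 𝓘(ℝ, ℝ) ∞ (fun h => b.repr (s j h) i) h :=
      fun i h hh => (LinearMap.toContinuousLinearMap (b.coord i)).contMDiff.contMDiffAt.comp h
        (hs j h hh)
    have hsum : ∀ h, σ (s j h) h = ∑ i, b.repr (s j h) i • σ (b i) h := fun h => by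
      have : σ (s j h) = ∑ i, b.repr (s j h) i • σ (b i) := by
        conv_lhs => rw [← b.sum_repr (s j h), map_sum]
        simp
      rw [this]
      simp
    constructor
    · intro h hh
      have h1 := ContMDiffAt.sum_smul_along (W := (TangentSpace (𝓡 (m + n)) : Γ → Type _))
        (φ := S.inclM) (X := fun i h => (σ (b i) h).1.1) (c := fun i h => b.repr (s j h) i)
        Finset.univ hincl.contMDiffAt (fun i _ => (hσ (b i) h (hUU hh).1).1)
        (fun i _ => hc i h hh)
      refine ContMDiffAt.contMDiffWithinAt (h1.congr_of_eventuallyEq ?_)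
      refine Filter.Eventually.of_forall fun h => ?_
      simp only [hsum]
      exact congrArg (fun v => (⟨S.inclM h, v⟩ : TangentBundle (𝓡 (m + n)) Γ))
        (map_sum ((G.vertTgt (S.inclM h)).subtype ∘ₗ LinearMap.fst ℝ _ _) _ _)
    · intro h hh
      have h1 := ContMDiffAt.sum_smul_along (W := (TangentSpace (𝓡 (m + n)) : Γ → Type _))
        (φ := S.inclM) (X := fun i h => (σ (b i) h).2.1) (c := fun i h => b.repr (s j h) i)
        Finset.univ hincl.contMDiffAt (fun i _ => (hσ (b i) h (hUU hh).1).2)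
        (fun i _ => hc i h hh)
      refine ContMDiffAt.contMDiffWithinAt (h1.congr_of_eventuallyEq ?_)
      refine Filter.Eventually.of_forall fun h => ?_
      simp only [hsum]
      exact congrArg (fun v => (⟨S.inclM h, v⟩ : TangentBundle (𝓡 (m + n)) Γ))
        (map_sum ((G.vertSrc (S.inclM h)).subtype ∘ₗ LinearMap.snd ℝ _ _) _ _)
  · obtain ⟨h1, h2⟩ := hsker h hh
    obtain ⟨h3, h4⟩ := hσF h (hUU hh).1
    refine ⟨h1.map' (σh h) (LinearMap.ker_eq_bot.2 h3), ?_⟩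
    have h5 : (range fun j => σ (s j h) h) = σh h '' range fun j => s j h := by
      rw [← range_comp]; rfl
    rw [h5, Submodule.span_image, h2]
    ext u
    constructor
    · rintro ⟨c, hc, rfl⟩
      exact ⟨(hTker h (hUU hh).2 c).1 hc, (h4 _).2 ⟨c, rfl⟩⟩
    · rintro ⟨hu1, hu2⟩
      obtain ⟨c, rfl⟩ := (h4 u).1 hu2
      exact ⟨c, (hTker h (hUU hh).2 c).2 hu1, rfl⟩

theorem isSubbundle_subH (H : ∀ h, S.IsRightNondegenerate h) :
    S.IsSubbundle (2 * r) S.subH := by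
  refine S.isSubbundle_of_frame (V := EuclideanSpace ℝ (Fin r) × EuclideanSpace ℝ (Fin n))
    (by simp) (fun h => S.subF (S.inclM h)) (fun h => S.finrank_subH_le (H h)) fun h₀ => ?_
  have hincl : ContMDiff (𝓡 (m + r)) (𝓡 (m + n)) ∞ S.inclM :=
    S.isSmoothEmbedding_inclM.isImmersion.contMDiff
  have hsrc : Continuous G.src := G.isSubmersion_src.contMDiff.continuous
  have htgt : Continuous G.tgt := G.isSubmersion_tgt.contMDiff.continuous
  obtain ⟨V, hV, hxV, s, hs, hsb⟩ := G.exists_frame (G.tgt (S.inclM h₀))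
  let e := trivializationAt (EuclideanSpace ℝ (Fin r)) D (G.src (S.inclM h₀))
  refine ⟨(fun h => G.src (S.inclM h)) ⁻¹' e.baseSet ∩ (fun h => G.tgt (S.inclM h)) ⁻¹' V,
    (e.open_baseSet.preimage (hsrc.comp hincl.continuous)).inter
      (hV.preimage (htgt.comp hincl.continuous)),
    ⟨FiberBundle.mem_baseSet_trivializationAt' _, hxV⟩,
    LinearMap.pi (fun h => LinearMap.proj (S.inclM h)) ∘ₗ
      G.prolFrame (S.frameD (G.src (S.inclM h₀))) s, ?_, ?_⟩
  · rintro c h ⟨h1, h2⟩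
    exact ⟨(G.contMDiffAt_rightField _ _ (S.sectionSmoothAt_frameD h1 c.1)).comp h
        hincl.contMDiffAt,
      (G.contMDiffAt_leftField _ _ (hs c.2 _ h2)).comp h hincl.contMDiffAt⟩
  · rintro h ⟨h1, h2⟩
    exact ⟨LieGroupoid.prolFrame_injective (a := S.frameD (G.src (S.inclM h₀))) (b := s)
      (g := S.inclM h) (S.frameD_injective h1) (hsb _ h2).1,
      fun u => S.mem_subF_iff_exists_prolFrame h1 (hsb _ h2).2 u⟩

theorem isSubbundle_subHbar (H : ∀ g, S.IsLeftNondegenerate g) :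
    S.IsSubbundle (2 * r) S.subHbar := by
  refine S.isSubbundle_of_frame (V := EuclideanSpace ℝ (Fin n) × EuclideanSpace ℝ (Fin r))
    (by simp [add_comm]) (fun h => S.subFbar (S.inclM h)) (fun h => S.finrank_subHbar_le (H h))
    fun h₀ => ?_
  have hincl : ContMDiff (𝓡 (m + r)) (𝓡 (m + n)) ∞ S.inclM :=
    S.isSmoothEmbedding_inclM.isImmersion.contMDiff
  have hsrc : Continuous G.src := G.isSubmersion_src.contMDiff.continuous
  have htgt : Continuous G.tgt := G.isSubmersion_tgt.contMDiff.continuous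
  obtain ⟨V, hV, hxV, s, hs, hsb⟩ := G.exists_frame (G.src (S.inclM h₀))
  let e := trivializationAt (EuclideanSpace ℝ (Fin r)) D (G.tgt (S.inclM h₀))
  refine ⟨(fun h => G.src (S.inclM h)) ⁻¹' V ∩ (fun h => G.tgt (S.inclM h)) ⁻¹' e.baseSet,
    (hV.preimage (hsrc.comp hincl.continuous)).inter
      (e.open_baseSet.preimage (htgt.comp hincl.continuous)),
    ⟨hxV, FiberBundle.mem_baseSet_trivializationAt' _⟩,
    LinearMap.pi (fun h => LinearMap.proj (S.inclM h)) ∘ₗ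
      G.prolFrame s (S.frameD (G.tgt (S.inclM h₀))), ?_, ?_⟩
  · rintro c h ⟨h1, h2⟩
    exact ⟨(G.contMDiffAt_rightField _ _ (hs c.1 _ h1)).comp h hincl.contMDiffAt,
      (G.contMDiffAt_leftField _ _ (S.sectionSmoothAt_frameD h2 c.2)).comp h hincl.contMDiffAt⟩
  · rintro h ⟨h1, h2⟩
    exact ⟨LieGroupoid.prolFrame_injective (a := s) (b := S.frameD (G.tgt (S.inclM h₀)))
      (g := S.inclM h) (hsb _ h1).1 (S.frameD_injective h2),
      fun u => S.mem_subFbar_iff_exists_prolFrame h2 (hsb _ h1).2 u⟩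

end NonholonomicSystem

/-! ### Legendre transformations -/

section VectorBundle

variable {E H E' H' N B F : Type*} [NormedAddCommGroup E] [NormedSpace ℝ E] [TopologicalSpace H]
  [NormedAddCommGroup E'] [NormedSpace ℝ E'] [TopologicalSpace H']
  {I : ModelWithCorners ℝ E H} {J : ModelWithCorners ℝ E' H'}
  [TopologicalSpace B] [ChartedSpace H B] [TopologicalSpace N] [ChartedSpace H' N]
  [NormedAddCommGroup F] [NormedSpace ℝ F]
  {W : B → Type*} [∀ x, AddCommGroup (W x)] [∀ x, Module ℝ (W x)] [∀ x, TopologicalSpace (W x)]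
  [TopologicalSpace (Bundle.TotalSpace F W)] [FiberBundle F W] [VectorBundle ℝ F W]
  [ContMDiffVectorBundle ∞ F W I]

/-- The kernel of the derivative of a map into a vector bundle, read in a trivialization. -/
theorem mfderiv_totalSpace_eq_zero_iff {f : N → Bundle.TotalSpace F W} {x : N}
    (hf : ContMDiffAt J (I.prod 𝓘(ℝ, F)) ∞ f x) (z : TangentSpace J x) :
    mfderiv J (I.prod 𝓘(ℝ, F)) f x z = 0 ↔
      mfderiv J I (fun y => (f y).proj) x z = 0 ∧
      vecDeriv J (fun y => (trivializationAt F W (f x).proj (f y)).2) x z = 0 := by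
  let e := trivializationAt F W (f x).proj
  have hx : f x ∈ e.source := FiberBundle.mem_trivializationAt_proj_source
  have he : e.toOpenPartialHomeomorph.MDifferentiable (I.prod 𝓘(ℝ, F)) (I.prod 𝓘(ℝ, F)) :=
    ⟨(e.contMDiffOn (n := ∞)).mdifferentiableOn (by simp),
     (e.contMDiffOn_symm (n := ∞)).mdifferentiableOn (by simp)⟩
  obtain ⟨h1, h2⟩ := Bundle.contMDiffAt_totalSpace.1 hf
  have h1' := h1.mdifferentiableAt (by simp)
  have h2' := h2.mdifferentiableAt (by simp)
  have h3 := (he.mdifferentiableAt hx).hasMFDerivAt.comp x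
    (hf.mdifferentiableAt (by simp)).hasMFDerivAt
  have h4 := h1'.hasMFDerivAt.prodMk h2'.hasMFDerivAt
  have h5 : (fun y => ((f y).proj, (e (f y)).2)) =ᶠ[𝓝 x] e ∘ f := by
    filter_upwards [hf.continuousAt (e.open_source.mem_nhds hx)] with y hy
    exact Prod.ext (e.coe_fst hy).symm rfl
  have h6 := congrArg (fun L => L z) (hasMFDerivAt_unique (h3.congr_of_eventuallyEq h5) h4)
  have hinj := he.mfderiv_injective hx
  constructor
  · intro h
    have h7 : mfderiv (I.prod 𝓘(ℝ, F)) (I.prod 𝓘(ℝ, F)) e (f x)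
      (mfderiv J (I.prod 𝓘(ℝ, F)) f x z) = 0 := (congrArg _ h).trans (map_zero _)
    have h8 := h6.symm.trans h7
    exact ⟨congrArg Prod.fst h8, congrArg Prod.snd h8⟩
  · rintro ⟨h7, h8⟩
    have h9 := congrArg₂ (fun (a : E) (b : F) => (a, b)) h7 h8
    exact hinj ((h6.trans h9).trans (map_zero _).symm)

end VectorBundle

namespace LieGroupoid

variable {m n : ℕ} {Γ M : Type*}
  [TopologicalSpace Γ] [ChartedSpace (EuclideanSpace ℝ (Fin (m + n))) Γ]
  [IsManifold (𝓡 (m + n)) ∞ Γ]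
  [TopologicalSpace M] [ChartedSpace (EuclideanSpace ℝ (Fin m)) M]
  [IsManifold (𝓡 m) ∞ M]
  (G : LieGroupoid m n Γ M)

/-- `v(L ∘ l_g) = (T l_g v)(L)`. -/
theorem fiberDeriv_mul_left {L : Γ → ℝ} {g : Γ} (hL : MDifferentiableAt (𝓡 (m + n)) 𝓘(ℝ, ℝ) L g)
    (b : ∀ x, G.algFiber x) :
    G.fiberDeriv (fun k => L (G.mul g k)) (G.tgt g) (b (G.tgt g)).1 = G.derivLeft L b g := by
  obtain ⟨d, hd0, hdx, hd, hdb⟩ := exists_curve_in_fiber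
    (G.isSubmersion_src.isSubmersionAt (G.unit (G.tgt g))) (b (G.tgt g)).1 (b (G.tgt g)).2
  rw [G.src_unit] at hdx
  have h1 := hasDerivAt_mul_curve rfl hd0 hdx hd hdb hL
  have hm := G.mdifferentiableWithinAt_mul_left g rfl (G.src_unit (G.tgt g))
  have hLm : MDifferentiableWithinAt (𝓡 (m + n)) 𝓘(ℝ, ℝ) (fun k => L (G.mul g k))
      (G.src ⁻¹' {G.tgt g}) (G.unit (G.tgt g)) :=
    MDifferentiableAt.comp_mdifferentiableWithinAt (G.unit (G.tgt g))
      (show MDifferentiableAt (𝓡 (m + n)) 𝓘(ℝ, ℝ) L (G.mul g (G.unit (G.tgt g))) by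
        rwa [G.mul_unit]) hm
  have h2 := mfderiv_comp_curve_fiber hd0 hLm hd hdx _ hdb
  refine h2.symm.trans ?_
  rw [mfderiv_eq_fderiv]
  exact h1.deriv

/-- `-v(L ∘ r_g ∘ i) = -(T (r_g ∘ i) v)(L)`. -/
theorem neg_fiberDeriv_inv_mul {L : Γ → ℝ} {g : Γ}
    (hL : MDifferentiableAt (𝓡 (m + n)) 𝓘(ℝ, ℝ) L g) (a : ∀ x, G.algFiber x) :
    -G.fiberDeriv (fun k => L (G.mul (G.inv k) g)) (G.src g) (a (G.src g)).1 =
      G.derivRight L a g := by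
  obtain ⟨c, hc0, hcx, hc, hca⟩ := exists_curve_in_fiber
    (G.isSubmersion_src.isSubmersionAt (G.unit (G.src g))) (a (G.src g)).1 (a (G.src g)).2
  rw [G.src_unit] at hcx
  have h1 := hasDerivAt_inv_curve_mul rfl hc0 hcx hc hca hL
  have hm := G.mdifferentiableWithinAt_inv_mul g rfl (G.src_unit (G.src g))
  have hLm : MDifferentiableWithinAt (𝓡 (m + n)) 𝓘(ℝ, ℝ) (fun k => L (G.mul (G.inv k) g))
      (G.src ⁻¹' {G.src g}) (G.unit (G.src g)) :=
    MDifferentiableAt.comp_mdifferentiableWithinAt (G.unit (G.src g))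
      (show MDifferentiableAt (𝓡 (m + n)) 𝓘(ℝ, ℝ) L (G.mul (G.inv (G.unit (G.src g))) g) by
        rwa [G.inv_unit, G.unit_mul]) hm
  have h2 := mfderiv_comp_curve_fiber hc0 hLm hc hcx _ hca
  refine (congrArg Neg.neg h2).symm.trans ?_
  rw [mfderiv_eq_fderiv]
  exact (congrArg Neg.neg h1.deriv).trans (neg_neg _)

end LieGroupoid

namespace NonholonomicSystem

variable {m n : ℕ} {Γ M : Type*}
  [TopologicalSpace Γ] [ChartedSpace (EuclideanSpace ℝ (Fin (m + n))) Γ]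
  [IsManifold (𝓡 (m + n)) ∞ Γ]
  [TopologicalSpace M] [ChartedSpace (EuclideanSpace ℝ (Fin m)) M]
  [IsManifold (𝓡 m) ∞ M]
  {G : LieGroupoid m n Γ M} {r : ℕ}
  {Mc : Type*} [TopologicalSpace Mc] [ChartedSpace (EuclideanSpace ℝ (Fin (m + r))) Mc]
  [IsManifold (𝓡 (m + r)) ∞ Mc]
  {D : M → Type*} [∀ x, AddCommGroup (D x)] [∀ x, Module ℝ (D x)]
  [∀ x, TopologicalSpace (D x)]
  [TopologicalSpace (Bundle.TotalSpace (EuclideanSpace ℝ (Fin r)) D)]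
  [FiberBundle (EuclideanSpace ℝ (Fin r)) D] [VectorBundle ℝ (EuclideanSpace ℝ (Fin r)) D]
  [ContMDiffVectorBundle ∞ (EuclideanSpace ℝ (Fin r)) D (𝓡 m)]
  (S : NonholonomicSystem G r Mc D)

theorem contMDiff_inclM : ContMDiff (𝓡 (m + r)) (𝓡 (m + n)) ∞ S.inclM :=
  S.isSmoothEmbedding_inclM.isImmersion.contMDiff

/-- The coordinates of a covector of `D_c` in the local trivialization of `D_c^*` near `x₀`. -/
theorem trivializationAt_dualD_apply (x₀ : M) (p : S.DualD) (w : EuclideanSpace ℝ (Fin r)) :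
    (trivializationAt (EuclideanSpace ℝ (Fin r) →L[ℝ] ℝ)
      (fun x => D x →L[ℝ] Bundle.Trivial M ℝ x) x₀ p).2 w =
      p.2 ((trivializationAt (EuclideanSpace ℝ (Fin r)) D x₀).symmL ℝ p.proj w) := by
  rw [hom_trivializationAt_apply]
  simp [ContinuousLinearMap.inCoordinates]

section Legendre

variable {S} {leg : Mc → S.DualD} {h : Mc}
  (hproj : ContMDiffAt (𝓡 (m + r)) (𝓡 m) ∞ (fun k => (leg k).proj) h)
  {ψ : EuclideanSpace ℝ (Fin r) → Γ → ℝ}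
  (hψ : ∀ w k, (leg k).2 ((trivializationAt (EuclideanSpace ℝ (Fin r)) D (leg h).proj).symmL ℝ
    (leg k).proj w) = ψ w (S.inclM k))
  (hψs : ∀ w, ContMDiffAt (𝓡 (m + n)) 𝓘(ℝ, ℝ) ∞ (ψ w) (S.inclM h))
include hproj hψ hψs

/-- A map `leg` to `D_c^*` over a smooth map is smooth if its coordinates `ψ w` are. -/
theorem contMDiffAt_dualD : ContMDiffAt (𝓡 (m + r))
    ((𝓡 m).prod 𝓘(ℝ, EuclideanSpace ℝ (Fin r) →L[ℝ] ℝ)) ∞ leg h := by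
  rw [Bundle.contMDiffAt_totalSpace]
  refine ⟨hproj, contMDiffAt_clm_of_apply fun w => ?_⟩
  simp only [trivializationAt_dualD_apply, hψ]
  exact (hψs w).comp h S.contMDiff_inclM.contMDiffAt

theorem mfderiv_dualD_eq_zero_iff (z : TangentSpace (𝓡 (m + r)) h) :
    mfderiv (𝓡 (m + r)) ((𝓡 m).prod 𝓘(ℝ, EuclideanSpace ℝ (Fin r) →L[ℝ] ℝ)) leg h z = 0 ↔
      mfderiv (𝓡 (m + r)) (𝓡 m) (fun k => (leg k).proj) h z = 0 ∧
      ∀ w, LieGroupoid.dirDeriv (ψ w) (S.inclM h)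
        (mfderiv (𝓡 (m + r)) (𝓡 (m + n)) S.inclM h z) = 0 := by
  have hleg := contMDiffAt_dualD hproj hψ hψs
  rw [mfderiv_totalSpace_eq_zero_iff hleg]
  refine and_congr_right fun _ => ?_
  have h1 := (Bundle.contMDiffAt_totalSpace.1 hleg).2.mdifferentiableAt (by simp)
  have h2 : ∀ w, vecDeriv (𝓡 (m + r)) (fun k => (trivializationAt
      (EuclideanSpace ℝ (Fin r) →L[ℝ] ℝ) (fun x => D x →L[ℝ] Bundle.Trivial M ℝ x)
      (leg h).proj (leg k)).2) h z w = LieGroupoid.dirDeriv (ψ w) (S.inclM h)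
        (mfderiv (𝓡 (m + r)) (𝓡 (m + n)) S.inclM h z) := by
    intro w
    let A : (EuclideanSpace ℝ (Fin r) →L[ℝ] ℝ) →L[ℝ] ℝ := ContinuousLinearMap.apply ℝ ℝ w
    have h3 := vecDeriv_comp (f := A) A.differentiableAt.mdifferentiableAt h1 z
    have h4 := vecDeriv_comp ((hψs w).mdifferentiableAt (by simp))
      (S.contMDiff_inclM.mdifferentiableAt (x := h) (by simp)) z
    have h5 : A ∘ (fun k => (trivializationAt
      (EuclideanSpace ℝ (Fin r) →L[ℝ] ℝ) (fun x => D x →L[ℝ] Bundle.Trivial M ℝ x)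
      (leg h).proj (leg k)).2) = ψ w ∘ S.inclM := by
      funext k
      exact (trivializationAt_dualD_apply S _ _ w).trans (hψ w k)
    rw [h5, h4] at h3
    refine Eq.trans ?_ h3.symm
    refine Eq.trans ?_ (vecDeriv_vectorSpace _ _ _).symm
    rw [A.fderiv]
    rfl
  constructor
  · intro h3 w
    rw [← h2, h3]
    rfl
  · intro h3
    ext w
    exact (h2 w).trans (h3 w)

end Legendre

theorem mfderiv_inclM_injective (h : Mc) :
    Function.Injective (mfderiv (𝓡 (m + r)) (𝓡 (m + n)) S.inclM h) :=
  (S.isSmoothEmbedding_inclM.isImmersion.isImmersionAt h).mfderiv_injective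

theorem mdifferentiableAt_L (g : Γ) : MDifferentiableAt (𝓡 (m + n)) 𝓘(ℝ, ℝ) S.L g :=
  S.contMDiff_L.mdifferentiableAt (by simp)

/-- The coordinates of `F⁻` are the derivatives of `L` along right-invariant fields. -/
theorem legendreMinus_symmL (x₀ : M) (w : EuclideanSpace ℝ (Fin r)) (k : Mc) :
    (S.legendreMinus k).2 ((trivializationAt (EuclideanSpace ℝ (Fin r)) D x₀).symmL ℝ
      (S.legendreMinus k).proj w) = G.derivRight S.L (S.frameD x₀ w) (S.inclM k) :=
  G.neg_fiberDeriv_inv_mul (S.mdifferentiableAt_L _) (S.frameD x₀ w)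

/-- The coordinates of `F⁺` are the derivatives of `L` along left-invariant fields. -/
theorem legendrePlus_symmL (x₀ : M) (w : EuclideanSpace ℝ (Fin r)) (k : Mc) :
    (S.legendrePlus k).2 ((trivializationAt (EuclideanSpace ℝ (Fin r)) D x₀).symmL ℝ
      (S.legendrePlus k).proj w) = G.derivLeft S.L (S.frameD x₀ w) (S.inclM k) :=
  G.fiberDeriv_mul_left (S.mdifferentiableAt_L _) (S.frameD x₀ w)

theorem contMDiff_legendreMinus : ContMDiff (𝓡 (m + r))
    ((𝓡 m).prod 𝓘(ℝ, EuclideanSpace ℝ (Fin r) →L[ℝ] ℝ)) ∞ S.legendreMinus := fun _ =>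
  contMDiffAt_dualD ((G.isSubmersion_src.contMDiff.comp S.contMDiff_inclM).contMDiffAt)
    (S.legendreMinus_symmL _) fun w => LieGroupoid.contMDiffAt_derivRight S.contMDiff_L
      (S.sectionSmoothAt_frameD (FiberBundle.mem_baseSet_trivializationAt' _) w)

theorem contMDiff_legendrePlus : ContMDiff (𝓡 (m + r))
    ((𝓡 m).prod 𝓘(ℝ, EuclideanSpace ℝ (Fin r) →L[ℝ] ℝ)) ∞ S.legendrePlus := fun _ =>
  contMDiffAt_dualD ((G.isSubmersion_tgt.contMDiff.comp S.contMDiff_inclM).contMDiffAt)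
    (S.legendrePlus_symmL _) fun w => LieGroupoid.contMDiffAt_derivLeft S.contMDiff_L
      (S.sectionSmoothAt_frameD (FiberBundle.mem_baseSet_trivializationAt' _) w)

/-- `z` is in the kernel of the derivative of `F⁻` if and only if its image in `T Γ` is in `V α`
and pairs to zero with `D_c`. -/
theorem mfderiv_legendreMinus_eq_zero_iff {h : Mc} (z : TangentSpace (𝓡 (m + r)) h)
    (Y : TangentSpace (𝓡 (m + n)) (S.inclM h))
    (hz : mfderiv (𝓡 (m + r)) (𝓡 (m + n)) S.inclM h z = Y) :
    mfderiv (𝓡 (m + r)) ((𝓡 m).prod 𝓘(ℝ, EuclideanSpace ℝ (Fin r) →L[ℝ] ℝ)) S.legendreMinus h z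
      = 0 ↔ ∃ hY : Y ∈ G.vertSrc (S.inclM h), ∀ a ∈ S.fiberD (G.src (S.inclM h)),
        S.pairing (S.inclM h) (G.tangentRightInv (S.inclM h) a) ⟨Y, hY⟩ = 0 := by
  have hb := FiberBundle.mem_baseSet_trivializationAt' (F := EuclideanSpace ℝ (Fin r)) (E := D)
    (G.src (S.inclM h))
  have hs := fun w => S.sectionSmoothAt_frameD hb w
  rw [mfderiv_dualD_eq_zero_iff
    ((G.isSubmersion_src.contMDiff.comp S.contMDiff_inclM).contMDiffAt)
    (S.legendreMinus_symmL _) fun w => LieGroupoid.contMDiffAt_derivRight S.contMDiff_L (hs w)]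
  have h1 : mfderiv (𝓡 (m + r)) (𝓡 m) (fun k => (S.legendreMinus k).proj) h z =
      mfderiv (𝓡 (m + n)) (𝓡 m) G.src (S.inclM h) Y := by
    rw [← hz]
    exact congrArg (fun L => L z) (mfderiv_comp h (G.mdifferentiableAt_src _)
      (S.contMDiff_inclM.mdifferentiableAt (by simp)))
  rw [h1, hz, ← exists_prop]
  refine exists_congr fun hY => ?_
  have h2 : ∀ w, LieGroupoid.dirDeriv (G.derivRight S.L (S.frameD (G.src (S.inclM h)) w))
      (S.inclM h) Y = -S.pairing (S.inclM h) (G.tangentRightInv (S.inclM h)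
        (S.frameD (G.src (S.inclM h)) w (G.src (S.inclM h)))) ⟨Y, hY⟩ := by
    intro w
    rw [← LinearMap.neg_apply, ← map_neg]
    exact (LieGroupoid.crossDeriv_rightField S.contMDiff_L (hs w) ⟨Y, hY⟩).symm
  constructor
  · intro h3 a ha
    obtain ⟨w, rfl⟩ := S.exists_frameD_eq hb ha
    exact neg_eq_zero.1 ((h2 w).symm.trans (h3 w))
  · intro h3 w
    exact (h2 w).trans (neg_eq_zero.2 (h3 _ (S.frameD_mem _ w _)))

theorem mfderiv_legendrePlus_eq_zero_iff {g : Mc} (z : TangentSpace (𝓡 (m + r)) g)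
    (X : TangentSpace (𝓡 (m + n)) (S.inclM g))
    (hz : mfderiv (𝓡 (m + r)) (𝓡 (m + n)) S.inclM g z = X) :
    mfderiv (𝓡 (m + r)) ((𝓡 m).prod 𝓘(ℝ, EuclideanSpace ℝ (Fin r) →L[ℝ] ℝ)) S.legendrePlus g z
      = 0 ↔ ∃ hX : X ∈ G.vertTgt (S.inclM g), ∀ b ∈ S.fiberD (G.tgt (S.inclM g)),
        S.pairing (S.inclM g) ⟨X, hX⟩ (G.tangentLeft (S.inclM g) b) = 0 := by
  have hb := FiberBundle.mem_baseSet_trivializationAt' (F := EuclideanSpace ℝ (Fin r)) (E := D)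
    (G.tgt (S.inclM g))
  have hs := fun w => S.sectionSmoothAt_frameD hb w
  rw [mfderiv_dualD_eq_zero_iff
    ((G.isSubmersion_tgt.contMDiff.comp S.contMDiff_inclM).contMDiffAt)
    (S.legendrePlus_symmL _) fun w => LieGroupoid.contMDiffAt_derivLeft S.contMDiff_L (hs w)]
  have h1 : mfderiv (𝓡 (m + r)) (𝓡 m) (fun k => (S.legendrePlus k).proj) g z =
      mfderiv (𝓡 (m + n)) (𝓡 m) G.tgt (S.inclM g) X := by
    rw [← hz]
    exact congrArg (fun L => L z) (mfderiv_comp g (G.mdifferentiableAt_tgt _)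
      (S.contMDiff_inclM.mdifferentiableAt (by simp)))
  rw [h1, hz, ← exists_prop]
  refine exists_congr fun hX => ?_
  have h2 : ∀ w, LieGroupoid.dirDeriv (G.derivLeft S.L (S.frameD (G.tgt (S.inclM g)) w))
      (S.inclM g) X = S.pairing (S.inclM g) ⟨X, hX⟩ (G.tangentLeft (S.inclM g)
        (S.frameD (G.tgt (S.inclM g)) w (G.tgt (S.inclM g)))) := fun w =>
    (LieGroupoid.crossDeriv_leftField S.contMDiff_L (hs w) ⟨X, hX⟩).symm
  constructor
  · intro h3 b hb'
    obtain ⟨w, rfl⟩ := S.exists_frameD_eq hb hb'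
    exact (h2 w).symm.trans (h3 w)
  · intro h3 w
    exact (h2 w).trans (h3 _ (S.frameD_mem _ w _))

/-- `M_c` and `D_c^*` have the same dimension. -/
theorem finrank_model_dualD : Module.finrank ℝ (EuclideanSpace ℝ (Fin (m + r))) =
    Module.finrank ℝ (EuclideanSpace ℝ (Fin m) × (EuclideanSpace ℝ (Fin r) →L[ℝ] ℝ)) := by
  have h1 : Module.finrank ℝ (EuclideanSpace ℝ (Fin r) →L[ℝ] ℝ) = r := by
    rw [← (LinearMap.toContinuousLinearMap (𝕜 := ℝ) (E := EuclideanSpace ℝ (Fin r))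
      (F' := ℝ)).finrank_eq]
    exact Subspace.dual_finrank_eq.trans finrank_euclideanSpace_fin
  rw [Module.finrank_prod, finrank_euclideanSpace_fin, finrank_euclideanSpace_fin, h1]

theorem isLocalDiffeomorphAt_legendreMinus_iff (h : Mc) :
    IsLocalDiffeomorphAt (𝓡 (m + r)) ((𝓡 m).prod 𝓘(ℝ, EuclideanSpace ℝ (Fin r) →L[ℝ] ℝ)) ∞
      S.legendreMinus h ↔ S.IsRightNondegenerate h := by
  rw [isLocalDiffeomorphAt_iff_ker_mfderiv finrank_model_dualD S.contMDiff_legendreMinus,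
    isRightNondegenerate_iff]
  constructor
  · rintro H ⟨Y, hY⟩ ⟨z, hz⟩ h1
    have h2 := H z ((S.mfderiv_legendreMinus_eq_zero_iff z Y hz).2 ⟨hY, h1⟩)
    refine Subtype.ext (hz.symm.trans ?_)
    rw [h2]
    exact map_zero _
  · intro H z hz
    obtain ⟨hY, h1⟩ := (S.mfderiv_legendreMinus_eq_zero_iff z _ rfl).1 hz
    have h2 := congrArg Subtype.val (H ⟨_, hY⟩ ⟨z, rfl⟩ h1)
    exact S.mfderiv_inclM_injective h (h2.trans (map_zero _).symm)

theorem isLocalDiffeomorphAt_legendrePlus_iff (g : Mc) :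
    IsLocalDiffeomorphAt (𝓡 (m + r)) ((𝓡 m).prod 𝓘(ℝ, EuclideanSpace ℝ (Fin r) →L[ℝ] ℝ)) ∞
      S.legendrePlus g ↔ S.IsLeftNondegenerate g := by
  rw [isLocalDiffeomorphAt_iff_ker_mfderiv finrank_model_dualD S.contMDiff_legendrePlus,
    isLeftNondegenerate_iff]
  constructor
  · rintro H ⟨X, hX⟩ ⟨z, hz⟩ h1
    have h2 := H z ((S.mfderiv_legendrePlus_eq_zero_iff z X hz).2 ⟨hX, h1⟩)
    refine Subtype.ext (hz.symm.trans ?_)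
    rw [h2]
    exact map_zero _
  · intro H z hz
    obtain ⟨hX, h1⟩ := (S.mfderiv_legendrePlus_eq_zero_iff z _ rfl).1 hz
    have h2 := congrArg Subtype.val (H ⟨_, hX⟩ ⟨z, rfl⟩ h1)
    exact S.mfderiv_inclM_injective g (h2.trans (map_zero _).symm)

/-- A smooth frame exhibits the rank of a subbundle. -/
theorem IsSubbundle.finrank_eq {S : NonholonomicSystem G r Mc D} {k : ℕ}
    {W : ∀ h : Mc, Submodule ℝ (G.Prol (S.inclM h))} (hW : S.IsSubbundle k W) (h : Mc) :
    Module.finrank ℝ (W h) = k := by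
  obtain ⟨U, -, hh, s, -, hs⟩ := hW h
  rw [← (hs h hh).2, finrank_span_eq_card (hs h hh).1, Fintype.card_fin]

end NonholonomicSystem

/-! ### Equivalence of the regularity conditions -/

theorem corollary3p12 {m n r : ℕ} {Γ M Mc : Type*}
    [TopologicalSpace Γ] [ChartedSpace (EuclideanSpace ℝ (Fin (m + n))) Γ]
    [IsManifold (𝓡 (m + n)) ∞ Γ]
    [TopologicalSpace M] [ChartedSpace (EuclideanSpace ℝ (Fin m)) M]
    [IsManifold (𝓡 m) ∞ M]
    [TopologicalSpace Mc] [ChartedSpace (EuclideanSpace ℝ (Fin (m + r))) Mc]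
    [IsManifold (𝓡 (m + r)) ∞ Mc]
    {D : M → Type*} [∀ x, AddCommGroup (D x)] [∀ x, Module ℝ (D x)]
    [∀ x, TopologicalSpace (D x)]
    [TopologicalSpace (Bundle.TotalSpace (EuclideanSpace ℝ (Fin r)) D)]
    [FiberBundle (EuclideanSpace ℝ (Fin r)) D] [VectorBundle ℝ (EuclideanSpace ℝ (Fin r)) D]
    [ContMDiffVectorBundle ∞ (EuclideanSpace ℝ (Fin r)) D (𝓡 m)]
    (G : LieGroupoid m n Γ M) (S : NonholonomicSystem G r Mc D) :
    List.TFAE [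
      S.IsRegular,
      (∀ h : Mc, (S.preTangent h : Set (G.Prol (S.inclM h))) ∩
          S.orth (S.inclM h) (S.subF (S.inclM h)) = {0}) ∧
        (∀ g : Mc, (S.preTangent g : Set (G.Prol (S.inclM g))) ∩
          S.orth (S.inclM g) (S.subFbar (S.inclM g)) = {0}),
      S.IsSymplecticSubbundle (2 * r) S.subH ∧ S.IsSymplecticSubbundle (2 * r) S.subHbar,
      ∀ g h : Mc, S.IsRightNondegenerate h ∧ S.IsLeftNondegenerate g] := by
  tfae_have 1 ↔ 4 := by
    constructor
    · rintro ⟨h1, h2⟩ g h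
      exact ⟨(S.isLocalDiffeomorphAt_legendreMinus_iff h).1 (h1 h),
        (S.isLocalDiffeomorphAt_legendrePlus_iff g).1 (h2 g)⟩
    · intro H
      exact ⟨fun h => (S.isLocalDiffeomorphAt_legendreMinus_iff h).2 (H h h).1,
        fun g => (S.isLocalDiffeomorphAt_legendrePlus_iff g).2 (H g g).2⟩
  tfae_have 2 ↔ 4 := by
    simp only [S.preTangent_inter_orth_subF_eq_iff, S.preTangent_inter_orth_subFbar_eq_iff]
    exact ⟨fun H g h => ⟨H.1 h, H.2 g⟩, fun H => ⟨fun h => (H h h).1, fun g => (H g g).2⟩⟩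
  tfae_have 3 → 4 := fun H g h =>
    ⟨S.isRightNondegenerate_of_subH (H.1.2 h), S.isLeftNondegenerate_of_subHbar (H.2.2 g)⟩
  tfae_have 4 → 3 := by
    intro H
    have h1 := S.isSubbundle_subH fun h => (H h h).1
    have h2 := S.isSubbundle_subHbar fun g => (H g g).2
    exact ⟨⟨h1, fun h => S.eq_zero_of_omega_subH (H h h).1 (h1.finrank_eq h)⟩,
      ⟨h2, fun g => S.eq_zero_of_omega_subHbar (H g g).2 (h2.finrank_eq g)⟩⟩
  tfae_finish
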